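/- Let $H=\mathbb{F}_2[x]$ with $x$ primitive (the case $n=\infty$), or $H=\mathbb{F}_2[x]/(x^{2^n})$ for an integer $n\ge 0$. Let $\mathbb{F}_2[a,u]$ be the $H$-comodule algebra with $a$ primitive and coaction $u\mapsto u\otimes 1+1\otimes a^2x$. Let $C^s=\mathbb{F}_2[a,u]\otimes H^{\otimes s}$ be its cobar complex, a differential graded algebra whose cohomology is $\mathrm{Ext}^s_H(\mathbb{F}_2[a,u])=\mathrm{Ext}^s_H(\mathbb{F}_2,\mathbb{F}_2[a,u])$. Filter it $x$-adically: $F^pC^s$ is spanned by the elements $a^iu^j[x^{k_1}|\cdots|x^{k_s}]$ with $k_1+\cdots+k_s\ge p$. Let $\{E^{(n)}_r\}_{1\le r\le\infty}$ be the resulting multiplicative spectral sequence, with $d_r$ raising filtration by $r$. Then the following hold. 1. There is an isomorphism of $\mathbb{F}_2[a]$-algebras $E^{(n)}_1\cong\mathbb{F}_2[a,u,y_r : 0\le r<n]$, where $u$ is the class of $u\in C^0$ and $y_r$ is the class of $[x^{2^r}]$, in cohomological degree $1$ and filtration $2^r$. 2. For $m\ge 0$ and $0\le r<n$ the class $u^{2^{r+1}m}y_r$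 survives to $E_\infty$, as does $u^{2^n}$ when $n<\infty$. There are isomorphisms of $\mathbb{F}_2[a]$-algebras, sending each named generator to the class of the same name, $$E^{(\infty)}_\infty\cong\mathbb{F}_2[a,\,u^{2^{r+1}m}y_r : m,r\ge 0]\,/\,(a^{2^{r+1}}u^{2^{r+1}m}y_r : m,r\ge 0),$$ $$E^{(n)}_\infty\cong\mathbb{F}_2[a,\,u^{2^n},\,u^{2^{r+1}m}y_r : m\ge 0,\ 0\le r\le n-1]\,/\,(a^{2^{r+1}}u^{2^{r+1}m}y_r : m\ge 0,\ 0\le r\le n-1)\qquad(n<\infty).$$ Here the numerators are the subrings of $\mathbb{F}_2[a,u,y_0,y_1,\dots]$ (respectively $\mathbb{F}_2[a,u,y_0,\dots,y_{n-1}]$) generated by the listed elements, and the denominators are the ideals of these subrings generated by the listed elements. 3. The spectral sequence converges to $\mathrm{Ext}_H(\mathbb{F}_2[a,u])$ and there are no nontrivial $\mathbb{F}_2[a]$-module extensions: there is an isomorphism of $\mathbb{F}_2[a]$-modules $\Theta:\bigoplus_{s,p}E_\infty^{s,p}\to\bigoplus_s\mathrm{Ext}^s_H(\mathbb{F}_2[a,u])$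 such that, for every $z\in E_\infty^{s,p}$, the element $\Theta(z)\in\mathrm{Ext}^s$ is represented by a cocycle in $F^pC^s$ whose class in $E_\infty^{s,p}$ is $z$. -/

import Mathlib

open scoped DirectSum

namespace XAdic

noncomputable section

/-! ### The cobar complex

The Hopf algebra `H = 𝔽₂[x]` (for `N = ⊤`) or `H = 𝔽₂[x]/(x^(2^n))` (for `N = n`) has `x`
primitive, and `A = 𝔽₂[a, u]` is the `H`-comodule algebra with `a` primitive and coaction
`u ↦ u ⊗ 1 + 1 ⊗ a² x`.  The cochain group `A ⊗ H^{⊗ s}` of the cobar complex is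
the algebra `𝔽₂[a, u, x₀, …, x_{s-1}]`, or its quotient by the `xᵢ^(2^n)`; the element
`m [h₀ | … | h_{s-1}]` is `m h₀(x₀) ⋯ h_{s-1}(x_{s-1})`.  For all `s` these are
realized as nested subalgebras of one algebra in countably many variables `x₀, x₁, …`. -/

/-- The ring `𝔽₂[a]`. -/
def F2a : Type := Polynomial (ZMod 2)

instance : CommRing F2a := inferInstanceAs (CommRing (Polynomial (ZMod 2)))

instance : CharP F2a 2 := inferInstanceAs (CharP (Polynomial (ZMod 2)) 2)

/-- The class `a`. -/
def F2a.a : F2a := (Polynomial.X : Polynomial (ZMod 2))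

inductive Var : Type
  | u : Var
  | x (i : ℕ) : Var

/-- `𝔽₂[a, u, x₀, x₁, …]`, as an algebra over `𝔽₂[a]`. -/
abbrev Poly : Type := MvPolynomial Var F2a

/-- The ideal generated by the `xᵢ^(2^n)` if `N = n` is finite; the zero ideal if `N = ⊤`. -/
def truncIdeal (N : ℕ∞) : Ideal Poly :=
  Ideal.span {f | ∃ n : ℕ, N = n ∧ ∃ i : ℕ, f = MvPolynomial.X (Var.x i) ^ 2 ^ n}

/-- `𝔽₂[a, u, x₀, x₁, …]`, truncated by `xᵢ^(2^n) = 0` if `N = n` is finite. -/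
def Cob (N : ℕ∞) : Type := Poly ⧸ truncIdeal N

instance (N : ℕ∞) : CommRing (Cob N) := inferInstanceAs (CommRing (Poly ⧸ truncIdeal N))

instance (N : ℕ∞) : Algebra F2a (Cob N) := inferInstanceAs (Algebra F2a (Poly ⧸ truncIdeal N))

/-- The quotient map. -/
def Cob.mk (N : ℕ∞) : Poly →ₐ[F2a] Cob N := Ideal.Quotient.mkₐ F2a (truncIdeal N)

theorem Cob.mk_surjective (N : ℕ∞) : Function.Surjective (Cob.mk N) :=
  Ideal.Quotient.mk_surjective

def aa (N : ℕ∞) : Cob N := algebraMap F2a (Cob N) F2a.a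

def uu (N : ℕ∞) : Cob N := Cob.mk N (MvPolynomial.X Var.u)

def xx (N : ℕ∞) (i : ℕ) : Cob N := Cob.mk N (MvPolynomial.X (Var.x i))

theorem xx_pow (N : ℕ∞) (n : ℕ) (h : N = n) (i : ℕ) : xx N i ^ 2 ^ n = 0 := by
  unfold xx
  rw [← map_pow]
  refine Ideal.Quotient.eq_zero_iff_mem.mpr ?_
  exact Ideal.subset_span ⟨n, h, i, rfl⟩

theorem add_pow_two_pow (N : ℕ∞) (n : ℕ) (f g : Cob N) :
    (f + g) ^ 2 ^ n = f ^ 2 ^ n + g ^ 2 ^ n := by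
  obtain ⟨f, rfl⟩ := Cob.mk_surjective N f
  obtain ⟨g, rfl⟩ := Cob.mk_surjective N g
  rw [← map_add, ← map_pow, ← map_pow, ← map_pow, ← map_add, add_pow_char_pow]

theorem add_self (N : ℕ∞) (f : Cob N) : f + f = 0 := by
  obtain ⟨f, rfl⟩ := Cob.mk_surjective N f
  rw [← map_add, CharTwo.add_self_eq_zero, map_zero]

/-- The endomorphism of the `𝔽₂[a]`-algebra `Cob N` with given values on `u` and the `xᵢ`. -/
def subst (N : ℕ∞) (v : Var → Cob N)
    (hv : ∀ n : ℕ, N = n → ∀ i : ℕ, v (Var.x i) ^ 2 ^ n = 0) : Cob N →ₐ[F2a] Cob N :=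
  Ideal.Quotient.liftₐ (truncIdeal N) (MvPolynomial.aeval v) (by
    intro f hf
    have h : truncIdeal N ≤ RingHom.ker (MvPolynomial.aeval v : Poly →ₐ[F2a] Cob N) := by
      rw [truncIdeal, Ideal.span_le]
      rintro _ ⟨n, hn, i, rfl⟩
      simp only [SetLike.mem_coe, RingHom.mem_ker, map_pow, MvPolynomial.aeval_X]
      exact hv n hn i
    exact h hf)

def shiftVar (N : ℕ∞) (k : ℕ) : Var → Cob N
  | Var.u => uu N + aa N ^ 2 * ∑ i ∈ Finset.range k, xx N i
  | Var.x i => xx N (k + i)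

/-- The `k`-fold iterated coaction in the first `k` slots, the old slots moving up by `k`:
`u ↦ u + a² (x₀ + ⋯ + x_{k-1})` and `xᵢ ↦ x_{k+i}`. -/
def shift (N : ℕ∞) (k : ℕ) : Cob N →ₐ[F2a] Cob N :=
  subst N (shiftVar N k) fun n hn i => xx_pow N n hn (k + i)

def comulVar (N : ℕ∞) (j : ℕ) : Var → Cob N
  | Var.u => uu N
  | Var.x i => if i < j then xx N i else if i = j then xx N j + xx N (j + 1) else xx N (i + 1)

/-- The comultiplication of `H` in slot `j`: `xⱼ ↦ xⱼ + x_{j+1}`, and `xᵢ ↦ x_{i+1}` for `i > j`. -/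
def comul (N : ℕ∞) (j : ℕ) : Cob N →ₐ[F2a] Cob N :=
  subst N (comulVar N j) (by
    intro n hn i
    simp only [comulVar]
    split_ifs
    · exact xx_pow N n hn i
    · rw [add_pow_two_pow, xx_pow N n hn, xx_pow N n hn, add_zero]
    · exact xx_pow N n hn (i + 1))

/-- The cobar differential `A ⊗ H^{⊗ s} → A ⊗ H^{⊗ (s+1)}`, that is
`m[h₀|…|h_{s-1}] ↦ ψ(m)[h₀|…|h_{s-1}] + ∑ⱼ m[h₀|…|Δ hⱼ|…|h_{s-1}] + m[h₀|…|h_{s-1}|1]`. -/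
def diff (N : ℕ∞) (s : ℕ) : Cob N →ₗ[F2a] Cob N :=
  (shift N 1).toLinearMap + ∑ j ∈ Finset.range s, (comul N j).toLinearMap + LinearMap.id

/-- The cobar cochains `A ⊗ H^{⊗ s}`: the subalgebra generated by `a, u, x₀, …, x_{s-1}`. -/
def cochainAlg (N : ℕ∞) (s : ℕ) : Subalgebra F2a (Cob N) :=
  Algebra.adjoin F2a (insert (uu N) (xx N '' Set.Iio s))

def cochains (N : ℕ∞) (s : ℕ) : Submodule F2a (Cob N) :=
  Subalgebra.toSubmodule (cochainAlg N s)

/-- The product `(A ⊗ H^{⊗ s}) × (A ⊗ H^{⊗ t}) → A ⊗ H^{⊗ (s+t)}` of the cobar complex of a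
comodule algebra: `m[h₀|…|h_{s-1}] · m'[k₀|…|k_{t-1}]` is
`m m'₍₀₎ [h₀ m'₍₁₎ | … | h_{s-1} m'₍ₛ₎ | k₀ | … | k_{t-1}]`. -/
def cup (N : ℕ∞) (s : ℕ) (f g : Cob N) : Cob N := f * shift N s g

theorem subst_uu (N : ℕ∞) (v) (hv) : subst N v hv (uu N) = v Var.u := by
  exact MvPolynomial.aeval_X v Var.u

theorem subst_xx (N : ℕ∞) (v) (hv) (i : ℕ) : subst N v hv (xx N i) = v (Var.x i) := by
  exact MvPolynomial.aeval_X v (Var.x i)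

theorem algHom_aa (N : ℕ∞) (φ : Cob N →ₐ[F2a] Cob N) : φ (aa N) = aa N :=
  φ.commutes _

theorem algHom_ext' (N : ℕ∞) {φ χ : Cob N →ₐ[F2a] Cob N} (hu : φ (uu N) = χ (uu N))
    (hx : ∀ i, φ (xx N i) = χ (xx N i)) : φ = χ := by
  have h : φ.comp (Cob.mk N) = χ.comp (Cob.mk N) := by
    apply MvPolynomial.algHom_ext
    rintro (_ | i)
    · exact hu
    · exact hx i
  ext f
  obtain ⟨f, rfl⟩ := Cob.mk_surjective N f
  exact DFunLike.congr_fun h f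

theorem shift_uu (N : ℕ∞) (k : ℕ) :
    shift N k (uu N) = uu N + aa N ^ 2 * ∑ i ∈ Finset.range k, xx N i := subst_uu _ _ _

theorem shift_xx (N : ℕ∞) (k i : ℕ) : shift N k (xx N i) = xx N (k + i) := subst_xx _ _ _ _

theorem comul_uu (N : ℕ∞) (j : ℕ) : comul N j (uu N) = uu N := subst_uu _ _ _

theorem comul_xx (N : ℕ∞) (j i : ℕ) : comul N j (xx N i) =
    if i < j then xx N i else if i = j then xx N j + xx N (j + 1) else xx N (i + 1) :=
  subst_xx _ _ _ _

theorem shift_shift (N : ℕ∞) (k l : ℕ) (f : Cob N) :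
    shift N k (shift N l f) = shift N (k + l) f := by
  suffices h : (shift N k).comp (shift N l) = shift N (k + l) from DFunLike.congr_fun h f
  apply algHom_ext'
  · simp only [AlgHom.comp_apply, shift_uu, map_add, map_mul, map_pow, map_sum, shift_xx,
      algHom_aa, Finset.sum_range_add]
    ring
  · intro i
    simp only [AlgHom.comp_apply, shift_xx, add_assoc]

theorem comul_shift_of_lt (N : ℕ∞) (j s : ℕ) (h : j < s) (f : Cob N) :
    comul N j (shift N s f) = shift N (s + 1) f := by
  suffices h : (comul N j).comp (shift N s) = shift N (s + 1) from DFunLike.congr_fun h f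
  apply algHom_ext'
  · have key : ∀ s, j < s → ∑ i ∈ Finset.range s, comul N j (xx N i) =
        ∑ i ∈ Finset.range (s + 1), xx N i := by
      intro s hs
      induction s with
      | zero => omega
      | succ s ih =>
        rw [Finset.sum_range_succ, Finset.sum_range_succ _ (s + 1)]
        rcases Nat.lt_succ_iff_lt_or_eq.mp hs with h1 | rfl
        · rw [ih h1, comul_xx, if_neg (by omega), if_neg (by omega)]
        · rw [comul_xx, if_neg (by omega), if_pos rfl, Finset.sum_range_succ, ← add_assoc]
          congr 2
          refine Finset.sum_congr rfl fun i hi => ?_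
          rw [comul_xx, if_pos (Finset.mem_range.mp hi)]
    simp only [AlgHom.comp_apply, shift_uu, map_add, map_mul, map_pow, map_sum, algHom_aa,
      comul_uu, key s h]
  · intro i
    simp only [AlgHom.comp_apply, shift_xx, comul_xx]
    rw [if_neg (by omega), if_neg (by omega)]
    congr 1
    omega

theorem comul_shift_add (N : ℕ∞) (j s : ℕ) (f : Cob N) :
    comul N (s + j) (shift N s f) = shift N s (comul N j f) := by
  suffices h : (comul N (s + j)).comp (shift N s) = (shift N s).comp (comul N j) from
    DFunLike.congr_fun h f
  apply algHom_ext'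
  · have key : ∑ i ∈ Finset.range s, comul N (s + j) (xx N i) =
        ∑ i ∈ Finset.range s, xx N i := by
      refine Finset.sum_congr rfl fun i hi => ?_
      rw [comul_xx, if_pos (by have := Finset.mem_range.mp hi; omega)]
    simp only [AlgHom.comp_apply, shift_uu, map_add, map_mul, map_pow, map_sum, algHom_aa,
      comul_uu, key]
  · intro i
    simp only [AlgHom.comp_apply, shift_xx, comul_xx]
    split_ifs <;> first | omega | simp only [shift_xx, map_add, add_assoc]

/-- The comultiplication in a slot `≥ s` fixes all `s`-cochains. -/
theorem comul_of_mem (N : ℕ∞) (s j : ℕ) {f : Cob N} (hf : f ∈ cochains N s) :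
    comul N (s + j) f = f := by
  have h : cochainAlg N s ≤ AlgHom.equalizer (comul N (s + j)) (AlgHom.id F2a (Cob N)) := by
    rw [cochainAlg, Algebra.adjoin_le_iff]
    rintro _ (rfl | ⟨i, hi, rfl⟩)
    · exact comul_uu N _
    · have hi' : i < s := hi
      change comul N (s + j) (xx N i) = xx N i
      rw [comul_xx, if_pos (by omega)]
  exact h hf

theorem diff_apply (N : ℕ∞) (s : ℕ) (f : Cob N) :
    diff N s f = shift N 1 f + ∑ j ∈ Finset.range s, comul N j f + f := by
  simp [diff]

/-- The Leibniz rule in the cobar complex. -/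
theorem diff_cup (N : ℕ∞) (s t : ℕ) {f : Cob N} (hf : f ∈ cochains N s) (g : Cob N) :
    diff N (s + t) (cup N s f g) = cup N (s + 1) (diff N s f) g + cup N s f (diff N t g) := by
  simp only [cup, diff_apply, map_mul, map_add, map_sum, shift_shift, Finset.sum_range_add]
  have h1 : ∑ j ∈ Finset.range s, comul N j f * comul N j (shift N s g) =
      (∑ j ∈ Finset.range s, comul N j f) * shift N (s + 1) g := by
    rw [Finset.sum_mul]
    refine Finset.sum_congr rfl fun j hj => ?_
    rw [comul_shift_of_lt N j s (Finset.mem_range.mp hj)]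
  have h2 : ∑ j ∈ Finset.range t, comul N (s + j) f * comul N (s + j) (shift N s g) =
      f * ∑ j ∈ Finset.range t, shift N s (comul N j g) := by
    rw [Finset.mul_sum]
    refine Finset.sum_congr rfl fun j _ => ?_
    rw [comul_of_mem N s j hf, comul_shift_add]
  rw [h1, h2, add_comm 1 s]
  linear_combination -(add_self N (f * shift N (s + 1) g))

theorem shift_mem (N : ℕ∞) (s t : ℕ) {g : Cob N} (hg : g ∈ cochains N t) :
    shift N s g ∈ cochains N (s + t) := by
  have h : cochainAlg N t ≤ (cochainAlg N (s + t)).comap (shift N s) := by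
    rw [cochainAlg, Algebra.adjoin_le_iff]
    have hx : ∀ i < s + t, xx N i ∈ cochainAlg N (s + t) := fun i hi =>
      Algebra.subset_adjoin (Or.inr ⟨i, hi, rfl⟩)
    rintro _ (rfl | ⟨i, hi, rfl⟩)
    · change shift N s (uu N) ∈ cochainAlg N (s + t)
      rw [shift_uu]
      refine add_mem (Algebra.subset_adjoin (Or.inl rfl)) (mul_mem (pow_mem ?_ 2) (sum_mem ?_))
      · exact Subalgebra.algebraMap_mem _ _
      · intro i hi
        exact hx i (by have := Finset.mem_range.mp hi; omega)
    · have hi' : i < t := hi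
      change shift N s (xx N i) ∈ cochainAlg N (s + t)
      rw [shift_xx]
      exact hx _ (by omega)
  exact h hg

theorem cochains_mono (N : ℕ∞) {s t : ℕ} (h : s ≤ t) : cochains N s ≤ cochains N t := by
  refine Algebra.adjoin_mono (Set.insert_subset_insert (Set.image_mono ?_))
  exact Set.Iio_subset_Iio h

theorem cup_mem_cochains (N : ℕ∞) (s t : ℕ) {f g : Cob N} (hf : f ∈ cochains N s)
    (hg : g ∈ cochains N t) : cup N s f g ∈ cochains N (s + t) :=
  (cochainAlg N (s + t)).mul_mem (cochains_mono N (Nat.le_add_right s t) hf) (shift_mem N s t hg)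

theorem comul_mem (N : ℕ∞) (s j : ℕ) {f : Cob N} (hf : f ∈ cochains N s) :
    comul N j f ∈ cochains N (s + 1) := by
  have h : cochainAlg N s ≤ (cochainAlg N (s + 1)).comap (comul N j) := by
    rw [cochainAlg, Algebra.adjoin_le_iff]
    have hx : ∀ i < s + 1, xx N i ∈ cochainAlg N (s + 1) := fun i hi =>
      Algebra.subset_adjoin (Or.inr ⟨i, hi, rfl⟩)
    rintro _ (rfl | ⟨i, hi, rfl⟩)
    · change comul N j (uu N) ∈ cochainAlg N (s + 1)
      rw [comul_uu]
      exact Algebra.subset_adjoin (Or.inl rfl)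
    · have hi' : i < s := hi
      change comul N j (xx N i) ∈ cochainAlg N (s + 1)
      rw [comul_xx]
      split_ifs
      · exact hx _ (by omega)
      · exact add_mem (hx _ (by omega)) (hx _ (by omega))
      · exact hx _ (by omega)
  exact h hf

/-- The differential maps `s`-cochains to `(s+1)`-cochains. -/
theorem diff_mem (N : ℕ∞) (s : ℕ) {f : Cob N} (hf : f ∈ cochains N s) :
    diff N s f ∈ cochains N (s + 1) := by
  rw [diff_apply]
  refine add_mem (add_mem ?_ (sum_mem fun j _ => comul_mem N s j hf))
    (cochains_mono N (Nat.le_succ s) hf)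
  rw [add_comm s 1]
  exact shift_mem N 1 s hf

theorem comul_comul (N : ℕ∞) {i j : ℕ} (h : j ≤ i) (f : Cob N) :
    comul N j (comul N i f) = comul N (i + 1) (comul N j f) := by
  suffices h : (comul N j).comp (comul N i) = (comul N (i + 1)).comp (comul N j) from
    DFunLike.congr_fun h f
  apply algHom_ext'
  · simp only [AlgHom.comp_apply, comul_uu]
  · intro k
    simp only [AlgHom.comp_apply, comul_xx]
    split_ifs <;> simp only [map_add, comul_xx] <;> split_ifs <;>
      first | omega | (subst_vars; simp only [add_assoc])

theorem sum_cosimplicial {M : Type} [AddCommMonoid M] (hM : ∀ m : M, m + m = 0) (g : ℕ → ℕ → M)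
    (hg : ∀ i j, j ≤ i → g j i = g (i + 1) j) (n : ℕ) :
    ∑ j ∈ Finset.range (n + 1), ∑ i ∈ Finset.range n, g j i = 0 := by
  induction n with
  | zero => simp
  | succ n ih =>
    have e : ∑ j ∈ Finset.range (n + 1), ∑ i ∈ Finset.range (n + 1), g j i =
        ∑ j ∈ Finset.range (n + 1), g j n := by
      rw [← zero_add (∑ j ∈ Finset.range (n + 1), g j n), ← ih, ← Finset.sum_add_distrib]
      exact Finset.sum_congr rfl fun j _ => Finset.sum_range_succ _ _
    rw [Finset.sum_range_succ, e]
    have : ∑ j ∈ Finset.range (n + 1), g j n = ∑ j ∈ Finset.range (n + 1), g (n + 1) j :=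
      Finset.sum_congr rfl fun j hj => hg n j (by have := Finset.mem_range.mp hj; omega)
    rw [this, hM]

/-- The cobar complex is a complex. -/
theorem diff_diff (N : ℕ∞) (s : ℕ) {f : Cob N} (hf : f ∈ cochains N s) :
    diff N (s + 1) (diff N s f) = 0 := by
  let δ : ℕ → Cob N →ₐ[F2a] Cob N := fun i => Nat.casesOn i (shift N 1) (comul N)
  have hδ : ∀ (s : ℕ) {f : Cob N}, f ∈ cochains N s →
      diff N s f = ∑ i ∈ Finset.range (s + 2), δ i f := by
    intro s f hf
    rw [diff_apply, Finset.sum_range_succ', Finset.sum_range_succ]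
    change _ = ∑ i ∈ Finset.range s, comul N i f + comul N (s + 0) f + shift N 1 f
    rw [comul_of_mem N s 0 hf]
    ring
  rw [hδ (s + 1) (diff_mem N s hf), hδ s hf]
  simp only [map_sum]
  refine sum_cosimplicial (add_self N) (fun j i => δ j (δ i f)) ?_ (s + 2)
  rintro (_ | i) (_ | j) h
  · change shift N 1 (shift N 1 f) = comul N 0 (shift N 1 f)
    rw [shift_shift, comul_shift_of_lt N 0 1 one_pos]
  · omega
  · change shift N 1 (comul N i f) = comul N (i + 1) (shift N 1 f)
    rw [add_comm i 1, comul_shift_add]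
  · exact comul_comul N (by omega) f

/-! ### The `x`-adic filtration and its spectral sequence -/

def xIdeal (N : ℕ∞) : Ideal (Cob N) := Ideal.span (Set.range (xx N))

/-- The `x`-adic filtration `F^p (A ⊗ H^{⊗ s})`: cochains of total degree at least `p` in the
variables `x₀, …, x_{s-1}`. -/
def fil (N : ℕ∞) (s p : ℕ) : Submodule F2a (Cob N) :=
  (xIdeal N ^ p).restrictScalars F2a ⊓ cochains N s

theorem fil_anti (N : ℕ∞) (s : ℕ) {p q : ℕ} (h : p ≤ q) : fil N s q ≤ fil N s p :=
  inf_le_inf_right _ (fun _ hf => Ideal.pow_le_pow_right h hf)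

theorem shift_mem_pow (N : ℕ∞) (s p : ℕ) {g : Cob N} (hg : g ∈ xIdeal N ^ p) :
    shift N s g ∈ xIdeal N ^ p := by
  have h : (xIdeal N).map (shift N s) ≤ xIdeal N := by
    rw [xIdeal, Ideal.map_span, Ideal.span_le]
    rintro _ ⟨_, ⟨i, rfl⟩, rfl⟩
    rw [shift_xx]
    exact Ideal.subset_span ⟨_, rfl⟩
  have h2 := Ideal.mem_map_of_mem (shift N s) hg
  rw [Ideal.map_pow] at h2
  exact Ideal.pow_right_mono h p h2

theorem cup_mem_fil (N : ℕ∞) {s t p q : ℕ} {f g : Cob N} (hf : f ∈ fil N s p)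
    (hg : g ∈ fil N t q) : cup N s f g ∈ fil N (s + t) (p + q) := by
  refine ⟨?_, cup_mem_cochains N s t hf.2 hg.2⟩
  change _ ∈ xIdeal N ^ (p + q)
  rw [pow_add]
  exact Ideal.mul_mem_mul hf.1 (shift_mem_pow N s q hg.1)

/-- The image of the incoming differential `d : C^{s-1} → C^s` on `F^p C^{s-1}`
(zero for `s = 0`). -/
def bound (N : ℕ∞) : ℕ → ℕ → Submodule F2a (Cob N)
  | 0, _ => ⊥
  | s + 1, p => (fil N s p).map (diff N s)

/-- `Z_r^{s,p}`, as a submodule of `F^p C^s` that contains `F^{p+1} C^s`: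
the `c ∈ F^p C^s` with `d c ∈ F^{p+r} C^{s+1}`, up to `F^{p+1} C^s`. -/
def cyc (N : ℕ∞) (r s p : ℕ) : Submodule F2a (Cob N) :=
  (fil N s p ⊓ (fil N (s + 1) (p + r)).comap (diff N s)) ⊔ fil N s (p + 1)

/-- `B_r^{s,p}`, as a submodule of `F^p C^s` that contains `F^{p+1} C^s`:
the `d b ∈ F^p C^s` with `b ∈ F^{p-r+1} C^{s-1}`, up to `F^{p+1} C^s`.
(`F^q` is everything for `q ≤ 0`, so truncated subtraction is harmless here.) -/
def bdy (N : ℕ∞) (r s p : ℕ) : Submodule F2a (Cob N) :=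
  (fil N s p ⊓ bound N s (p + 1 - r)) ⊔ fil N s (p + 1)

/-- `Z_r` for `1 ≤ r ≤ ∞`.  As the `Z_k` decrease with `k`, this is `Z_r` for finite `r`, and it is
`Z_∞ = ⋂ Z_k` for `r = ⊤`.  The index is `i = (s, p)`. -/
def pageCyc (N r : ℕ∞) (i : ℕ × ℕ) : Submodule F2a (Cob N) :=
  ⨅ (k : ℕ) (_ : (k : ℕ∞) ≤ r), cyc N k i.1 i.2

/-- `B_r` for `1 ≤ r ≤ ∞`.  As the `B_k` increase with `k`, this is `B_r` for finite `r`, and it is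
`B_∞ = ⋃ B_k` for `r = ⊤`. -/
def pageBdy (N r : ℕ∞) (i : ℕ × ℕ) : Submodule F2a (Cob N) :=
  ⨆ (k : ℕ) (_ : (k : ℕ∞) ≤ r), bdy N k i.1 i.2

/-- The `(s, p)` entry `E_r^{s,p} = Z_r^{s,p} / B_r^{s,p}` of the `r`-th page of the spectral
sequence of the filtered complex, for `1 ≤ r ≤ ∞`.  Here `s` is the cohomological
degree and `p` the filtration. -/
abbrev Page (N r : ℕ∞) (i : ℕ × ℕ) : Type :=
  pageCyc N r i ⧸ (pageBdy N r i).submoduleOf (pageCyc N r i)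

/-- The class in `E_r^{s,p}` of an element of `Z_r^{s,p}`. -/
def pageClass (N r : ℕ∞) (i : ℕ × ℕ) (c : Cob N) (hc : c ∈ pageCyc N r i) : Page N r i :=
  Submodule.Quotient.mk ⟨c, hc⟩

theorem cup_add_left (N : ℕ∞) (s : ℕ) (f f' g : Cob N) :
    cup N s (f + f') g = cup N s f g + cup N s f' g := add_mul _ _ _

theorem cup_add_right (N : ℕ∞) (s : ℕ) (f g g' : Cob N) :
    cup N s f (g + g') = cup N s f g + cup N s f g' := by
  simp only [cup, map_add, mul_add]

theorem cyc_le_fil (N : ℕ∞) (r s p : ℕ) : cyc N r s p ≤ fil N s p :=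
  sup_le inf_le_left (fil_anti N s (Nat.le_succ p))

theorem bdy_le_fil (N : ℕ∞) (r s p : ℕ) : bdy N r s p ≤ fil N s p :=
  sup_le inf_le_left (fil_anti N s (Nat.le_succ p))

theorem fil_le_bdy (N : ℕ∞) (r s p : ℕ) : fil N s (p + 1) ≤ bdy N r s p := le_sup_right

theorem cup_mem_cyc (N : ℕ∞) {r s t p q : ℕ} {f g : Cob N} (hf : f ∈ cyc N r s p)
    (hg : g ∈ cyc N r t q) : cup N s f g ∈ cyc N r (s + t) (p + q) := by
  have hg0 := cyc_le_fil N r t q hg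
  obtain ⟨f₁, ⟨hf₁, hdf⟩, f₂, hf₂, rfl⟩ := Submodule.mem_sup.mp hf
  obtain ⟨g₁, ⟨hg₁, hdg⟩, g₂, hg₂, rfl⟩ := Submodule.mem_sup.mp hg
  rw [cup_add_left, cup_add_right]
  have h12 : cup N s f₁ g₂ ∈ fil N (s + t) (p + (q + 1)) := cup_mem_fil N hf₁ hg₂
  refine add_mem (add_mem (Submodule.mem_sup_left ⟨cup_mem_fil N hf₁ hg₁, ?_⟩)
    (Submodule.mem_sup_right h12)) (Submodule.mem_sup_right ?_)
  · change diff N (s + t) (cup N s f₁ g₁) ∈ fil N (s + t + 1) (p + q + r)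
    rw [diff_cup N s t hf₁.2]
    have h1 := cup_mem_fil N (Submodule.mem_comap.mp hdf) hg₁
    have h2 := cup_mem_fil N hf₁ (Submodule.mem_comap.mp hdg)
    rw [← add_assoc, ← add_assoc] at h2
    rw [show s + 1 + t = s + t + 1 by omega, show p + r + q = p + q + r by omega] at h1
    exact add_mem h1 h2
  · have h := cup_mem_fil N hf₂ hg0
    rwa [show p + 1 + q = p + q + 1 by omega] at h

theorem cup_mem_bdy_left (N : ℕ∞) {r s t p q : ℕ} {f g : Cob N} (hf : f ∈ bdy N r s p)
    (hg : g ∈ cyc N r t q) : cup N s f g ∈ bdy N r (s + t) (p + q) := by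
  have hg0 := cyc_le_fil N r t q hg
  obtain ⟨f₁, ⟨hf₁, hb⟩, f₂, hf₂, rfl⟩ := Submodule.mem_sup.mp hf
  obtain ⟨g₁, ⟨hg₁, hdg⟩, g₂, hg₂, rfl⟩ := Submodule.mem_sup.mp hg
  rw [cup_add_left, cup_add_right]
  have h3 := cup_mem_fil N hf₂ hg0
  rw [show p + 1 + q = p + q + 1 by omega] at h3
  have h12 : cup N s f₁ g₂ ∈ fil N (s + t) (p + (q + 1)) := cup_mem_fil N hf₁ hg₂
  refine add_mem (add_mem ?_ (fil_le_bdy N _ _ _ h12)) (fil_le_bdy N _ _ _ h3)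
  cases s with
  | zero =>
    have : f₁ = 0 := by simpa [bound] using hb
    rw [this, cup, zero_mul]
    exact zero_mem _
  | succ s =>
    obtain ⟨b, hb, rfl⟩ := hb
    have e := diff_cup N s t hb.2 g₁
    have h1 := cup_mem_fil N hb (Submodule.mem_comap.mp hdg)
    have h1' : cup N s b (diff N t g₁) ∈ fil N (s + 1 + t) (p + q + 1) := by
      rw [show s + (t + 1) = s + 1 + t by omega] at h1
      exact fil_anti N _ (by omega) h1
    have h2 := cup_mem_fil N hb hg₁
    have h4 : cup N (s + 1) (diff N s b) g₁ =
        diff N (s + t) (cup N s b g₁) + cup N s b (diff N t g₁) := by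
      linear_combination -e - (add_self N (cup N s b (diff N t g₁)))
    have h5 := cup_mem_fil N hf₁ hg₁
    rw [h4] at h5 ⊢
    refine add_mem (Submodule.mem_sup_left ⟨?_, ?_⟩) (fil_le_bdy N _ _ _ h1')
    · have := sub_mem h5 (fil_anti N _ (Nat.le_succ _) h1')
      simpa using this
    · rw [show s + 1 + t = s + t + 1 by omega]
      exact ⟨_, fil_anti N _ (by omega) h2, rfl⟩

theorem cup_mem_bdy_right (N : ℕ∞) {r s t p q : ℕ} {f g : Cob N} (hf : f ∈ cyc N r s p)
    (hg : g ∈ bdy N r t q) : cup N s f g ∈ bdy N r (s + t) (p + q) := by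
  have hg0 := bdy_le_fil N r t q hg
  obtain ⟨f₁, ⟨hf₁, hdf⟩, f₂, hf₂, rfl⟩ := Submodule.mem_sup.mp hf
  obtain ⟨g₁, ⟨hg₁, hb⟩, g₂, hg₂, rfl⟩ := Submodule.mem_sup.mp hg
  rw [cup_add_left, cup_add_right]
  have h3 := cup_mem_fil N hf₂ hg0
  rw [show p + 1 + q = p + q + 1 by omega] at h3
  have h12 : cup N s f₁ g₂ ∈ fil N (s + t) (p + (q + 1)) := cup_mem_fil N hf₁ hg₂
  refine add_mem (add_mem ?_ (fil_le_bdy N _ _ _ h12)) (fil_le_bdy N _ _ _ h3)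
  cases t with
  | zero =>
    have : g₁ = 0 := by simpa [bound] using hb
    rw [this, cup, map_zero, mul_zero]
    exact zero_mem _
  | succ t =>
    obtain ⟨b, hb, rfl⟩ := hb
    have e := diff_cup N s t hf₁.2 b
    have h1 := cup_mem_fil N (Submodule.mem_comap.mp hdf) hb
    have h1' : cup N (s + 1) (diff N s f₁) b ∈ fil N (s + (t + 1)) (p + q + 1) := by
      rw [show s + 1 + t = s + (t + 1) by omega] at h1
      exact fil_anti N _ (by omega) h1
    have h2 := cup_mem_fil N hf₁ hb
    have h4 : cup N s f₁ (diff N t b) =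
        diff N (s + t) (cup N s f₁ b) + cup N (s + 1) (diff N s f₁) b := by
      linear_combination -e - (add_self N (cup N (s + 1) (diff N s f₁) b))
    have h5 := cup_mem_fil N hf₁ hg₁
    rw [h4] at h5 ⊢
    refine add_mem (Submodule.mem_sup_left ⟨?_, ?_⟩) (fil_le_bdy N _ _ _ h1')
    · have := sub_mem h5 (fil_anti N _ (Nat.le_succ _) h1')
      simpa using this
    · exact ⟨_, fil_anti N _ (by omega) h2, rfl⟩

theorem cup_mem_pageCyc (N r : ℕ∞) {i j : ℕ × ℕ} {f g : Cob N} (hf : f ∈ pageCyc N r i)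
    (hg : g ∈ pageCyc N r j) : cup N i.1 f g ∈ pageCyc N r (i + j) := by
  simp only [pageCyc, Submodule.mem_iInf] at *
  exact fun k hk => cup_mem_cyc N (hf k hk) (hg k hk)

theorem cup_mem_pageBdy_left (N r : ℕ∞) {i j : ℕ × ℕ} {f g : Cob N} (hf : f ∈ pageBdy N r i)
    (hg : g ∈ pageCyc N r j) : cup N i.1 f g ∈ pageBdy N r (i + j) := by
  simp only [pageCyc, Submodule.mem_iInf] at hg
  let φ : Cob N →ₗ[F2a] Cob N := LinearMap.mulRight F2a (shift N i.1 g)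
  have : pageBdy N r i ≤ (pageBdy N r (i + j)).comap φ := by
    refine iSup₂_le fun k hk f hf => ?_
    exact Submodule.mem_iSup_of_mem k
      (Submodule.mem_iSup_of_mem hk (cup_mem_bdy_left N hf (hg k hk)))
  exact this hf

theorem cup_mem_pageBdy_right (N r : ℕ∞) {i j : ℕ × ℕ} {f g : Cob N} (hf : f ∈ pageCyc N r i)
    (hg : g ∈ pageBdy N r j) : cup N i.1 f g ∈ pageBdy N r (i + j) := by
  simp only [pageCyc, Submodule.mem_iInf] at hf
  let φ : Cob N →ₗ[F2a] Cob N := (LinearMap.mulLeft F2a f).comp (shift N i.1).toLinearMap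
  have : pageBdy N r j ≤ (pageBdy N r (i + j)).comap φ := by
    refine iSup₂_le fun k hk g hg => ?_
    exact Submodule.mem_iSup_of_mem k
      (Submodule.mem_iSup_of_mem hk (cup_mem_bdy_right N (hf k hk) hg))
  exact this hg

/-- The product `E_r^{s,p} × E_r^{t,q} → E_r^{s+t,p+q}` induced by the product of the cobar
complex. -/
def pageMul (N r : ℕ∞) (i j : ℕ × ℕ) : Page N r i → Page N r j → Page N r (i + j) :=
  Quotient.map₂ (fun f g => ⟨cup N i.1 f g, cup_mem_pageCyc N r f.2 g.2⟩) (by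
    intro f f' hf g g' hg
    have hf' := (Submodule.quotientRel_def _).mp hf
    have hg' := (Submodule.quotientRel_def _).mp hg
    refine (Submodule.quotientRel_def _).mpr ?_
    change _ ∈ pageBdy N r (i + j)
    change (f : Cob N) - f' ∈ pageBdy N r i at hf'
    change (g : Cob N) - g' ∈ pageBdy N r j at hg'
    have h1 := cup_mem_pageBdy_left N r hf' g.2
    have h2 := cup_mem_pageBdy_right N r f'.2 hg'
    have h3 := add_mem h1 h2
    convert h3 using 1
    change cup N i.1 f g - cup N i.1 f' g' = _
    simp only [cup, map_sub]
    ring)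

/-- The total page `⨁ E_r^{s,p}` is a bigraded ring under the product above. -/
instance pageGMul (N r : ℕ∞) : DirectSum.GNonUnitalNonAssocSemiring (Page N r) where
  mul {i j} f g := pageMul N r i j f g
  mul_zero {i j} f := by
    induction f using Submodule.Quotient.induction_on with | _ f =>
    refine congrArg (Submodule.Quotient.mk) (Subtype.ext ?_)
    simp [cup]
  zero_mul {i j} g := by
    induction g using Submodule.Quotient.induction_on with | _ g =>
    refine congrArg (Submodule.Quotient.mk) (Subtype.ext ?_)
    simp [cup]
  mul_add {i j} f g h := by
    induction f using Submodule.Quotient.induction_on with | _ f =>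
    induction g using Submodule.Quotient.induction_on with | _ g =>
    induction h using Submodule.Quotient.induction_on with | _ h =>
    exact congrArg (Submodule.Quotient.mk) (Subtype.ext (cup_add_right N i.1 f g h))
  add_mul {i j} f g h := by
    induction f using Submodule.Quotient.induction_on with | _ f =>
    induction g using Submodule.Quotient.induction_on with | _ g =>
    induction h using Submodule.Quotient.induction_on with | _ h =>
    exact congrArg (Submodule.Quotient.mk) (Subtype.ext (cup_add_left N i.1 f g h))

/-! ### The target of the spectral sequence -/

/-- The `s`-cocycles of the cobar complex. -/
def cocycles (N : ℕ∞) (s : ℕ) : Submodule F2a (Cob N) :=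
  cochains N s ⊓ LinearMap.ker (diff N s)

/-- `Ext^s_H(𝔽₂, A)`, the cohomology of the cobar complex. -/
abbrev CobarExt (N : ℕ∞) (s : ℕ) : Type :=
  cocycles N s ⧸ (bound N s 0).submoduleOf (cocycles N s)

/-- The class in `Ext^s` of a cocycle. -/
def extClass (N : ℕ∞) (s : ℕ) (c : Cob N) (hc : c ∈ cocycles N s) : CobarExt N s :=
  Submodule.Quotient.mk ⟨c, hc⟩

/-! ### The answer -/

inductive YVar (N : ℕ∞) : Type
  | u : YVar N
  | y (r : ℕ) (hr : (r : ℕ∞) < N) : YVar N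

/-- `𝔽₂[a, u, y_r : 0 ≤ r < N]`. -/
abbrev YPoly (N : ℕ∞) : Type := MvPolynomial (YVar N) F2a

/-- The monomial `u^(2^(r+1) m) y_r`. -/
def yGen (N : ℕ∞) (r : ℕ) (hr : (r : ℕ∞) < N) (m : ℕ) : YPoly N :=
  MvPolynomial.X YVar.u ^ (2 ^ (r + 1) * m) * MvPolynomial.X (YVar.y r hr)

/-- The subring `𝔽₂[a, u^(2^(r+1) m) y_r : m ≥ 0, 0 ≤ r < N]` of `𝔽₂[a, u, y_r : 0 ≤ r < N]`, with
`u^(2^n)` adjoined if `N = n` is finite. -/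
def answerSub (N : ℕ∞) : Subalgebra F2a (YPoly N) :=
  Algebra.adjoin F2a
    ({f | ∃ (r : ℕ) (hr : (r : ℕ∞) < N) (m : ℕ), f = yGen N r hr m} ∪
      {f | ∃ n : ℕ, N = n ∧ f = MvPolynomial.X YVar.u ^ 2 ^ n})

theorem yGen_mem (N : ℕ∞) (r : ℕ) (hr : (r : ℕ∞) < N) (m : ℕ) : yGen N r hr m ∈ answerSub N :=
  Algebra.subset_adjoin (Or.inl ⟨r, hr, m, rfl⟩)

theorem u_pow_mem (N : ℕ∞) (n : ℕ) (hn : N = n) :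
    (MvPolynomial.X YVar.u ^ 2 ^ n : YPoly N) ∈ answerSub N :=
  Algebra.subset_adjoin (Or.inr ⟨n, hn, rfl⟩)

/-- The ideal of `answerSub N` generated by the `a^(2^(r+1)) u^(2^(r+1) m) y_r`. -/
def answerIdeal (N : ℕ∞) : Ideal (answerSub N) :=
  Ideal.span {f | ∃ (r : ℕ) (hr : (r : ℕ∞) < N) (m : ℕ),
    f = F2a.a ^ 2 ^ (r + 1) • (⟨yGen N r hr m, yGen_mem N r hr m⟩ : answerSub N)}

/-- `𝔽₂[a, u^(2^(r+1) m) y_r] / (a^(2^(r+1)) u^(2^(r+1) m) y_r)`, with `u^(2^n)` adjoined to the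
numerator if `N = n` is finite. -/
abbrev Answer (N : ℕ∞) : Type := answerSub N ⧸ answerIdeal N

end

end XAdic

open scoped DirectSum

namespace XAdic

noncomputable section

open MvPolynomial (monomial X C coeff)
open Finset.HasAntidiagonal (antidiagonal mem_antidiagonal)

/-! ### Monomials of the cobar complex -/

/-! The cobar complex is compared with a small complex whose cohomology can be read off from
monomials. Let `q` send `x^(2^r)` to `y_r` and every other power of `x` to zero. The `y_r` commute
and the characteristic is two, so `q` is a twisting cochain, and `m[h₀|…|h_{s-1}] ↦ m q(h₀) ⋯
q(h_{s-1})` (`toKosz`) is a chain map to the Koszul complex `𝔽₂[a, u, y_r]`, whose differential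
sends `u^m y^α` to the sum of `a^(2^(r+1)) u^(m-2^r) y_r y^α` over the binary digits `r` of `m`
(`toKosz_diff`).

The Koszul resolution `H ⊗ 𝔽₂[y_r]` of `𝔽₂` has an explicit contraction (`contract_kosz_aux`). A
zigzag through the double complex with terms `A ⊗ H^{⊗ i} ⊗ H ⊗ 𝔽₂[y_r]` turns it into an identity
`f = d h f + h d f + fromKosz (toKosz f)` (`homotopy_succ`). All these maps preserve the `x`-adic
filtration if `y_r` has weight `2^r`, while the Koszul differential raises it. So a class of `E₁` is
determined by the component of `toKosz f` in its bidegree, its leading term `lead`, and `E₁` is the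
Koszul complex. `toKosz` is not multiplicative, but leading terms are (`comp_toKosz_cup`).

Call `u^m y^α` good if `2^(t+1) ∣ m` for the least index `t` in `α` (for all `t < N` if `α = 0`),
and bad otherwise. A bad monomial has `v₂(m) = t` for some `t < N` such that no `y_q` with `q < t`
occurs. The lowest term of its differential is `a^(2^(t+1))` times the good monomial `u^(m-2^t) y_t
y^α`. This matches bad monomials with good monomials having `α ≠ 0`, triangularly in the weight
(`coeff_koszulD_bad`). Hence a Koszul cocycle is determined by its good coefficients, and boundaries
have their coefficients divisible by `a^(2^(t+1))`. The good monomials are a basis of `answerSub`,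
and this divisibility describes `answerIdeal`.

The other half is `exists_lift`: for `α ≠ 0` a good monomial is the leading term of the cocycle
`d(u^(m+2^t)) / a^(2^(t+1))` multiplied by cocycles `[x^(2^r)]`. The power `a^(2^(t+1))` kills this
cocycle in `Ext` itself and not only in `E_∞`. This computes `E_∞` and also excludes module
extensions. -/

instance : IsDomain F2a := inferInstanceAs (IsDomain (Polynomial (ZMod 2)))

theorem F2a.a_ne_zero : F2a.a ≠ 0 := Polynomial.X_ne_zero

theorem two_eq_zero (N : ℕ∞) : (2 : Cob N) = 0 := by
  rw [← one_add_one_eq_two]; exact add_self N 1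

theorem Cob.mk_eq_zero_iff (N : ℕ∞) (f : Poly) : Cob.mk N f = 0 ↔ f ∈ truncIdeal N :=
  Ideal.Quotient.eq_zero_iff_mem

/-- The class in `Cob N` of a monomial in `u` and the `xᵢ`. -/
def mon (N : ℕ∞) (μ : Var →₀ ℕ) : Cob N := Cob.mk N (monomial μ 1)

theorem mon_add (N : ℕ∞) (μ ν : Var →₀ ℕ) : mon N (μ + ν) = mon N μ * mon N ν := by
  rw [mon, mon, mon, ← map_mul, MvPolynomial.monomial_mul, one_mul]

theorem mon_zero (N : ℕ∞) : mon N 0 = 1 := by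
  rw [mon, MvPolynomial.monomial_zero', map_one, map_one]

theorem mon_single_x (N : ℕ∞) (i k : ℕ) : mon N (Finsupp.single (Var.x i) k) = xx N i ^ k := by
  rw [mon, xx, ← map_pow, MvPolynomial.X_pow_eq_monomial]

theorem mon_single_u (N : ℕ∞) (k : ℕ) : mon N (Finsupp.single Var.u k) = uu N ^ k := by
  rw [mon, uu, ← map_pow, MvPolynomial.X_pow_eq_monomial]

theorem smul_mon (N : ℕ∞) (c : F2a) (μ : Var →₀ ℕ) :
    c • mon N μ = Cob.mk N (monomial μ c) := by
  rw [mon, ← map_smul, MvPolynomial.smul_monomial, smul_eq_mul, mul_one]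

theorem span_mon (N : ℕ∞) : Submodule.span F2a (Set.range (mon N)) = ⊤ := by
  rw [eq_top_iff]
  rintro f -
  obtain ⟨f, rfl⟩ := Cob.mk_surjective N f
  induction f using MvPolynomial.induction_on' with
  | monomial μ c =>
    rw [← smul_mon]
    exact Submodule.smul_mem _ _ (Submodule.subset_span ⟨μ, rfl⟩)
  | add f g hf hg =>
    rw [map_add]
    exact add_mem hf hg

theorem mem_truncIdeal (N : ℕ∞) (f : Poly) :
    f ∈ truncIdeal N ↔ ∀ μ ∈ f.support, ∃ n : ℕ, N = n ∧ ∃ i, 2 ^ n ≤ μ (Var.x i) := by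
  have : truncIdeal N = Ideal.span ((fun μ => monomial μ (1 : F2a)) ''
      {μ | ∃ n : ℕ, N = n ∧ ∃ i : ℕ, μ = Finsupp.single (Var.x i) (2 ^ n)}) := by
    rw [truncIdeal]
    congr 1
    ext f
    constructor
    · rintro ⟨n, hn, i, rfl⟩
      exact ⟨_, ⟨n, hn, i, rfl⟩, (MvPolynomial.X_pow_eq_monomial).symm⟩
    · rintro ⟨_, ⟨n, hn, i, rfl⟩, rfl⟩
      exact ⟨n, hn, i, (MvPolynomial.X_pow_eq_monomial).symm⟩
  rw [this, MvPolynomial.mem_ideal_span_monomial_image]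
  refine forall₂_congr fun μ _ => ?_
  constructor
  · rintro ⟨_, ⟨n, hn, i, rfl⟩, h⟩
    exact ⟨n, hn, i, Finsupp.single_le_iff.mp h⟩
  · rintro ⟨n, hn, i, h⟩
    exact ⟨_, ⟨n, hn, i, rfl⟩, Finsupp.single_le_iff.mpr h⟩

/-- The truncation ideal is a monomial ideal, so membership depends only on the support, which
multiplication by a nonzero element of the domain `𝔽₂[a]` does not change. Torsion-freeness is what
makes coboundaries divided by powers of `a` cocycles again. -/
theorem smul_eq_zero_of_ne (N : ℕ∞) {c : F2a} (hc : c ≠ 0) {f : Cob N} (h : c • f = 0) :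
    f = 0 := by
  obtain ⟨f, rfl⟩ := Cob.mk_surjective N f
  rw [← map_smul, Cob.mk_eq_zero_iff, mem_truncIdeal] at h
  rw [Cob.mk_eq_zero_iff, mem_truncIdeal]
  intro μ hμ
  refine h μ ?_
  rw [MvPolynomial.mem_support_iff] at hμ ⊢
  rw [MvPolynomial.coeff_smul, smul_eq_mul]
  exact mul_ne_zero hc hμ

theorem mon_eq_zero (N : ℕ∞) {n : ℕ} (hn : N = n) {μ : Var →₀ ℕ} {i : ℕ}
    (h : 2 ^ n ≤ μ (Var.x i)) : mon N μ = 0 := by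
  rw [mon, Cob.mk_eq_zero_iff, mem_truncIdeal]
  intro ν hν
  have := Finset.mem_singleton.mp (MvPolynomial.support_monomial_subset hν)
  exact ⟨n, hn, i, this ▸ h⟩

/-- The degree of a monomial in the variables `xᵢ`. -/
def xdeg : (Var →₀ ℕ) →+ ℕ :=
  Finsupp.weight fun v => match v with
    | Var.u => 0
    | Var.x _ => 1

theorem xdeg_single_x (i k : ℕ) : xdeg (Finsupp.single (Var.x i) k) = k := by
  simp [xdeg, Finsupp.weight_single]

theorem xdeg_single_u (k : ℕ) : xdeg (Finsupp.single Var.u k) = 0 := by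
  simp [xdeg, Finsupp.weight_single]

/-- The span of the monomials of degree at least `p` in the `xᵢ`. -/
def degSpan (N : ℕ∞) (p : ℕ) : Submodule F2a (Cob N) :=
  Submodule.span F2a {f | ∃ μ, p ≤ xdeg μ ∧ f = mon N μ}

theorem degSpan_mul (N : ℕ∞) {p q : ℕ} {f g : Cob N} (hf : f ∈ degSpan N p)
    (hg : g ∈ degSpan N q) : f * g ∈ degSpan N (p + q) := by
  have h := Submodule.mul_mem_mul hf hg
  rw [degSpan, degSpan, Submodule.span_mul_span] at h
  refine Submodule.span_mono ?_ h
  rintro _ ⟨_, ⟨μ, hμ, rfl⟩, _, ⟨ν, hν, rfl⟩, rfl⟩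
  exact ⟨μ + ν, by rw [map_add]; omega, (mon_add N μ ν).symm⟩

theorem degSpan_zero (N : ℕ∞) : degSpan N 0 = ⊤ := by
  rw [← span_mon, degSpan]
  congr 1
  ext f
  simp [eq_comm]

/-- Reduces statements about the filtration to monomials, where operations that are only linear can
be checked. -/
theorem xIdeal_pow_le (N : ℕ∞) {p : ℕ} {f : Cob N} (hf : f ∈ xIdeal N ^ p) :
    f ∈ degSpan N p := by
  have h1 : ∀ g ∈ xIdeal N, g ∈ degSpan N 1 := by
    intro g hg
    refine Submodule.span_induction ?_ (zero_mem _) (fun _ _ _ _ => add_mem) ?_ hg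
    · rintro _ ⟨i, rfl⟩
      refine Submodule.subset_span ⟨_, (xdeg_single_x i 1).ge, ?_⟩
      rw [mon_single_x, pow_one]
    · intro c g _ h
      have := degSpan_mul N (p := 0) (f := c) (by simp [degSpan_zero]) h
      rwa [zero_add] at this
  induction p generalizing f with
  | zero => simp [degSpan_zero]
  | succ p ih =>
    rw [pow_succ] at hf
    refine Submodule.mul_induction_on hf (fun r hr s hs => ?_) fun _ _ => add_mem
    exact degSpan_mul N (ih hr) (h1 s hs)

theorem xx_mem_xIdeal (N : ℕ∞) (i : ℕ) : xx N i ∈ xIdeal N := Ideal.subset_span ⟨i, rfl⟩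

theorem mon_mem_xIdeal_pow (N : ℕ∞) (μ : Var →₀ ℕ) : mon N μ ∈ xIdeal N ^ xdeg μ := by
  induction μ using Finsupp.induction_linear with
  | zero => simp
  | add μ ν hμ hν =>
    rw [mon_add, map_add, pow_add]
    exact Ideal.mul_mem_mul hμ hν
  | single v k =>
    cases v with
    | u => rw [xdeg_single_u]; simp
    | x i =>
      rw [mon_single_x, xdeg_single_x]
      exact Ideal.pow_mem_pow (xx_mem_xIdeal N i) k

theorem xx_mem_cochains (N : ℕ∞) {i s : ℕ} (h : i < s) : xx N i ∈ cochains N s :=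
  Algebra.subset_adjoin (Or.inr ⟨i, h, rfl⟩)

theorem uu_mem_cochains (N : ℕ∞) (s : ℕ) : uu N ∈ cochains N s :=
  Algebra.subset_adjoin (Or.inl rfl)

theorem cochains_mul (N : ℕ∞) {s : ℕ} {f g : Cob N} (hf : f ∈ cochains N s)
    (hg : g ∈ cochains N s) : f * g ∈ cochains N s := (cochainAlg N s).mul_mem hf hg

theorem cochains_pow (N : ℕ∞) {s : ℕ} {f : Cob N} (hf : f ∈ cochains N s) (k : ℕ) :
    f ^ k ∈ cochains N s := (cochainAlg N s).pow_mem hf k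

theorem cochains_eq_span (N : ℕ∞) (s : ℕ) : cochains N s =
    Submodule.span F2a {f | ∃ μ : Var →₀ ℕ, (∀ i, s ≤ i → μ (Var.x i) = 0) ∧ f = mon N μ} := by
  apply le_antisymm
  · intro f hf
    refine Algebra.adjoin_induction (p := fun f _ => f ∈ Submodule.span F2a
      {f | ∃ μ : Var →₀ ℕ, (∀ i, s ≤ i → μ (Var.x i) = 0) ∧ f = mon N μ}) ?_ ?_ ?_ ?_ hf
    · rintro _ (rfl | ⟨i, hi, rfl⟩)
      · exact Submodule.subset_span ⟨Finsupp.single Var.u 1, by simp, by simp [mon_single_u]⟩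
      · refine Submodule.subset_span ⟨Finsupp.single (Var.x i) 1, fun j hj => ?_,
          by simp [mon_single_x]⟩
        have : i < s := hi
        rw [Finsupp.single_eq_of_ne (by simp; omega)]
    · intro c
      rw [Algebra.algebraMap_eq_smul_one, ← mon_zero]
      exact Submodule.smul_mem _ _ (Submodule.subset_span ⟨0, by simp, rfl⟩)
    · exact fun _ _ _ _ => add_mem
    · intro f g _ _ hf hg
      have h := Submodule.mul_mem_mul hf hg
      rw [Submodule.span_mul_span] at h
      refine Submodule.span_mono ?_ h
      rintro _ ⟨_, ⟨μ, hμ, rfl⟩, _, ⟨ν, hν, rfl⟩, rfl⟩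
      exact ⟨μ + ν, fun i hi => by simp [hμ i hi, hν i hi], (mon_add N μ ν).symm⟩
  · rw [Submodule.span_le]
    rintro _ ⟨μ, hμ, rfl⟩
    induction μ using Finsupp.induction with
    | zero => rw [mon_zero]; exact one_mem (cochainAlg N s)
    | single_add v k μ hv hk ih =>
      rw [mon_add]
      refine cochains_mul N ?_ (ih fun i hi => ?_)
      · cases v with
        | u => rw [mon_single_u]; exact cochains_pow N (uu_mem_cochains N s) k
        | x j =>
          rw [mon_single_x]
          refine cochains_pow N (xx_mem_cochains N ?_) k
          by_contra hj
          have := hμ j (by omega)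
          simp at this
          omega
      · have := hμ i hi
        rw [Finsupp.add_apply] at this
        omega

theorem mon_erase_mul (N : ℕ∞) (μ : Var →₀ ℕ) (s : ℕ) :
    mon N μ = mon N (μ.erase (Var.x s)) * xx N s ^ μ (Var.x s) := by
  rw [← mon_single_x, ← mon_add, Finsupp.erase_add_single]

/-- `(s+1)`-cochains are sums of products `g * x_s^k` with `g` an `s`-cochain. -/
theorem cochains_succ_induction (N : ℕ∞) {s : ℕ} {p : Cob N → Prop} (h0 : p 0)
    (hadd : ∀ f g, p f → p g → p (f + g)) (hmul : ∀ g ∈ cochains N s, ∀ k, p (g * xx N s ^ k))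
    {f : Cob N} (hf : f ∈ cochains N (s + 1)) : p f := by
  rw [cochains_eq_span] at hf
  refine Submodule.closure_induction (p := fun f _ => p f) h0 (fun f g _ _ => hadd f g) ?_ hf
  rintro c _ ⟨μ, hμ, rfl⟩
  rw [mon_erase_mul N μ s, ← smul_mul_assoc]
  refine hmul _ (Submodule.smul_mem _ _ ?_) _
  rw [cochains_eq_span]
  refine Submodule.subset_span ⟨_, fun i hi => ?_, rfl⟩
  rcases Nat.eq_or_lt_of_le hi with rfl | hi
  · simp
  · rw [Finsupp.erase_ne (by simp; omega), hμ i hi]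

/-! ### Adjoining the polynomial generators `y_r` to the cobar complex -/

/-- The indices `0 ≤ r < N`. -/
abbrev Idx (N : ℕ∞) : Type := {r : ℕ // (r : ℕ∞) < N}

/-- `Cob N [y_r : 0 ≤ r < N]`. -/
abbrev CobY (N : ℕ∞) : Type := MvPolynomial (Idx N) (Cob N)

theorem Idx.lt {N : ℕ∞} (r : Idx N) {n : ℕ} (h : N = n) : r.1 < n := by
  subst h
  exact_mod_cast r.2

theorem CobY.two_eq_zero (N : ℕ∞) : (2 : CobY N) = 0 := by
  rw [← map_ofNat C 2, XAdic.two_eq_zero, map_zero]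

theorem CobY.add_self (N : ℕ∞) (F : CobY N) : F + F = 0 := by
  rw [← two_mul, CobY.two_eq_zero, zero_mul]

/-- A function of exponents that vanishes on the exponents `k` with `x^k = 0`. -/
def Admissible (N : ℕ∞) (w : ℕ → CobY N) : Prop :=
  ∀ n : ℕ, N = n → ∀ k, 2 ^ n ≤ k → w k = 0

/-- The operation is not multiplicative, so it is prescribed on the monomial basis and only then
descends to the truncated algebra. -/
def slotPoly (N : ℕ∞) (s : ℕ) (w : ℕ → CobY N) : Poly →ₗ[F2a] CobY N :=
  (MvPolynomial.basisMonomials Var F2a).constr F2a fun μ =>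
    C (mon N (μ.erase (Var.x s))) * w (μ (Var.x s))

theorem slotPoly_monomial (N : ℕ∞) (s : ℕ) (w : ℕ → CobY N) (μ : Var →₀ ℕ) :
    slotPoly N s w (monomial μ 1) = C (mon N (μ.erase (Var.x s))) * w (μ (Var.x s)) := by
  rw [slotPoly, ← congrFun (MvPolynomial.coe_basisMonomials Var F2a) μ,
    Module.Basis.constr_basis]

/-- A monomial in the truncation ideal has a large exponent. In slot `s` it is killed by
admissibility of `w`; in another slot it survives into the coefficient, which is then zero in `Cob
N`. -/
theorem slotPoly_ker (N : ℕ∞) (s : ℕ) (w : ℕ → CobY N) (hw : Admissible N w) :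
    LinearMap.ker (Cob.mk N).toLinearMap ≤ LinearMap.ker (slotPoly N s w) := by
  intro f hf
  have hf' : Cob.mk N f = 0 := hf
  rw [Cob.mk_eq_zero_iff, mem_truncIdeal] at hf'
  rw [LinearMap.mem_ker, f.as_sum, map_sum]
  refine Finset.sum_eq_zero fun μ hμ => ?_
  obtain ⟨n, hn, i, hi⟩ := hf' μ hμ
  rw [← mul_one (coeff μ f), ← smul_eq_mul, ← MvPolynomial.smul_monomial, map_smul,
    slotPoly_monomial]
  by_cases h : i = s
  · subst h
    rw [hw n hn _ hi, mul_zero, smul_zero]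
  · rw [mon_eq_zero N hn (i := i), map_zero, zero_mul, smul_zero]
    rwa [Finsupp.erase_ne (by simpa using h)]

/-- The linear operation in slot `s` that sends `x_s^k` to `w k`. -/
def slotOp (N : ℕ∞) (s : ℕ) (w : ℕ → CobY N) (hw : Admissible N w) : Cob N →ₗ[F2a] CobY N :=
  (Submodule.liftQ _ (slotPoly N s w) (slotPoly_ker N s w hw)).comp
    ((Cob.mk N).toLinearMap.quotKerEquivOfSurjective (Cob.mk_surjective N)).symm.toLinearMap

theorem slotOp_mon (N : ℕ∞) (s : ℕ) (w : ℕ → CobY N) (hw : Admissible N w) (μ : Var →₀ ℕ) :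
    slotOp N s w hw (mon N μ) = C (mon N (μ.erase (Var.x s))) * w (μ (Var.x s)) := by
  have : ((Cob.mk N).toLinearMap.quotKerEquivOfSurjective (Cob.mk_surjective N)).symm (mon N μ) =
      Submodule.Quotient.mk (monomial μ 1) := by
    rw [LinearEquiv.symm_apply_eq]
    rfl
  rw [slotOp, LinearMap.comp_apply, LinearEquiv.coe_toLinearMap, this, Submodule.liftQ_apply,
    slotPoly_monomial]

theorem slotOp_mul_pow (N : ℕ∞) (s : ℕ) (w : ℕ → CobY N) (hw : Admissible N w) {g : Cob N}
    (hg : g ∈ cochains N s) (k : ℕ) : slotOp N s w hw (g * xx N s ^ k) = C g * w k := by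
  rw [cochains_eq_span] at hg
  induction hg using Submodule.span_induction with
  | mem g hg =>
    obtain ⟨μ, hμ, rfl⟩ := hg
    rw [← mon_single_x, ← mon_add, slotOp_mon]
    congr
    · ext v
      by_cases hv : v = Var.x s
      · subst hv
        simp [hμ s le_rfl]
      · rw [Finsupp.erase_ne hv, Finsupp.add_apply, Finsupp.single_eq_of_ne hv, add_zero]
    · simp [hμ s le_rfl]
  | zero => simp
  | add f g _ _ hf hg => rw [add_mul, map_add, hf, hg, C.map_add, add_mul]
  | smul c f _ hf => rw [smul_mul_assoc, map_smul, hf, MvPolynomial.C_eq_smul_one, MvPolynomial.C_eq_smul_one,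
    smul_assoc, smul_mul_assoc, smul_mul_assoc, smul_mul_assoc]

/-- The linear operation in slot `s` that sends `y^α x_s^k` to `w α k`. -/
def slotExt (N : ℕ∞) (s : ℕ) (w : (Idx N →₀ ℕ) → ℕ → CobY N) (hw : ∀ α, Admissible N (w α)) :
    CobY N →ₗ[F2a] CobY N :=
  (Finsupp.lsum F2a fun α => slotOp N s (w α) (hw α)).comp
    (AddMonoidAlgebra.coeffLinearEquiv F2a).toLinearMap

theorem slotExt_monomial (N : ℕ∞) (s : ℕ) (w : (Idx N →₀ ℕ) → ℕ → CobY N)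
    (hw : ∀ α, Admissible N (w α)) (α : Idx N →₀ ℕ) (c : Cob N) :
    slotExt N s w hw (monomial α c) = slotOp N s (w α) (hw α) c := by
  have h : (AddMonoidAlgebra.coeffLinearEquiv F2a).toLinearMap (monomial α c : CobY N) =
      Finsupp.single α c := rfl
  rw [slotExt, LinearMap.comp_apply, h, Finsupp.lsum_single]

theorem slotExt_mul_pow (N : ℕ∞) (s : ℕ) (w : (Idx N →₀ ℕ) → ℕ → CobY N)
    (hw : ∀ α, Admissible N (w α)) (α : Idx N →₀ ℕ) {g : Cob N} (hg : g ∈ cochains N s) (k : ℕ) :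
    slotExt N s w hw (monomial α (g * xx N s ^ k)) = C g * w α k := by
  rw [slotExt_monomial, slotOp_mul_pow N s _ _ hg]

/-! ### The operators -/

/-- `y_r` if `k = 2^r`, and zero otherwise. -/
def yPow (N : ℕ∞) (k : ℕ) : CobY N :=
  open Classical in if h : ∃ r : Idx N, k = 2 ^ r.1 then X h.choose else 0

theorem yPow_two_pow (N : ℕ∞) (r : Idx N) : yPow N (2 ^ r.1) = X r := by
  have h : ∃ t : Idx N, 2 ^ r.1 = 2 ^ t.1 := ⟨r, rfl⟩
  rw [yPow, dif_pos h]
  congr 1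
  exact Subtype.ext (Nat.pow_right_injective le_rfl h.choose_spec).symm

theorem yPow_eq_zero (N : ℕ∞) {k : ℕ} (h : ∀ r : Idx N, k ≠ 2 ^ r.1) : yPow N k = 0 := by
  rw [yPow, dif_neg]
  rintro ⟨r, hr⟩
  exact h r hr

theorem yPow_admissible (N : ℕ∞) (α : Idx N →₀ ℕ) :
    Admissible N fun k => monomial α 1 * yPow N k := by
  intro n hn k hk
  change _ * yPow N k = 0
  rw [yPow_eq_zero, mul_zero]
  rintro r rfl
  have := (Nat.pow_le_pow_iff_right (one_lt_two)).mp hk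
  have := r.lt hn
  omega

/-- The operation `x_s^(2^r) ↦ y_r` in slot `s`, that sends all other powers of `x_s` to zero. -/
def toY (N : ℕ∞) (s : ℕ) : CobY N →ₗ[F2a] CobY N :=
  slotExt N s (fun α k => monomial α 1 * yPow N k) (yPow_admissible N)

theorem toY_mul_pow (N : ℕ∞) (s : ℕ) (α : Idx N →₀ ℕ) {g : Cob N} (hg : g ∈ cochains N s)
    (k : ℕ) : toY N s (monomial α (g * xx N s ^ k)) = monomial α g * yPow N k := by
  rw [toY, slotExt_mul_pow N s _ _ _ hg, ← mul_assoc, MvPolynomial.C_mul_monomial, mul_one]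

/-- Apply an endomorphism of `Cob N` to coefficients. -/
def mapY (N : ℕ∞) (φ : Cob N →ₐ[F2a] Cob N) : CobY N →ₐ[F2a] CobY N :=
  MvPolynomial.mapAlgHom φ

theorem mapY_monomial (N : ℕ∞) (φ : Cob N →ₐ[F2a] Cob N) (α : Idx N →₀ ℕ) (c : Cob N) :
    mapY N φ (monomial α c) = monomial α (φ c) := MvPolynomial.map_monomial _ _ _

theorem mapY_yPow (N : ℕ∞) (φ : Cob N →ₐ[F2a] Cob N) (k : ℕ) :
    mapY N φ (yPow N k) = yPow N k := by
  rw [yPow]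
  split_ifs
  · exact MvPolynomial.map_X _ _
  · exact map_zero _

theorem coeff_mapY (N : ℕ∞) (φ : Cob N →ₐ[F2a] Cob N) (α : Idx N →₀ ℕ) (F : CobY N) :
    coeff α (mapY N φ F) = φ (coeff α F) := MvPolynomial.coeff_map _ _ _

/-- `A ⊗ H^{⊗ i} ⊗ 𝔽₂[y_r]` in degree `j` in the `y_r`. -/
def mixed (N : ℕ∞) (i j : ℕ) : Submodule F2a (CobY N) :=
  Submodule.span F2a {F | ∃ (α : Idx N →₀ ℕ) (g : Cob N),
    α.degree = j ∧ g ∈ cochains N i ∧ F = monomial α g}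

theorem monomial_mem_mixed (N : ℕ∞) {i : ℕ} (α : Idx N →₀ ℕ) {g : Cob N}
    (hg : g ∈ cochains N i) : monomial α g ∈ mixed N i α.degree :=
  Submodule.subset_span ⟨α, g, rfl, hg, rfl⟩

theorem monomial_mem_mixed' (N : ℕ∞) {i j : ℕ} (α : Idx N →₀ ℕ) (hα : α.degree = j) {g : Cob N}
    (hg : g ∈ cochains N i) : monomial α g ∈ mixed N i j :=
  Submodule.subset_span ⟨α, g, hα, hg, rfl⟩

theorem mixed_induction (N : ℕ∞) {i j : ℕ} {p : CobY N → Prop} (h0 : p 0)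
    (hadd : ∀ f g, p f → p g → p (f + g))
    (hmon : ∀ α : Idx N →₀ ℕ, α.degree = j → ∀ g ∈ cochains N i, p (monomial α g))
    {F : CobY N} (hF : F ∈ mixed N i j) : p F := by
  refine Submodule.closure_induction (p := fun f _ => p f) h0 (fun f g _ _ => hadd f g) ?_ hF
  rintro c _ ⟨α, g, hα, hg, rfl⟩
  rw [MvPolynomial.smul_monomial]
  exact hmon α hα _ (Submodule.smul_mem _ _ hg)

theorem mixed_succ_induction (N : ℕ∞) {i j : ℕ} {p : CobY N → Prop} (h0 : p 0)
    (hadd : ∀ f g, p f → p g → p (f + g))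
    (hmon : ∀ α : Idx N →₀ ℕ, α.degree = j → ∀ g ∈ cochains N i, ∀ k,
      p (monomial α (g * xx N i ^ k)))
    {F : CobY N} (hF : F ∈ mixed N (i + 1) j) : p F := by
  refine mixed_induction N h0 hadd (fun α hα g hg => ?_) hF
  refine cochains_succ_induction N (p := fun g => p (monomial α g)) ?_ ?_ ?_ hg
  · simpa using h0
  · intro f g hf hg
    rw [map_add]
    exact hadd _ _ hf hg
  · exact fun g hg k => hmon α hα g hg k

theorem mixed_mono (N : ℕ∞) {i i' : ℕ} (h : i ≤ i') (j : ℕ) : mixed N i j ≤ mixed N i' j := by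
  refine Submodule.span_mono ?_
  rintro _ ⟨α, g, hα, hg, rfl⟩
  exact ⟨α, g, hα, cochains_mono N h hg, rfl⟩

theorem mixed_mul (N : ℕ∞) {i j l : ℕ} {F G : CobY N} (hF : F ∈ mixed N i j)
    (hG : G ∈ mixed N i l) : F * G ∈ mixed N i (j + l) := by
  have h := Submodule.mul_mem_mul hF hG
  rw [mixed, mixed, Submodule.span_mul_span] at h
  refine Submodule.span_mono ?_ h
  rintro _ ⟨_, ⟨α, f, hα, hf, rfl⟩, _, ⟨β, g, hβ, hg, rfl⟩, rfl⟩
  exact ⟨α + β, f * g, by rw [map_add, hα, hβ], cochains_mul N hf hg,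
    MvPolynomial.monomial_mul⟩

theorem C_mem_mixed (N : ℕ∞) {i : ℕ} {g : Cob N} (hg : g ∈ cochains N i) :
    C g ∈ mixed N i 0 := monomial_mem_mixed' N 0 (map_zero _) hg

theorem yPow_mem_mixed (N : ℕ∞) (i k : ℕ) : yPow N k ∈ mixed N i 1 := by
  rw [yPow]
  split_ifs
  · exact monomial_mem_mixed' N _ (Finsupp.degree_single _ _) (one_mem (cochainAlg N i))
  · exact zero_mem _

theorem toY_mem (N : ℕ∞) {i j : ℕ} {F : CobY N} (hF : F ∈ mixed N (i + 1) j) :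
    toY N i F ∈ mixed N i (j + 1) := by
  refine mixed_succ_induction N (p := fun F => toY N i F ∈ mixed N i (j + 1)) ?_ ?_ ?_ hF
  · rw [map_zero]; exact zero_mem _
  · intro F G hF hG
    rw [map_add]; exact add_mem hF hG
  · intro α hα g hg k
    rw [toY_mul_pow N i α hg]
    exact mixed_mul N (monomial_mem_mixed' N α hα hg) (yPow_mem_mixed N i k)

theorem mapY_mem (N : ℕ∞) (φ : Cob N →ₐ[F2a] Cob N) {i i' j : ℕ}
    (h : ∀ f ∈ cochains N i, φ f ∈ cochains N i') {F : CobY N} (hF : F ∈ mixed N i j) :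
    mapY N φ F ∈ mixed N i' j := by
  refine mixed_induction N (p := fun F => mapY N φ F ∈ mixed N i' j) ?_ ?_ ?_ hF
  · rw [map_zero]; exact zero_mem _
  · intro _ _ hF hG
    rw [map_add]; exact add_mem hF hG
  · intro α hα g hg
    rw [mapY_monomial]
    exact monomial_mem_mixed' N α hα (h g hg)

theorem mapY_shift_mem (N : ℕ∞) {i j : ℕ} {F : CobY N} (hF : F ∈ mixed N i j) :
    mapY N (shift N 1) F ∈ mixed N (i + 1) j :=
  mapY_mem N _ (fun f hf => by rw [add_comm]; exact shift_mem N 1 i hf) hF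

theorem mapY_comul_mem (N : ℕ∞) (l : ℕ) {i j : ℕ} {F : CobY N} (hF : F ∈ mixed N i j) :
    mapY N (comul N l) F ∈ mixed N (i + 1) j :=
  mapY_mem N _ (fun _ hf => comul_mem N i l hf) hF

/-- Operations that move slot `i` to slot `i + 1` commute with `toY`. -/
theorem toY_mapY (N : ℕ∞) (φ : Cob N →ₐ[F2a] Cob N) {i j : ℕ}
    (h : ∀ f ∈ cochains N i, φ f ∈ cochains N (i + 1)) (hx : φ (xx N i) = xx N (i + 1))
    {F : CobY N} (hF : F ∈ mixed N (i + 1) j) :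
    toY N (i + 1) (mapY N φ F) = mapY N φ (toY N i F) := by
  refine mixed_succ_induction N
    (p := fun F => toY N (i + 1) (mapY N φ F) = mapY N φ (toY N i F)) ?_ ?_ ?_ hF
  · simp only [map_zero]
  · intro F G hF hG
    simp only [map_add, hF, hG]
  · intro α hα g hg k
    rw [toY_mul_pow N i α hg, mapY_monomial, map_mul, map_pow, hx,
      toY_mul_pow N (i + 1) α (h g hg), map_mul, mapY_monomial, mapY_yPow]

theorem toY_shift (N : ℕ∞) {i j : ℕ} {F : CobY N} (hF : F ∈ mixed N (i + 1) j) :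
    toY N (i + 1) (mapY N (shift N 1) F) = mapY N (shift N 1) (toY N i F) :=
  toY_mapY N _ (fun f hf => by rw [add_comm]; exact shift_mem N 1 i hf)
    (by rw [shift_xx, add_comm]) hF

theorem toY_comul (N : ℕ∞) {l i j : ℕ} (hl : l < i) {F : CobY N} (hF : F ∈ mixed N (i + 1) j) :
    toY N (i + 1) (mapY N (comul N l) F) = mapY N (comul N l) (toY N i F) :=
  toY_mapY N _ (fun f hf => comul_mem N i l hf)
    (by rw [comul_xx, if_neg (by omega), if_neg (by omega)]) hF

/-- Here slot `i` contains `x^0`, and `0` is not a power of two: the twisting cochain vanishes on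
`1`. -/
theorem toY_of_mem (N : ℕ∞) {i j : ℕ} {F : CobY N} (hF : F ∈ mixed N i j) : toY N i F = 0 := by
  refine mixed_induction N (p := fun F => toY N i F = 0) (map_zero _) ?_ ?_ hF
  · intro F G hF hG
    rw [map_add, hF, hG, add_zero]
  · intro α hα g hg
    rw [← mul_one g, ← pow_zero (xx N i), toY_mul_pow N i α hg, yPow_eq_zero, mul_zero]
    intro r
    positivity

/-! ### Binary digits -/

/-- Lucas' theorem at the prime two, used to read binomial coefficients as binary digits. -/
theorem choose_two_pow_mod (k r : ℕ) : k.choose (2 ^ r) % 2 = (k.testBit r).toNat := by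
  have : Fact (Nat.Prime 2) := ⟨Nat.prime_two⟩
  induction r generalizing k with
  | zero => simp [Nat.testBit_zero, Nat.choose_one_right]; rcases Nat.mod_two_eq_zero_or_one k with h | h <;> simp [h]
  | succ r ih =>
    have h := Choose.choose_modEq_choose_mod_mul_choose_div_nat (p := 2) (n := k) (k := 2 ^ (r + 1))
    have h1 : 2 ^ (r + 1) / 2 = 2 ^ r := by rw [pow_succ]; simp
    have h2 : 2 ^ (r + 1) % 2 = 0 := by rw [pow_succ]; simp
    rw [h1, h2, Nat.choose_zero_right, one_mul] at h
    rw [h, ih, Nat.testBit_succ]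

theorem choose_two_pow_cast {R : Type} [CommRing R] (h2 : (2 : R) = 0) (k r : ℕ) :
    (k.choose (2 ^ r) : R) = if k.testBit r then 1 else 0 := by
  rw [← Nat.div_add_mod (k.choose (2 ^ r)) 2, choose_two_pow_mod]
  push_cast
  rw [h2, zero_mul, zero_add]
  cases k.testBit r <;> simp

theorem two_pow_le_of_testBit {k r : ℕ} (h : k.testBit r = true) : 2 ^ r ≤ k :=
  Nat.ge_two_pow_of_testBit h

theorem testBit_iff_of_dvd {k t : ℕ} (h : 2 ^ t ∣ k) :
    k.testBit t = true ↔ ¬ 2 ^ (t + 1) ∣ k := by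
  obtain ⟨m, rfl⟩ := h
  rw [pow_succ, Nat.mul_dvd_mul_iff_left (by positivity), Nat.testBit_two_pow_mul]
  simp [Nat.testBit_zero]

theorem le_of_testBit_of_dvd {k t r : ℕ} (h : k.testBit r = true) (hk : 2 ^ t ∣ k) : t ≤ r := by
  obtain ⟨m, rfl⟩ := hk
  rw [Nat.testBit_two_pow_mul] at h
  simp at h
  exact h.1

theorem testBit_add_two_pow {k t : ℕ} (h : 2 ^ (t + 1) ∣ k) (r : ℕ) :
    (k + 2 ^ t).testBit r = true ↔ r = t ∨ k.testBit r = true := by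
  obtain ⟨m, rfl⟩ := h
  have : 2 ^ (t + 1) * m + 2 ^ t = 2 ^ t * (2 * m + 1) := by ring
  rw [this, Nat.testBit_two_pow_mul, Nat.testBit_two_pow_mul]
  rcases lt_trichotomy r t with hr | rfl | hr
  · simp; omega
  · simp [Nat.testBit_zero]
  · obtain ⟨d, rfl⟩ := Nat.exists_eq_add_of_lt hr
    have e1 : t + d + 1 - t = d + 1 := by omega
    have e2 : t + d + 1 - (t + 1) = d := by omega
    rw [e1, e2, Nat.testBit_succ]
    have : (2 * m + 1) / 2 = m := by omega
    rw [this]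
    simp
    constructor
    · exact fun h => Or.inr h.2
    · rintro (h | h)
      · omega
      · exact ⟨by omega, h⟩

/-- The binary digits of `k` below `N`. -/
def bits (N : ℕ∞) (k : ℕ) : Finset (Idx N) :=
  open Classical in ((Finset.range (k + 1)).filter fun r => k.testBit r = true).subtype _

theorem mem_bits (N : ℕ∞) (k : ℕ) (r : Idx N) : r ∈ bits N k ↔ k.testBit r.1 = true := by
  rw [bits, Finset.mem_subtype, Finset.mem_filter, Finset.mem_range, and_iff_right_iff_imp]
  intro h
  have := two_pow_le_of_testBit h
  have := Nat.lt_two_pow_self (n := r.1)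
  omega

/-- A binomial expansion, with the exponents `2^r` selected by `yPow`. -/
theorem sum_choose_mul_yPow (N : ℕ∞) (k : ℕ) (φ : ℕ → CobY N) :
    ∑ i ∈ Finset.range (k + 1), φ i * yPow N i * (k.choose i : CobY N) =
      ∑ r ∈ bits N k, φ (2 ^ r.1) * X r := by
  symm
  refine Finset.sum_of_injOn (fun r => 2 ^ r.1) ?_ ?_ ?_ ?_
  · intro r _ t _ h
    exact Subtype.ext (Nat.pow_right_injective le_rfl h)
  · intro r hr
    have := two_pow_le_of_testBit ((mem_bits N k r).mp hr)
    simp only [Finset.coe_range, Set.mem_Iio]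
    omega
  · intro i _ hi
    by_cases h : ∃ r : Idx N, i = 2 ^ r.1
    · obtain ⟨r, rfl⟩ := h
      have : ¬ k.testBit r.1 = true := by
        rw [← mem_bits]
        exact fun h => hi ⟨r, h, rfl⟩
      rw [choose_two_pow_cast (CobY.two_eq_zero N), if_neg this, mul_zero]
    · rw [yPow_eq_zero N fun r hr => h ⟨r, hr⟩, mul_zero, zero_mul]
  · intro r hr
    rw [yPow_two_pow, choose_two_pow_cast (CobY.two_eq_zero N),
      if_pos ((mem_bits N k r).mp hr), mul_one]

/-- The Koszul differential on the Koszul resolution of `𝔽₂` over `H`, in the last slot `i`. -/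
def kosz (N : ℕ∞) (i : ℕ) : CobY N →ₗ[F2a] CobY N :=
  (toY N (i + 1)).comp (mapY N (comul N i)).toLinearMap

theorem kosz_apply (N : ℕ∞) (i : ℕ) (F : CobY N) :
    kosz N i F = toY N (i + 1) (mapY N (comul N i) F) := rfl

/-- Expanding `(x_i + x_{i+1})^k`, the map `toY` retains the exponents `2^r` of `x_{i+1}`. Their
coefficients `k.choose (2^r)` are the binary digits of `k`. -/
theorem kosz_mul_pow (N : ℕ∞) (i : ℕ) (α : Idx N →₀ ℕ) {g : Cob N} (hg : g ∈ cochains N i)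
    (k : ℕ) : kosz N i (monomial α (g * xx N i ^ k)) =
      ∑ r ∈ bits N k, monomial (α + Finsupp.single r 1) (g * xx N i ^ (k - 2 ^ r.1)) := by
  have hgi : comul N i g = g := comul_of_mem N i 0 hg
  have e : comul N i (g * xx N i ^ k) =
      ∑ l ∈ Finset.range (k + 1), (k.choose l • (g * xx N i ^ (k - l))) * xx N (i + 1) ^ l := by
    rw [map_mul, map_pow, hgi, comul_xx, if_neg (lt_irrefl _), if_pos rfl, add_comm, add_pow,
      Finset.mul_sum]
    refine Finset.sum_congr rfl fun l _ => ?_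
    rw [nsmul_eq_mul]
    ring
  rw [kosz_apply, mapY_monomial, e, map_sum, map_sum]
  have h1 : ∀ l ∈ Finset.range (k + 1), toY N (i + 1)
      (monomial α ((k.choose l • (g * xx N i ^ (k - l))) * xx N (i + 1) ^ l)) =
      monomial α (g * xx N i ^ (k - l)) * yPow N l * (k.choose l : CobY N) := by
    intro l _
    rw [toY_mul_pow]
    · rw [map_nsmul, nsmul_eq_mul]
      ring
    · exact nsmul_mem (cochains_mul N (cochains_mono N (Nat.le_succ i) hg)
        (cochains_pow N (xx_mem_cochains N (Nat.lt_succ_self i)) _)) _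
  rw [Finset.sum_congr rfl h1,
    sum_choose_mul_yPow N k fun l => monomial α (g * xx N i ^ (k - l))]
  refine Finset.sum_congr rfl fun r _ => ?_
  rw [X, MvPolynomial.monomial_mul, mul_one]

/-- The twisting cochain condition. Only `k = 2^r + 2^t` with `r ≠ t` can contribute, and then the
terms `y_r y_t` and `y_t y_r` cancel in characteristic two. -/
theorem toY_toY_comul (N : ℕ∞) {i j : ℕ} {F : CobY N} (hF : F ∈ mixed N (i + 1) j) :
    toY N i (kosz N i F) = 0 := by
  refine mixed_succ_induction N (p := fun F => toY N i (kosz N i F) = 0) ?_ ?_ ?_ hF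
  · simp only [map_zero]
  · intro F G hF hG
    simp only [map_add, hF, hG, add_zero]
  · intro α hα g hg k
    rw [kosz_mul_pow N i α hg, map_sum]
    by_cases h : ∃ r t : Idx N, r ∈ bits N k ∧ k - 2 ^ r.1 = 2 ^ t.1
    · obtain ⟨r, t, hr, ht⟩ := h
      have hrk := two_pow_le_of_testBit ((mem_bits N k r).mp hr)
      -- Equality would give `k = 2^(r+1)`, whose digit at `r` is zero: the corresponding binomial
      -- coefficient is even.
      have hne : r ≠ t := by
        rintro rfl
        have hk : k = 2 ^ (r.1 + 1) := by rw [pow_succ]; omega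
        have h3 := (mem_bits N k r).mp hr
        rw [hk, Nat.testBit_two_pow] at h3
        simp at h3
      have hne' : r.1 ≠ t.1 := fun h => hne (Subtype.ext h)
      have hk : k = 2 ^ r.1 + 2 ^ t.1 := by omega
      have hb : bits N k = {r, t} := by
        ext q
        rw [mem_bits, Finset.mem_insert, Finset.mem_singleton, Subtype.ext_iff, Subtype.ext_iff]
        rcases lt_or_gt_of_ne hne' with hlt | hlt
        · rw [hk, add_comm, testBit_add_two_pow (pow_dvd_pow 2 hlt), Nat.testBit_two_pow]
          simp [eq_comm]
        · rw [hk, testBit_add_two_pow (pow_dvd_pow 2 hlt), Nat.testBit_two_pow]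
          simp [eq_comm, or_comm]
      rw [hb, Finset.sum_pair hne, toY_mul_pow N i _ hg, toY_mul_pow N i _ hg, ht,
        show k - 2 ^ t.1 = 2 ^ r.1 from by rw [hk, Nat.add_sub_cancel], yPow_two_pow, yPow_two_pow, X, X,
        MvPolynomial.monomial_mul, MvPolynomial.monomial_mul, add_right_comm]
      exact CobY.add_self N _
    · refine Finset.sum_eq_zero fun r hr => ?_
      rw [toY_mul_pow N i _ hg, yPow_eq_zero, mul_zero]
      exact fun t ht => h ⟨r, t, hr, ht⟩

/-! ### Contractions -/

/-- The counit in slot `i`. -/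
def counit (N : ℕ∞) (i : ℕ) : Cob N →ₐ[F2a] Cob N :=
  subst N (fun v => match v with
    | Var.u => uu N
    | Var.x l => if l = i then 0 else xx N l) (by
    intro n hn l
    dsimp only
    split_ifs
    · exact zero_pow (by positivity)
    · exact xx_pow N n hn l)

theorem counit_uu (N : ℕ∞) (i : ℕ) : counit N i (uu N) = uu N := subst_uu _ _ _

theorem counit_xx (N : ℕ∞) (i l : ℕ) : counit N i (xx N l) = if l = i then 0 else xx N l :=
  subst_xx _ _ _ _

theorem counit_of_mem (N : ℕ∞) (i : ℕ) {f : Cob N} (hf : f ∈ cochains N i) :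
    counit N i f = f := by
  have h : cochainAlg N i ≤ AlgHom.equalizer (counit N i) (AlgHom.id F2a (Cob N)) := by
    rw [cochainAlg, Algebra.adjoin_le_iff]
    rintro _ (rfl | ⟨l, hl, rfl⟩)
    · exact counit_uu N _
    · have hl' : l < i := hl
      change counit N i (xx N l) = xx N l
      rw [counit_xx, if_neg (by omega)]
  exact h hf

theorem counit_mem (N : ℕ∞) (i : ℕ) {f : Cob N} (hf : f ∈ cochains N (i + 1)) :
    counit N i f ∈ cochains N i := by
  refine cochains_succ_induction N (p := fun f => counit N i f ∈ cochains N i) ?_ ?_ ?_ hf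
  · rw [map_zero]; exact zero_mem _
  · intro f g hf hg
    rw [map_add]; exact add_mem hf hg
  · intro g hg k
    rw [map_mul, map_pow, counit_of_mem N i hg, counit_xx, if_pos rfl]
    refine cochains_mul N hg ?_
    rcases Nat.eq_zero_or_pos k with rfl | hk
    · rw [pow_zero]; exact one_mem (cochainAlg N i)
    · rw [zero_pow hk.ne']; exact zero_mem _

/-- The cobar differential for coefficients in a cofree comodule, whose cogenerating slot is the
last one of the `i` slots. -/
def cofreeD (N : ℕ∞) (i : ℕ) : CobY N →ₗ[F2a] CobY N :=
  (mapY N (shift N 1)).toLinearMap + ∑ l ∈ Finset.range i, (mapY N (comul N l)).toLinearMap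

theorem cofreeD_apply (N : ℕ∞) (i : ℕ) (F : CobY N) :
    cofreeD N i F = mapY N (shift N 1) F + ∑ l ∈ Finset.range i, mapY N (comul N l) F := by
  simp [cofreeD]

/-- The differential `diff` has the additional last coface `m[…|1]`, which is the identity in this
model. Adding the identity removes it. -/
theorem cofreeD_monomial (N : ℕ∞) (i : ℕ) (α : Idx N →₀ ℕ) (g : Cob N) :
    cofreeD N i (monomial α g) = monomial α (diff N i g + g) := by
  simp only [cofreeD_apply, diff_apply, mapY_monomial, add_assoc, add_self, add_zero, map_add,
    map_sum]

theorem cofreeD_mem (N : ℕ∞) {i j : ℕ} {F : CobY N} (hF : F ∈ mixed N i j) :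
    cofreeD N i F ∈ mixed N (i + 1) j := by
  rw [cofreeD_apply]
  exact add_mem (mapY_shift_mem N hF) (sum_mem fun l _ => mapY_comul_mem N l hF)

theorem mapY_comul_of_mem (N : ℕ∞) {i j : ℕ} {F : CobY N} (hF : F ∈ mixed N i j) :
    mapY N (comul N i) F = F := by
  refine mixed_induction N (p := fun F => mapY N (comul N i) F = F) (map_zero _) ?_ ?_ hF
  · intro F G hF hG
    rw [map_add, hF, hG]
  · intro α _ g hg
    have h : comul N i g = g := comul_of_mem N i 0 hg
    rw [mapY_monomial, h]

theorem cofreeD_succ (N : ℕ∞) (i : ℕ) (F : CobY N) :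
    cofreeD N (i + 1) F = cofreeD N i F + mapY N (comul N i) F := by
  rw [cofreeD_apply, cofreeD_apply, Finset.sum_range_succ, add_assoc]

theorem cofreeD_succ_of_mem (N : ℕ∞) {i j : ℕ} {F : CobY N} (hF : F ∈ mixed N i j) :
    cofreeD N (i + 1) F = cofreeD N i F + F := by
  rw [cofreeD_succ, mapY_comul_of_mem N hF]

theorem C_diff (N : ℕ∞) (i : ℕ) (f : Cob N) : C (diff N i f) = cofreeD N i (C f) + C f := by
  rw [MvPolynomial.C_apply, MvPolynomial.C_apply, cofreeD_monomial, ← map_add, add_assoc, add_self, add_zero]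

theorem cofreeD_cofreeD (N : ℕ∞) {i j : ℕ} {F : CobY N} (hF : F ∈ mixed N i j) :
    cofreeD N (i + 1) (cofreeD N i F) = 0 := by
  refine mixed_induction N (p := fun F => cofreeD N (i + 1) (cofreeD N i F) = 0) ?_ ?_ ?_ hF
  · simp only [map_zero]
  · intro F G hF hG
    rw [map_add, map_add, hF, hG, add_zero]
  · intro α _ g hg
    have h1 := cofreeD_succ_of_mem N (monomial_mem_mixed N α hg)
    rw [cofreeD_monomial, map_add, map_add, h1, cofreeD_monomial, cofreeD_monomial, diff_diff N i hg,
      ← map_add, ← map_add]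
    convert (monomial α).map_zero using 2
    linear_combination (diff N i g + g) * two_eq_zero N

/-- Coassociativity: the comultiplication of the cogenerating slot commutes with the cofaces in the
lower slots. The two differentials therefore form a double complex. -/
theorem kosz_cofreeD (N : ℕ∞) {i j : ℕ} {F : CobY N} (hF : F ∈ mixed N (i + 1) j) :
    kosz N (i + 1) (cofreeD N (i + 1) F) = cofreeD N (i + 1) (kosz N i F) := by
  have hG := mapY_comul_mem N i hF
  have e1 : mapY N (comul N (i + 1)) (mapY N (shift N 1) F) =
      mapY N (shift N 1) (mapY N (comul N i) F) := by
    ext α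
    rw [coeff_mapY, coeff_mapY, coeff_mapY, coeff_mapY, add_comm i 1, comul_shift_add]
  have e2 : ∀ l ∈ Finset.range (i + 1), toY N (i + 1 + 1) (mapY N (comul N (i + 1))
      (mapY N (comul N l) F)) = mapY N (comul N l) (toY N (i + 1) (mapY N (comul N i) F)) := by
    intro l hl
    have hl' := Finset.mem_range.mp hl
    have e : mapY N (comul N (i + 1)) (mapY N (comul N l) F) =
        mapY N (comul N l) (mapY N (comul N i) F) := by
      ext α
      rw [coeff_mapY, coeff_mapY, coeff_mapY, coeff_mapY]
      exact (comul_comul N (by omega) _).symm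
    rw [e, toY_comul N hl' hG]
  rw [cofreeD_apply, cofreeD_apply, map_add, map_sum, kosz_apply, kosz_apply, e1,
    toY_shift N hG]
  congr 1
  exact Finset.sum_congr rfl e2

/-- `t` is the least index with `α t ≠ 0`. -/
def IsLow {N : ℕ∞} (α : Idx N →₀ ℕ) (t : Idx N) : Prop := α t ≠ 0 ∧ ∀ r < t, α r = 0

theorem exists_isLow {N : ℕ∞} {α : Idx N →₀ ℕ} (h : α ≠ 0) : ∃ t, IsLow α t := by
  have hs : α.support.Nonempty := Finsupp.support_nonempty_iff.mpr h
  refine ⟨α.support.min' hs, Finsupp.mem_support_iff.mp (Finset.min'_mem _ _), fun r hr => ?_⟩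
  by_contra hne
  exact absurd (Finset.min'_le _ _ (Finsupp.mem_support_iff.mpr hne)) (not_le.mpr hr)

theorem IsLow.unique {N : ℕ∞} {α : Idx N →₀ ℕ} {t r : Idx N} (h : IsLow α t)
    (hr : IsLow α r) : t = r := by
  rcases lt_trichotomy t r with hl | he | hl
  · exact absurd (hr.2 t hl) h.1
  · exact he
  · exact absurd (h.2 r hl) hr.1

/-- The value of the contraction of the Koszul resolution on `y^α x_i^k`. -/
def contractFun (N : ℕ∞) (i : ℕ) (α : Idx N →₀ ℕ) (k : ℕ) : CobY N :=
  open Classical in if h : ∃ t, IsLow α t ∧ 2 ^ (t.1 + 1) ∣ k then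
    monomial (α - Finsupp.single h.choose 1) (xx N i ^ (k + 2 ^ h.choose.1)) else 0

theorem contractFun_of_dvd (N : ℕ∞) (i : ℕ) {α : Idx N →₀ ℕ} {k : ℕ} {t : Idx N}
    (ht : IsLow α t) (hk : 2 ^ (t.1 + 1) ∣ k) : contractFun N i α k =
      monomial (α - Finsupp.single t 1) (xx N i ^ (k + 2 ^ t.1)) := by
  have h : ∃ t, IsLow α t ∧ 2 ^ (t.1 + 1) ∣ k := ⟨t, ht, hk⟩
  rw [contractFun, dif_pos h, h.choose_spec.1.unique ht]

theorem contractFun_eq_zero (N : ℕ∞) (i : ℕ) {α : Idx N →₀ ℕ} {k : ℕ}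
    (h : ∀ t, IsLow α t → ¬ 2 ^ (t.1 + 1) ∣ k) : contractFun N i α k = 0 := by
  rw [contractFun, dif_neg]
  rintro ⟨t, ht, hk⟩
  exact h t ht hk

theorem xx_pow_of_le (N : ℕ∞) (i : ℕ) {n k : ℕ} (hn : N = n) (hk : 2 ^ n ≤ k) :
    xx N i ^ k = 0 := by
  rw [← Nat.sub_add_cancel hk, pow_add, xx_pow N n hn, mul_zero]

theorem contractFun_admissible (N : ℕ∞) (i : ℕ) (α : Idx N →₀ ℕ) :
    Admissible N (contractFun N i α) := by
  intro n hn k hk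
  rw [contractFun]
  split_ifs
  · rw [xx_pow_of_le N i hn (hk.trans (Nat.le_add_right _ _)), map_zero]
  · rfl

/-- The contraction of the Koszul resolution in slot `i`. -/
def contract (N : ℕ∞) (i : ℕ) : CobY N →ₗ[F2a] CobY N :=
  slotExt N i (contractFun N i) (contractFun_admissible N i)

theorem contract_mul_pow (N : ℕ∞) (i : ℕ) (α : Idx N →₀ ℕ) {g : Cob N} (hg : g ∈ cochains N i)
    (k : ℕ) : contract N i (monomial α (g * xx N i ^ k)) = C g * contractFun N i α k :=
  slotExt_mul_pow N i _ _ α hg k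

/-- The resolution is the tensor product of the small resolutions `𝔽₂[x^(2^r)]/(x^(2^(r+1))) ⊗
𝔽₂[y_r]`. The contraction acts at the lowest index occurring in the monomial: if a `y_t` occurs and
no digit of `k` is at or below `t`, it trades one `y_t` for `x^(2^t)`. Of all monomials only `1` is
excluded. -/
theorem contract_kosz_aux (N : ℕ∞) (i : ℕ) (α : Idx N →₀ ℕ) {k : ℕ} (h0 : α ≠ 0 ∨ k ≠ 0)
    {g : Cob N} (hg : g ∈ cochains N i) :
    contract N i (kosz N i (monomial α (g * xx N i ^ k))) +
      kosz N i (contract N i (monomial α (g * xx N i ^ k))) = monomial α (g * xx N i ^ k) := by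
  by_cases hx : xx N i ^ k = 0
  · simp [hx]
  -- As `x^k ≠ 0`, all binary digits of `k` lie below `N`, so `bits N k` loses none of them.
  have hlt : ∀ r, k.testBit r = true → (r : ℕ∞) < N := by
    intro r hr
    by_contra hN
    obtain ⟨n, rfl⟩ := ENat.ne_top_iff_exists.mp (ne_top_of_le_ne_top (ENat.natCast_ne_top r)
      (not_lt.mp hN))
    have hnr : n ≤ r := by exact_mod_cast not_lt.mp hN
    exact hx (xx_pow_of_le _ i rfl
      ((Nat.pow_le_pow_right two_pos hnr).trans (two_pow_le_of_testBit hr)))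
  rw [kosz_mul_pow N i α hg, map_sum, contract_mul_pow N i α hg]
  have e1 : ∀ r ∈ bits N k, contract N i
      (monomial (α + Finsupp.single r 1) (g * xx N i ^ (k - 2 ^ r.1))) =
      C g * contractFun N i (α + Finsupp.single r 1) (k - 2 ^ r.1) :=
    fun r _ => contract_mul_pow N i _ hg _
  rw [Finset.sum_congr rfl e1]
  by_cases hB : ∃ t, IsLow α t ∧ 2 ^ (t.1 + 1) ∣ k
  · obtain ⟨t, ht, hk⟩ := hB
    have hα : α - Finsupp.single t 1 + Finsupp.single t 1 = α :=
      tsub_add_cancel_of_le (Finsupp.single_le_iff.mpr (Nat.one_le_iff_ne_zero.mpr ht.1))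
    rw [contractFun_of_dvd N i ht hk, MvPolynomial.C_mul_monomial, kosz_mul_pow N i _ hg]
    have htb : t ∉ bits N k := by
      rw [mem_bits, testBit_iff_of_dvd (dvd_trans (pow_dvd_pow 2 (Nat.le_succ _)) hk)]
      exact fun h => h hk
    have hbits : bits N (k + 2 ^ t.1) = insert t (bits N k) := by
      ext r
      rw [Finset.mem_insert, mem_bits, mem_bits, testBit_add_two_pow hk, Subtype.ext_iff]
    rw [hbits, Finset.sum_insert htb, hα, Nat.add_sub_cancel]
    -- The digit `t` added by the contraction returns the monomial itself. For the old digits, all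
    -- above `t`, the contraction still acts at `t`, so their contributions to the two composites
    -- agree and cancel.
    have e2 : ∀ r ∈ bits N k, C g * contractFun N i (α + Finsupp.single r 1) (k - 2 ^ r.1) =
        monomial (α - Finsupp.single t 1 + Finsupp.single r 1)
          (g * xx N i ^ (k + 2 ^ t.1 - 2 ^ r.1)) := by
      intro r hr
      have hr' := (mem_bits N k r).mp hr
      have htr := le_of_testBit_of_dvd hr' hk
      have hrk := two_pow_le_of_testBit hr'
      have hlow : IsLow (α + Finsupp.single r 1) t := by
        refine ⟨?_, fun q hq => ?_⟩
        · rw [Finsupp.add_apply]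
          have := ht.1
          omega
        · rw [Finsupp.add_apply, ht.2 q hq, Finsupp.single_eq_of_ne, zero_add]
          rintro rfl
          have : q.1 < t.1 := hq
          omega
      rw [contractFun_of_dvd N i hlow (Nat.dvd_sub hk (pow_dvd_pow 2 htr)),
        MvPolynomial.C_mul_monomial, Nat.sub_add_comm hrk]
      rw [tsub_add_eq_add_tsub (Finsupp.single_le_iff.mpr (Nat.one_le_iff_ne_zero.mpr ht.1))]
    rw [Finset.sum_congr rfl e2, add_left_comm, CobY.add_self, add_zero]
  · rw [contractFun_eq_zero N i fun t ht hk => hB ⟨t, ht, hk⟩, mul_zero, map_zero, add_zero]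
    have hk : k ≠ 0 := by
      rintro rfl
      obtain ⟨t, ht⟩ := exists_isLow (h0.resolve_right (by simp))
      exact hB ⟨t, ht, dvd_zero _⟩
    -- Now the lowest index `v` of the monomial comes from a digit of `k`, with no index of `α`
    -- below `v`. Removing the digit `v` creates a term that the contraction sends back to the
    -- monomial. Removing a higher digit leaves the digit `v`, so the contraction vanishes there.
    obtain ⟨v, m, hm, rfl⟩ := Nat.exists_eq_two_pow_mul_odd hk
    have hv1 : ¬ 2 ^ (v + 1) ∣ 2 ^ v * m := by
      rw [pow_succ, Nat.mul_dvd_mul_iff_left (by positivity)]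
      exact fun h => (Nat.not_even_iff_odd.mpr hm) (even_iff_two_dvd.mpr h)
    have hvb := (testBit_iff_of_dvd (Dvd.intro _ rfl)).mpr hv1
    let t : Idx N := ⟨v, hlt v hvb⟩
    have hα : ∀ r < t, α r = 0 := by
      intro r hr
      by_contra hne
      obtain ⟨q, hq⟩ := exists_isLow (α := α) (by rintro rfl; exact hne rfl)
      refine hB ⟨q, hq, (pow_dvd_pow 2 ?_).mul_right m⟩
      have h1 : r.1 < v := hr
      have h2 : q ≤ r := by
        by_contra h
        exact hne (hq.2 r (not_le.mp h))
      have h3 : q.1 ≤ r.1 := h2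
      omega
    rw [Finset.sum_eq_single_of_mem t ((mem_bits N _ t).mpr hvb)]
    · have hlow : IsLow (α + Finsupp.single t 1) t := by
        refine ⟨by simp, fun q hq => ?_⟩
        rw [Finsupp.add_apply, hα q hq, Finsupp.single_eq_of_ne hq.ne, zero_add]
      have hd : 2 ^ (v + 1) ∣ 2 ^ v * m - 2 ^ v := by
        obtain ⟨l, rfl⟩ := hm
        exact ⟨l, by rw [mul_add, mul_one, Nat.add_sub_cancel]; ring⟩
      rw [contractFun_of_dvd N i hlow hd, MvPolynomial.C_mul_monomial, add_tsub_cancel_right]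
      congr
      exact Nat.sub_add_cancel (two_pow_le_of_testBit hvb)
    · intro r hr hrt
      have hr' := (mem_bits N _ r).mp hr
      have hvr : v < r.1 := lt_of_le_of_ne (le_of_testBit_of_dvd hr' (Dvd.intro _ rfl))
        fun h => hrt (Subtype.ext h.symm)
      rw [contractFun_eq_zero, mul_zero]
      intro q hq hd
      refine hv1 ?_
      have hvq : v ≤ q.1 := by
        by_contra h
        have hqt : q < t := not_le.mp h
        refine hq.1 ?_
        rw [Finsupp.add_apply, hα q hqt, Finsupp.single_eq_of_ne, zero_add]
        rintro rfl
        omega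
      rw [← Nat.sub_add_cancel (two_pow_le_of_testBit hr')]
      exact dvd_add ((pow_dvd_pow 2 (by omega)).trans hd) (pow_dvd_pow 2 (by omega))

theorem contract_kosz (N : ℕ∞) {i j : ℕ} {F : CobY N} (hF : F ∈ mixed N (i + 1) (j + 1)) :
    contract N i (kosz N i F) + kosz N i (contract N i F) = F := by
  refine mixed_succ_induction N
    (p := fun F => contract N i (kosz N i F) + kosz N i (contract N i F) = F) ?_ ?_ ?_ hF
  · simp only [map_zero, add_zero]
  · intro F G hF hG
    simp only [map_add]
    rw [add_add_add_comm, hF, hG]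
  · intro α hα g hg k
    refine contract_kosz_aux N i α (Or.inl ?_) hg
    rintro rfl
    simp at hα

/-- In degree zero there is no `y` to remove, and the homotopy formula acquires the projection to
the resolved module `𝔽₂` through the counit. -/
theorem contract_kosz_zero (N : ℕ∞) {i : ℕ} {F : CobY N} (hF : F ∈ mixed N (i + 1) 0) :
    contract N i (kosz N i F) = F + mapY N (counit N i) F := by
  refine mixed_succ_induction N
    (p := fun F => contract N i (kosz N i F) = F + mapY N (counit N i) F) ?_ ?_ ?_ hF
  · simp only [map_zero, add_zero]
  · intro F G hF hG
    simp only [map_add]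
    rw [add_add_add_comm, hF, hG]
  · intro α hα g hg k
    have hα0 : α = 0 := (Finsupp.degree_eq_zero_iff α).mp hα
    subst hα0
    have e : counit N i (g * xx N i ^ k) = g * 0 ^ k := by
      rw [map_mul, map_pow, counit_xx, if_pos rfl, counit_of_mem N i hg]
    rw [mapY_monomial, e]
    rcases Nat.eq_zero_or_pos k with rfl | hk
    · rw [kosz_mul_pow N i _ hg, pow_zero, pow_zero, CobY.add_self]
      have : bits N 0 = ∅ := by
        ext r
        simp [mem_bits]
      rw [this, Finset.sum_empty, map_zero]
    · have h := contract_kosz_aux N i 0 (Or.inr hk.ne') hg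
      rw [contract_mul_pow N i _ hg, contractFun_eq_zero N i (fun t ht => absurd rfl ht.1),
        mul_zero, map_zero, add_zero] at h
      rw [h, zero_pow hk.ne', mul_zero, map_zero, add_zero]

theorem contract_mem (N : ℕ∞) {i j : ℕ} {F : CobY N} (hF : F ∈ mixed N (i + 1) (j + 1)) :
    contract N i F ∈ mixed N (i + 1) j := by
  refine mixed_succ_induction N (p := fun F => contract N i F ∈ mixed N (i + 1) j) ?_ ?_ ?_ hF
  · rw [map_zero]; exact zero_mem _
  · intro F G hF hG
    rw [map_add]; exact add_mem hF hG
  · intro α hα g hg k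
    rw [contract_mul_pow N i α hg]
    by_cases hB : ∃ t, IsLow α t ∧ 2 ^ (t.1 + 1) ∣ k
    · obtain ⟨t, ht, hk⟩ := hB
      have hα' : α - Finsupp.single t 1 + Finsupp.single t 1 = α :=
        tsub_add_cancel_of_le (Finsupp.single_le_iff.mpr (Nat.one_le_iff_ne_zero.mpr ht.1))
      rw [contractFun_of_dvd N i ht hk, MvPolynomial.C_mul_monomial]
      refine monomial_mem_mixed' N _ ?_ (cochains_mul N (cochains_mono N (Nat.le_succ i) hg)
        (cochains_pow N (xx_mem_cochains N (Nat.lt_succ_self i)) _))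
      rw [← hα', map_add, Finsupp.degree_single] at hα
      omega
    · rw [contractFun_eq_zero N i fun t ht hk => hB ⟨t, ht, hk⟩, mul_zero]
      exact zero_mem _

/-! ### The comparison of the cobar complex with the Koszul complex -/

/-- The composite of `toY` in the slots `i + j - 1, …, i`. -/
def toYs (N : ℕ∞) : ℕ → ℕ → CobY N →ₗ[F2a] CobY N
  | _, 0 => LinearMap.id
  | i, j + 1 => (toY N i).comp (toYs N (i + 1) j)

theorem toYs_mem (N : ℕ∞) (i j : ℕ) {l : ℕ} {F : CobY N} (hF : F ∈ mixed N (i + j) l) :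
    toYs N i j F ∈ mixed N i (l + j) := by
  induction j generalizing i with
  | zero => exact hF
  | succ j ih =>
    refine toY_mem N (ih (i + 1) ?_)
    rwa [show i + 1 + j = i + (j + 1) by omega]

/-- The last of the `j + 1` slots is not used by `F` and contains `1`, which the twisting cochain
kills. -/
theorem toYs_succ_of_mem (N : ℕ∞) (i j : ℕ) {l : ℕ} {F : CobY N} (hF : F ∈ mixed N (i + j) l) :
    toYs N i (j + 1) F = 0 := by
  induction j generalizing i with
  | zero => exact toY_of_mem N hF
  | succ j ih =>
    change toY N i (toYs N (i + 1) (j + 1) F) = 0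
    rw [ih (i + 1), map_zero]
    rwa [show i + 1 + j = i + (j + 1) by omega]

/-- Applying `toY` slot by slot, the lower cofaces commute with it and the coface that doubles the
current slot gives a `kosz`. The next `toY` kills that term by the twisting condition, so only the
one in slot `i` survives. -/
theorem toYs_cofreeD (N : ℕ∞) (i j : ℕ) {l : ℕ} {F : CobY N}
    (hF : F ∈ mixed N (i + (j + 1)) l) :
    toYs N (i + 1) (j + 1) (cofreeD N (i + (j + 1)) F) =
      cofreeD N i (toYs N i (j + 1) F) + kosz N i (toYs N (i + 1) j F) := by
  have key : ∀ (i : ℕ) {l : ℕ} {F : CobY N}, F ∈ mixed N (i + 1) l →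
      toY N (i + 1) (cofreeD N (i + 1) F) = cofreeD N i (toY N i F) + kosz N i F := by
    intro i l F hF
    rw [cofreeD_succ, map_add, ← kosz_apply, cofreeD_apply, cofreeD_apply, map_add, map_sum,
      toY_shift N hF]
    congr 2
    exact Finset.sum_congr rfl fun l hl => toY_comul N (Finset.mem_range.mp hl) hF
  induction j generalizing i with
  | zero => exact key i hF
  | succ j ih =>
    have e : i + (j + 1 + 1) = i + 1 + (j + 1) := by omega
    rw [e] at hF ⊢
    change toY N (i + 1) (toYs N (i + 1 + 1) (j + 1) (cofreeD N (i + 1 + (j + 1)) F)) = _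
    have h1 := toYs_mem N (i + 1) (j + 1) hF
    have h2 : toYs N (i + 1 + 1) j F ∈ mixed N (i + 1 + 1) (l + j) :=
      toYs_mem N (i + 1 + 1) j (by rwa [show i + 1 + 1 + j = i + 1 + (j + 1) by omega])
    rw [ih (i + 1) hF, map_add, key i h1, toY_toY_comul N h2, add_zero]
    rfl

/-- The map from `mixed N (i + 1) j` to the cobar complex. -/
def fromMixed (N : ℕ∞) : ℕ → ℕ → CobY N →ₗ[F2a] Cob N
  | i, 0 => ((MvPolynomial.lcoeff (R := Cob N) (0 : Idx N →₀ ℕ)).restrictScalars F2a).comp (mapY N (counit N i)).toLinearMap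
  | i, j + 1 => ((fromMixed N (i + 1) j).comp (cofreeD N (i + 1))).comp (contract N i)

theorem fromMixed_zero (N : ℕ∞) (i : ℕ) (F : CobY N) :
    fromMixed N i 0 F = counit N i (coeff 0 F) := by
  change coeff 0 (mapY N (counit N i) F) = _
  exact coeff_mapY N _ _ _

theorem fromMixed_succ (N : ℕ∞) (i j : ℕ) (F : CobY N) :
    fromMixed N i (j + 1) F = fromMixed N (i + 1) j (cofreeD N (i + 1) (contract N i F)) := rfl

theorem eq_C_of_mem_mixed_zero (N : ℕ∞) {i : ℕ} {F : CobY N} (hF : F ∈ mixed N i 0) :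
    ∃ f ∈ cochains N i, F = C f := by
  refine mixed_induction N (p := fun F => ∃ f ∈ cochains N i, F = C f)
    ⟨0, zero_mem _, (map_zero C).symm⟩ ?_ ?_ hF
  · rintro _ _ ⟨f, hf, rfl⟩ ⟨g, hg, rfl⟩
    exact ⟨f + g, add_mem hf hg, (map_add C f g).symm⟩
  · intro α hα g hg
    have hα0 : α = 0 := (Finsupp.degree_eq_zero_iff α).mp hα
    subst hα0
    exact ⟨g, hg, rfl⟩

theorem fromMixed_mem (N : ℕ∞) (i j : ℕ) {F : CobY N} (hF : F ∈ mixed N (i + 1) j) :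
    fromMixed N i j F ∈ cochains N (i + j) := by
  induction j generalizing i F with
  | zero =>
    obtain ⟨f, hf, rfl⟩ := eq_C_of_mem_mixed_zero N hF
    rw [fromMixed_zero, MvPolynomial.coeff_zero_C]
    exact counit_mem N i hf
  | succ j ih =>
    rw [fromMixed_succ, show i + (j + 1) = i + 1 + j by omega]
    exact ih (i + 1) (cofreeD_mem N (contract_mem N hF))

/-- The map `fromMixed` is a chain map from the total complex of the double complex. It is the usual
zigzag: undo the Koszul differential by the contraction, apply the cobar differential of the next
row, and end with the augmentation by the counit. -/
theorem fromMixed_differential (N : ℕ∞) (i j : ℕ) {F : CobY N} (hF : F ∈ mixed N (i + 1) j) :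
    fromMixed N (i + 1) j (cofreeD N (i + 1) F) + fromMixed N i (j + 1) (kosz N i F) =
      diff N (i + j) (fromMixed N i j F) := by
  induction j generalizing i F with
  | zero =>
    rw [fromMixed_succ, contract_kosz_zero N hF]
    obtain ⟨f, hf, rfl⟩ := eq_C_of_mem_mixed_zero N hF
    have he := counit_mem N i hf
    have h1 : mapY N (counit N i) (C f) = C (counit N i f) := mapY_monomial _ _ _ _
    rw [h1, map_add, map_add, ← add_assoc, add_self, zero_add,
      cofreeD_succ_of_mem N (C_mem_mixed N he), ← C_diff, fromMixed_zero, fromMixed_zero,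
      MvPolynomial.coeff_zero_C, MvPolynomial.coeff_zero_C,
      counit_of_mem N (i + 1) (diff_mem N i he), add_zero]
  | succ j ih =>
    have hG := contract_mem N hF
    have hDG := cofreeD_mem N hG
    -- The induction hypothesis is applied to `D G`, with `G` the contraction of `F`. Its first term
    -- vanishes because `D D = 0`, and the commuting square turns the second into `D` of `kosz G`,
    -- which is the error term in the homotopy formula for `F`.
    have h := ih (i + 1) hDG
    rw [cofreeD_cofreeD N hG, map_zero, zero_add, kosz_cofreeD N hG] at h
    have hc : contract N i (kosz N i F) = F + kosz N i (contract N i F) := by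
      have := contract_kosz N hF
      rw [← this]
      rw [add_assoc, this, CobY.add_self, add_zero]
    rw [fromMixed_succ N i (j + 1), hc, map_add, map_add, ← add_assoc, add_self, zero_add, h,
      fromMixed_succ N i j, show i + 1 + j = i + (j + 1) by omega]

theorem sum_antidiagonal_succ_left {M : Type} [AddCommMonoid M] (s : ℕ) (P : ℕ → ℕ → M) :
    ∑ q ∈ antidiagonal (s + 1), P q.1 q.2 =
      P 0 (s + 1) + ∑ q ∈ antidiagonal s, P (q.1 + 1) q.2 :=
  Finset.Nat.sum_antidiagonal_succ

theorem sum_antidiagonal_succ_right {M : Type} [AddCommMonoid M] (s : ℕ) (P : ℕ → ℕ → M) :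
    ∑ q ∈ antidiagonal (s + 1), P q.1 q.2 =
      P (s + 1) 0 + ∑ q ∈ antidiagonal s, P q.1 (q.2 + 1) :=
  Finset.Nat.sum_antidiagonal_succ' (f := fun q : ℕ × ℕ => P q.1 q.2)

/-- The homotopy on `(s+1)`-cochains. -/
def homotopy (N : ℕ∞) (s : ℕ) (f : Cob N) : Cob N :=
  ∑ q ∈ antidiagonal s, fromMixed N q.1 q.2 (toYs N (q.1 + 1) q.2 (C f))

/-- The map from the Koszul complex in degree `s` to the cobar complex. -/
def fromKosz (N : ℕ∞) (s : ℕ) (F : CobY N) : Cob N :=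
  fromMixed N 0 s (mapY N (shift N 1) F)

theorem homotopy_mem (N : ℕ∞) (s : ℕ) {f : Cob N} (hf : f ∈ cochains N (s + 1)) :
    homotopy N s f ∈ cochains N s := by
  refine sum_mem fun q hq => ?_
  have hq' := mem_antidiagonal.mp hq
  have h := fromMixed_mem N q.1 (0 + q.2) (toYs_mem N (q.1 + 1) q.2 (C_mem_mixed N
    (show f ∈ cochains N (q.1 + 1 + q.2) by rwa [show q.1 + 1 + q.2 = s + 1 by omega])))
  rw [zero_add, hq'] at h
  exact h

theorem homotopy_diff_zero (N : ℕ∞) {f : Cob N} (hf : f ∈ cochains N 0) :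
    homotopy N 0 (diff N 0 f) = f + fromKosz N 0 (toYs N 0 0 (C f)) := by
  simp only [homotopy, Finset.Nat.antidiagonal_zero, Finset.sum_singleton]
  change fromMixed N 0 0 (C (diff N 0 f)) = f + fromMixed N 0 0 (mapY N (shift N 1) (C f))
  rw [C_diff, map_add, cofreeD_apply, Finset.range_zero, Finset.sum_empty, add_zero,
    fromMixed_zero N 0 (C f), MvPolynomial.coeff_zero_C, counit_of_mem N 0 hf, add_comm]

/-- Each summand of `h d f` splits by `toYs_cofreeD` into a row term `P` and a Koszul term `K`; each
summand of `d h f` splits by `fromMixed_differential` into a neighbouring `P` and the same `K`. The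
sums of `P` telescope along the antidiagonal and leave its end `P 0 (s+1)`, which factors through
the Koszul complex. -/
theorem homotopy_diff_succ (N : ℕ∞) (s : ℕ) {f : Cob N} (hf : f ∈ cochains N (s + 1)) :
    homotopy N (s + 1) (diff N (s + 1) f) =
      f + diff N s (homotopy N s f) + fromKosz N (s + 1) (toYs N 0 (s + 1) (C f)) := by
  let P : ℕ → ℕ → Cob N := fun i j => fromMixed N i j (cofreeD N i (toYs N i j (C f)))
  let K : ℕ → ℕ → Cob N := fun i j =>
    fromMixed N i (j + 1) (kosz N i (toYs N (i + 1) j (C f)))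
  have h0 : fromMixed N (s + 1) 0 (toYs N (s + 1 + 1) 0 (C (diff N (s + 1) f))) =
      P (s + 1) 0 + f := by
    change fromMixed N (s + 1) 0 (C (diff N (s + 1) f)) =
      fromMixed N (s + 1) 0 (cofreeD N (s + 1) (C f)) + f
    rw [C_diff, map_add, fromMixed_zero N (s + 1) (C f), MvPolynomial.coeff_zero_C,
      counit_of_mem N (s + 1) hf]
  have h1 : ∀ q ∈ antidiagonal s,
      fromMixed N q.1 (q.2 + 1) (toYs N (q.1 + 1) (q.2 + 1) (C (diff N (s + 1) f))) =
      P q.1 (q.2 + 1) + K q.1 q.2 := by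
    intro q hq
    have hq' := mem_antidiagonal.mp hq
    have e : s + 1 = q.1 + (q.2 + 1) := by omega
    have e' : s + 1 = q.1 + 1 + q.2 := by omega
    have hC : C f ∈ mixed N (q.1 + (q.2 + 1)) 0 := C_mem_mixed N (by rwa [← e])
    have hC' : C f ∈ mixed N (q.1 + 1 + q.2) 0 := C_mem_mixed N (by rwa [← e'])
    have h := toYs_cofreeD N q.1 q.2 hC
    rw [← e] at h
    rw [C_diff, map_add, toYs_succ_of_mem N (q.1 + 1) q.2 hC', add_zero, h, map_add]
  have h4 : diff N s (homotopy N s f) =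
      ∑ q ∈ antidiagonal s, P (q.1 + 1) q.2 + ∑ q ∈ antidiagonal s, K q.1 q.2 := by
    rw [homotopy, map_sum, ← Finset.sum_add_distrib]
    refine Finset.sum_congr rfl fun q hq => ?_
    have hq' := mem_antidiagonal.mp hq
    have hC : C f ∈ mixed N (q.1 + 1 + q.2) 0 :=
      C_mem_mixed N (by rwa [show q.1 + 1 + q.2 = s + 1 by omega])
    have h := toYs_mem N (q.1 + 1) q.2 hC
    rw [zero_add] at h
    have h' := fromMixed_differential N q.1 q.2 h
    rw [hq'] at h'
    exact h'.symm
  have h5 : P 0 (s + 1) = fromKosz N (s + 1) (toYs N 0 (s + 1) (C f)) := by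
    change fromMixed N 0 (s + 1) (cofreeD N 0 (toYs N 0 (s + 1) (C f))) = _
    rw [cofreeD_apply, Finset.range_zero, Finset.sum_empty, add_zero, fromKosz]
  -- The sum of `P` over the antidiagonal of `s + 1`, with its term at either end split off.
  have h3 := (sum_antidiagonal_succ_right s P).symm.trans (sum_antidiagonal_succ_left s P)
  have h6 := sum_antidiagonal_succ_right s fun i j =>
    fromMixed N i j (toYs N (i + 1) j (C (diff N (s + 1) f)))
  rw [homotopy, h6, Finset.sum_congr rfl h1, Finset.sum_add_distrib, h0, h4, ← h5]
  linear_combination h3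

/-! ### The filtration -/

/-- The weight of a monomial in the `y_r`, with `y_r` of weight `2^r`. -/
def yWeight (N : ℕ∞) : (Idx N →₀ ℕ) →+ ℕ := Finsupp.weight fun r => 2 ^ r.1

theorem yWeight_single (N : ℕ∞) (r : Idx N) (k : ℕ) :
    yWeight N (Finsupp.single r k) = k * 2 ^ r.1 := by
  simp [yWeight, Finsupp.weight_single]

/-- The filtration of `Cob N [y_r]` by the degree in the `xᵢ` and the weight in the `y_r`. -/
def filY (N : ℕ∞) (p : ℕ) : Submodule F2a (CobY N) where
  carrier := {F | ∀ α, coeff α F ∈ xIdeal N ^ (p - yWeight N α)}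
  zero_mem' α := by simp
  add_mem' hF hG α := by rw [MvPolynomial.coeff_add]; exact add_mem (hF α) (hG α)
  smul_mem' c F hF α := by
    rw [MvPolynomial.coeff_smul, Algebra.smul_def]
    exact Ideal.mul_mem_left _ _ (hF α)

theorem monomial_mem_filY (N : ℕ∞) {p l : ℕ} {α : Idx N →₀ ℕ} {c : Cob N}
    (hc : c ∈ xIdeal N ^ l) (h : p ≤ l + yWeight N α) : monomial α c ∈ filY N p := by
  intro β
  rw [MvPolynomial.coeff_monomial]
  split_ifs with hβ
  · subst hβ
    exact Ideal.pow_le_pow_right (by omega) hc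
  · exact zero_mem _

theorem C_mem_filY (N : ℕ∞) {p : ℕ} {f : Cob N} (hf : f ∈ xIdeal N ^ p) : C f ∈ filY N p :=
  monomial_mem_filY N hf (Nat.le_add_right _ _)

theorem filY_anti (N : ℕ∞) {p q : ℕ} (h : p ≤ q) : filY N q ≤ filY N p :=
  fun _ hF α => Ideal.pow_le_pow_right (by omega) (hF α)

theorem filY_mul (N : ℕ∞) {p q : ℕ} {F G : CobY N} (hF : F ∈ filY N p) (hG : G ∈ filY N q) :
    F * G ∈ filY N (p + q) := by
  classical
  intro α
  rw [MvPolynomial.coeff_mul]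
  refine sum_mem fun β hβ => ?_
  have h := Ideal.mul_mem_mul (hF β.1) (hG β.2)
  rw [← pow_add] at h
  refine Ideal.pow_le_pow_right ?_ h
  have h1 : yWeight N β.1 + yWeight N β.2 = yWeight N α := by
    rw [← map_add, mem_antidiagonal.mp hβ]
  omega

theorem algHom_mem_pow (N : ℕ∞) {φ : Cob N →ₐ[F2a] Cob N} (hφ : ∀ i, φ (xx N i) ∈ xIdeal N)
    {p : ℕ} {g : Cob N} (hg : g ∈ xIdeal N ^ p) : φ g ∈ xIdeal N ^ p := by
  have h : (xIdeal N).map φ ≤ xIdeal N := by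
    rw [xIdeal, Ideal.map_span, Ideal.span_le]
    rintro _ ⟨_, ⟨i, rfl⟩, rfl⟩
    exact hφ i
  have h2 := Ideal.mem_map_of_mem φ hg
  rw [Ideal.map_pow] at h2
  exact Ideal.pow_right_mono h p h2

theorem comul_mem_pow (N : ℕ∞) (l : ℕ) {p : ℕ} {g : Cob N} (hg : g ∈ xIdeal N ^ p) :
    comul N l g ∈ xIdeal N ^ p := by
  refine algHom_mem_pow N (fun i => ?_) hg
  rw [comul_xx]
  split_ifs
  · exact xx_mem_xIdeal N _
  · exact add_mem (xx_mem_xIdeal N _) (xx_mem_xIdeal N _)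
  · exact xx_mem_xIdeal N _

theorem counit_mem_pow (N : ℕ∞) (l : ℕ) {p : ℕ} {g : Cob N} (hg : g ∈ xIdeal N ^ p) :
    counit N l g ∈ xIdeal N ^ p := by
  refine algHom_mem_pow N (fun i => ?_) hg
  rw [counit_xx]
  split_ifs
  · exact zero_mem _
  · exact xx_mem_xIdeal N _

theorem cofreeD_mem_filY (N : ℕ∞) (i : ℕ) {p : ℕ} {F : CobY N} (hF : F ∈ filY N p) :
    cofreeD N i F ∈ filY N p := by
  rw [cofreeD_apply]
  refine add_mem (fun α => ?_) (sum_mem fun l _ α => ?_)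
  · rw [coeff_mapY]; exact shift_mem_pow N 1 _ (hF α)
  · rw [coeff_mapY]; exact comul_mem_pow N l (hF α)

/-- A slot operation changes only the exponent of `x_i` and the `y` part, so it preserves the
filtration as soon as `x_i^k y^α` is sent to total weight at least that of `x_i^k y^α`. -/
theorem slotExt_mem_filY (N : ℕ∞) (i : ℕ) (w : (Idx N →₀ ℕ) → ℕ → CobY N)
    (hw : ∀ α, Admissible N (w α)) (h : ∀ α k, w α k ∈ filY N (k + yWeight N α)) {p : ℕ}
    {F : CobY N} (hF : F ∈ filY N p) : slotExt N i w hw F ∈ filY N p := by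
  rw [F.as_sum, map_sum]
  refine sum_mem fun α _ => ?_
  rw [slotExt_monomial]
  have hα := xIdeal_pow_le N (hF α)
  rw [degSpan] at hα
  generalize coeff α F = c at hα
  induction hα using Submodule.span_induction with
  | zero => rw [map_zero]; exact zero_mem _
  | add f g _ _ hf hg => rw [map_add]; exact add_mem hf hg
  | smul c f _ hf => rw [map_smul]; exact Submodule.smul_mem _ _ hf
  | mem f hf =>
    obtain ⟨μ, hμ, rfl⟩ := hf
    rw [slotOp_mon]
    have h1 := filY_mul N (C_mem_filY N (mon_mem_xIdeal_pow N (μ.erase (Var.x i))))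
      (h α (μ (Var.x i)))
    refine filY_anti N ?_ h1
    have h2 : xdeg (μ.erase (Var.x i)) + μ (Var.x i) = xdeg μ := by
      conv_rhs => rw [← Finsupp.erase_add_single (Var.x i) μ, map_add, xdeg_single_x]
    omega

theorem toY_mem_filY (N : ℕ∞) (i : ℕ) {p : ℕ} {F : CobY N} (hF : F ∈ filY N p) :
    toY N i F ∈ filY N p := by
  refine slotExt_mem_filY N i _ _ (fun α k => ?_) hF
  by_cases h : ∃ r : Idx N, k = 2 ^ r.1
  · obtain ⟨r, rfl⟩ := h
    rw [yPow_two_pow, X, MvPolynomial.monomial_mul]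
    refine monomial_mem_filY N (l := 0) (by simp) ?_
    rw [map_add, yWeight_single]
    omega
  · rw [yPow_eq_zero N fun r hr => h ⟨r, hr⟩, mul_zero]
    exact zero_mem _

theorem contract_mem_filY (N : ℕ∞) (i : ℕ) {p : ℕ} {F : CobY N} (hF : F ∈ filY N p) :
    contract N i F ∈ filY N p := by
  refine slotExt_mem_filY N i _ _ (fun α k => ?_) hF
  by_cases hB : ∃ t, IsLow α t ∧ 2 ^ (t.1 + 1) ∣ k
  · obtain ⟨t, ht, hk⟩ := hB
    have hα' : α - Finsupp.single t 1 + Finsupp.single t 1 = α :=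
      tsub_add_cancel_of_le (Finsupp.single_le_iff.mpr (Nat.one_le_iff_ne_zero.mpr ht.1))
    rw [contractFun_of_dvd N i ht hk]
    refine monomial_mem_filY N (Ideal.pow_mem_pow (xx_mem_xIdeal N i) _) ?_
    conv_lhs => rw [← hα', map_add, yWeight_single]
    omega
  · rw [contractFun_eq_zero N i fun t ht hk => hB ⟨t, ht, hk⟩]
    exact zero_mem _

theorem toYs_mem_filY (N : ℕ∞) (i j : ℕ) {p : ℕ} {F : CobY N} (hF : F ∈ filY N p) :
    toYs N i j F ∈ filY N p := by
  induction j generalizing i with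
  | zero => exact hF
  | succ j ih => exact toY_mem_filY N i (ih (i + 1))

theorem fromMixed_mem_pow (N : ℕ∞) (i j : ℕ) {p : ℕ} {F : CobY N} (hF : F ∈ filY N p) :
    fromMixed N i j F ∈ xIdeal N ^ p := by
  induction j generalizing i F with
  | zero =>
    rw [fromMixed_zero]
    have h := hF 0
    rw [map_zero, Nat.sub_zero] at h
    exact counit_mem_pow N i h
  | succ j ih =>
    exact ih (i + 1) (cofreeD_mem_filY N _ (contract_mem_filY N i hF))

theorem homotopy_mem_fil (N : ℕ∞) (s p : ℕ) {f : Cob N} (hf : f ∈ fil N (s + 1) p) :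
    homotopy N s f ∈ fil N s p := by
  refine ⟨?_, homotopy_mem N s hf.2⟩
  exact sum_mem fun q _ => fromMixed_mem_pow N _ _ (toYs_mem_filY N _ _ (C_mem_filY N hf.1))

theorem fromKosz_mem_pow (N : ℕ∞) (s : ℕ) {p : ℕ} {F : CobY N} (hF : F ∈ filY N p) :
    fromKosz N s F ∈ xIdeal N ^ p := by
  refine fromMixed_mem_pow N _ _ fun α => ?_
  rw [coeff_mapY]
  exact shift_mem_pow N 1 _ (hF α)

theorem fromKosz_mem (N : ℕ∞) (s : ℕ) {F : CobY N} (hF : F ∈ mixed N 0 s) :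
    fromKosz N s F ∈ cochains N s := by
  have := fromMixed_mem N 0 s (mapY_shift_mem N hF)
  rwa [zero_add] at this

/-! ### The Koszul complex -/

/-- The monomial `u^m y^α` of `𝔽₂[a, u, y_r]`. -/
def ymon {N : ℕ∞} (m : ℕ) (α : Idx N →₀ ℕ) : YVar N →₀ ℕ :=
  Finsupp.single YVar.u m + α.mapDomain fun r => YVar.y r.1 r.2

theorem yvar_injective (N : ℕ∞) :
    Function.Injective fun r : Idx N => YVar.y (N := N) r.1 r.2 := by
  intro r t h
  simp only [YVar.y.injEq] at h
  exact Subtype.ext h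

theorem ymon_u {N : ℕ∞} (m : ℕ) (α : Idx N →₀ ℕ) : ymon m α YVar.u = m := by
  rw [ymon, Finsupp.add_apply, Finsupp.single_eq_same, Finsupp.mapDomain_of_notMem_range, add_zero]
  rintro ⟨r, hr⟩
  cases hr

theorem ymon_y {N : ℕ∞} (m : ℕ) (α : Idx N →₀ ℕ) (r : Idx N) :
    ymon m α (YVar.y r.1 r.2) = α r := by
  rw [ymon, Finsupp.add_apply, Finsupp.single_eq_of_ne (by simp), zero_add]
  exact Finsupp.mapDomain_apply (yvar_injective N) α r

/-- The exponents of the `y_r` in a monomial. -/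
def yPart {N : ℕ∞} (μ : YVar N →₀ ℕ) : Idx N →₀ ℕ :=
  μ.comapDomain _ (yvar_injective N).injOn

theorem ymon_yPart {N : ℕ∞} (μ : YVar N →₀ ℕ) : ymon (μ YVar.u) (yPart μ) = μ := by
  ext v
  cases v with
  | u => exact ymon_u _ _
  | y r hr => exact ymon_y _ _ ⟨r, hr⟩

theorem yPart_ymon {N : ℕ∞} (m : ℕ) (α : Idx N →₀ ℕ) : yPart (ymon m α) = α := by
  ext r
  exact ymon_y _ _ r

theorem ymon_inj {N : ℕ∞} {m m' : ℕ} {α α' : Idx N →₀ ℕ} :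
    ymon m α = ymon m' α' ↔ m = m' ∧ α = α' := by
  constructor
  · intro h
    exact ⟨by rw [← ymon_u m α, h, ymon_u], by rw [← yPart_ymon m α, h, yPart_ymon]⟩
  · rintro ⟨rfl, rfl⟩
    rfl

theorem ymon_add {N : ℕ∞} (m m' : ℕ) (α α' : Idx N →₀ ℕ) :
    ymon (m + m') (α + α') = ymon m α + ymon m' α' := by
  rw [ymon, ymon, ymon, Finsupp.single_add, Finsupp.mapDomain_add]
  abel

theorem ymon_zero {N : ℕ∞} : ymon 0 (0 : Idx N →₀ ℕ) = 0 := by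
  simp [ymon]

theorem ymon_single_y {N : ℕ∞} (r : Idx N) (k : ℕ) :
    ymon 0 (Finsupp.single r k) = Finsupp.single (YVar.y r.1 r.2) k := by
  simp [ymon, Finsupp.mapDomain_single]

theorem ymon_single_u {N : ℕ∞} (m : ℕ) :
    ymon m (0 : Idx N →₀ ℕ) = Finsupp.single YVar.u m := by
  simp [ymon]

/-- The bidegree, with `y_r` in bidegree `(1, 2^r)`. -/
def bideg (N : ℕ∞) : YVar N → ℕ × ℕ
  | YVar.u => 0
  | YVar.y r _ => (1, 2 ^ r)

theorem weight_ymon {N : ℕ∞} (m : ℕ) (α : Idx N →₀ ℕ) :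
    Finsupp.weight (bideg N) (ymon m α) = (α.degree, yWeight N α) := by
  rw [ymon, map_add, Finsupp.weight_single]
  induction α using Finsupp.induction_linear with
  | zero => simp [bideg]; rfl
  | add α β hα hβ =>
    rw [Finsupp.mapDomain_add, map_add, map_add, map_add]
    simp only [bideg, smul_zero, zero_add] at hα hβ ⊢
    rw [hα, hβ]
    rfl
  | single r k =>
    rw [Finsupp.mapDomain_single, Finsupp.weight_single, Finsupp.degree_single, yWeight_single]
    simp [bideg]

/-- Set all `xᵢ` to zero. -/
def augment (N : ℕ∞) : Cob N →ₐ[F2a] YPoly N :=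
  Ideal.Quotient.liftₐ (truncIdeal N) (MvPolynomial.aeval fun v => match v with
    | Var.u => X YVar.u
    | Var.x _ => 0) (by
    intro f hf
    have h : truncIdeal N ≤ RingHom.ker (MvPolynomial.aeval (fun v => match v with
        | Var.u => X YVar.u
        | Var.x _ => 0) : Poly →ₐ[F2a] YPoly N) := by
      rw [truncIdeal, Ideal.span_le]
      rintro _ ⟨n, hn, i, rfl⟩
      simp only [SetLike.mem_coe, RingHom.mem_ker, map_pow, MvPolynomial.aeval_X]
      exact zero_pow (by positivity)
    exact h hf)

theorem augment_uu (N : ℕ∞) : augment N (uu N) = X YVar.u := by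
  exact MvPolynomial.aeval_X _ Var.u

theorem augment_xx (N : ℕ∞) (i : ℕ) : augment N (xx N i) = 0 := by
  exact MvPolynomial.aeval_X _ (Var.x i)

/-- The homomorphism `Cob N [y_r] → 𝔽₂[a, u, y_r]`. -/
def evalY (N : ℕ∞) : CobY N →ₐ[F2a] YPoly N where
  __ := MvPolynomial.eval₂Hom (augment N).toRingHom fun r : Idx N => X (YVar.y r.1 r.2)
  commutes' c := by
    change MvPolynomial.eval₂Hom (augment N).toRingHom _ (C (algebraMap F2a (Cob N) c)) = _
    rw [MvPolynomial.eval₂Hom_C]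
    exact (augment N).commutes c

theorem evalY_C (N : ℕ∞) (f : Cob N) : evalY N (C f) = augment N f :=
  MvPolynomial.eval₂Hom_C _ _ _

theorem evalY_X (N : ℕ∞) (r : Idx N) : evalY N (X r) = X (YVar.y r.1 r.2) :=
  MvPolynomial.eval₂_X _ _ _

/-- The inclusion `𝔽₂[a, u, y_r] → Cob N [y_r]`. -/
def inclY (N : ℕ∞) : YPoly N →ₐ[F2a] CobY N :=
  MvPolynomial.aeval fun v => match v with
    | YVar.u => C (uu N)
    | YVar.y r hr => X ⟨r, hr⟩

theorem inclY_u (N : ℕ∞) : inclY N (X YVar.u) = C (uu N) := MvPolynomial.aeval_X _ _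

theorem inclY_y (N : ℕ∞) (r : Idx N) : inclY N (X (YVar.y r.1 r.2)) = X r :=
  MvPolynomial.aeval_X _ _

theorem monomial_ymon {N : ℕ∞} (m : ℕ) (α : Idx N →₀ ℕ) :
    (monomial (ymon m α) 1 : YPoly N) =
      X YVar.u ^ m * α.prod fun r k => X (YVar.y r.1 r.2) ^ k := by
  rw [ymon, ← one_mul (1 : F2a), ← MvPolynomial.monomial_mul, MvPolynomial.X_pow_eq_monomial]
  congr 1
  induction α using Finsupp.induction_linear with
  | zero => simp
  | add α β hα hβ =>
    rw [Finsupp.mapDomain_add, ← one_mul (1 : F2a), ← MvPolynomial.monomial_mul, hα, hβ,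
      Finsupp.prod_add_index' (by simp) (by intros; rw [pow_add])]
  | single r k =>
    rw [Finsupp.mapDomain_single, Finsupp.prod_single_index (by simp),
      MvPolynomial.X_pow_eq_monomial]

theorem CobY.monomial_eq {N : ℕ∞} (c : Cob N) (α : Idx N →₀ ℕ) :
    (monomial α c : CobY N) = C c * α.prod fun r k => X r ^ k := MvPolynomial.monomial_eq

theorem inclY_ymon (N : ℕ∞) (m : ℕ) (α : Idx N →₀ ℕ) :
    inclY N (monomial (ymon m α) 1) = monomial α (uu N ^ m) := by
  rw [monomial_ymon, map_mul, map_pow, inclY_u, CobY.monomial_eq, C.map_pow]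
  congr 1
  rw [map_finsuppProd]
  refine Finsupp.prod_congr fun r _ => ?_
  rw [map_pow, inclY_y]

theorem evalY_monomial (N : ℕ∞) (c : Cob N) (α : Idx N →₀ ℕ) :
    evalY N (monomial α c) = augment N c * monomial (ymon 0 α) 1 := by
  rw [monomial_ymon, pow_zero, one_mul, CobY.monomial_eq, map_mul, evalY_C]
  congr 1
  rw [map_finsuppProd]
  refine Finsupp.prod_congr fun r _ => ?_
  rw [map_pow, evalY_X]

theorem evalY_inclY (N : ℕ∞) (z : YPoly N) : evalY N (inclY N z) = z := by
  suffices h : (evalY N).comp (inclY N) = AlgHom.id F2a (YPoly N) from DFunLike.congr_fun h z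
  apply MvPolynomial.algHom_ext
  intro v
  cases v with
  | u =>
    change evalY N (inclY N (X YVar.u)) = X YVar.u
    rw [inclY_u, evalY_C, augment_uu]
  | y r hr =>
    change evalY N (inclY N (X (YVar.y r hr))) = X (YVar.y r hr)
    rw [inclY_y N ⟨r, hr⟩, evalY_X]

theorem inclY_augment (N : ℕ∞) {g : Cob N} (hg : g ∈ cochains N 0) :
    inclY N (augment N g) = C g := by
  have h : cochainAlg N 0 ≤ AlgHom.equalizer ((inclY N).comp (augment N))
      (IsScalarTower.toAlgHom F2a (Cob N) (CobY N)) := by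
    rw [cochainAlg, Algebra.adjoin_le_iff]
    rintro _ (rfl | ⟨i, hi, rfl⟩)
    · change inclY N (augment N (uu N)) = C (uu N)
      rw [augment_uu, inclY_u]
    · exact absurd hi (Nat.not_lt_zero i)
  exact h hg

theorem inclY_evalY (N : ℕ∞) {j : ℕ} {F : CobY N} (hF : F ∈ mixed N 0 j) :
    inclY N (evalY N F) = F := by
  refine mixed_induction N (p := fun F => inclY N (evalY N F) = F) ?_ ?_ ?_ hF
  · simp only [map_zero]
  · intro F G hF hG
    rw [map_add, map_add, hF, hG]
  · intro α _ g hg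
    rw [evalY_monomial, map_mul, inclY_augment N hg, inclY_ymon, pow_zero,
      MvPolynomial.C_mul_monomial, mul_one]

/-- The differential of the Koszul complex `𝔽₂[a, u, y_r]`. -/
def koszulD (N : ℕ∞) : YPoly N →ₗ[F2a] YPoly N :=
  (MvPolynomial.basisMonomials (YVar N) F2a).constr F2a fun μ =>
    ∑ r ∈ bits N (μ YVar.u), monomial (ymon (μ YVar.u - 2 ^ r.1) (yPart μ + Finsupp.single r 1))
      (F2a.a ^ 2 ^ (r.1 + 1))

theorem koszulD_ymon (N : ℕ∞) (m : ℕ) (α : Idx N →₀ ℕ) :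
    koszulD N (monomial (ymon m α) 1) = ∑ r ∈ bits N m,
      monomial (ymon (m - 2 ^ r.1) (α + Finsupp.single r 1)) (F2a.a ^ 2 ^ (r.1 + 1)) := by
  rw [koszulD, ← congrFun (MvPolynomial.coe_basisMonomials (YVar N) F2a) (ymon m α),
    Module.Basis.constr_basis, ymon_u, yPart_ymon]

theorem YPoly.induction {N : ℕ∞} {p : YPoly N → Prop}
    (hadd : ∀ f g, p f → p g → p (f + g)) (hsmul : ∀ (c : F2a) f, p f → p (c • f))
    (hmon : ∀ m α, p (monomial (ymon m α) 1)) (z : YPoly N) : p z := by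
  induction z using MvPolynomial.induction_on' with
  | monomial μ c =>
    rw [← mul_one c, ← smul_eq_mul, ← MvPolynomial.smul_monomial, ← ymon_yPart μ]
    exact hsmul _ _ (hmon _ _)
  | add f g hf hg => exact hadd f g hf hg

/-- The Koszul differential is the twisting cochain applied to the coaction: in `(u + a² x)^m` the
coefficient of `x^(2^r)` is `a^(2^(r+1)) u^(m-2^r)` if `r` is a digit of `m`, and zero otherwise. -/
theorem inclY_koszulD (N : ℕ∞) (z : YPoly N) :
    inclY N (koszulD N z) = toY N 0 (mapY N (shift N 1) (inclY N z)) := by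
  refine YPoly.induction (p := fun z => inclY N (koszulD N z) =
    toY N 0 (mapY N (shift N 1) (inclY N z))) ?_ ?_ ?_ z
  · intro f g hf hg
    simp only [map_add, hf, hg]
  · intro c f hf
    simp only [map_smul, hf]
  · intro m α
    have e : shift N 1 (uu N ^ m) = ∑ l ∈ Finset.range (m + 1),
        (m.choose l • (uu N ^ (m - l) * (aa N ^ 2) ^ l)) * xx N 0 ^ l := by
      rw [map_pow, shift_uu, Finset.sum_range_one, add_comm, add_pow]
      refine Finset.sum_congr rfl fun l _ => ?_
      rw [nsmul_eq_mul, mul_pow]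
      ring
    rw [koszulD_ymon, inclY_ymon, mapY_monomial, e, map_sum, map_sum, map_sum]
    have h1 : ∀ l ∈ Finset.range (m + 1), toY N 0
        (monomial α ((m.choose l • (uu N ^ (m - l) * (aa N ^ 2) ^ l)) * xx N 0 ^ l)) =
        monomial α (uu N ^ (m - l) * (aa N ^ 2) ^ l) * yPow N l * (m.choose l : CobY N) := by
      intro l _
      rw [toY_mul_pow]
      · rw [map_nsmul, nsmul_eq_mul]
        ring
      · refine nsmul_mem (cochains_mul N (cochains_pow N (uu_mem_cochains N 0) _)
          (cochains_pow N (cochains_pow N ?_ 2) l)) _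
        exact Subalgebra.algebraMap_mem _ _
    rw [Finset.sum_congr rfl h1,
      sum_choose_mul_yPow N m fun l => monomial α (uu N ^ (m - l) * (aa N ^ 2) ^ l)]
    refine Finset.sum_congr rfl fun r _ => ?_
    rw [← mul_one (F2a.a ^ _), ← smul_eq_mul, ← MvPolynomial.smul_monomial, map_smul, inclY_ymon,
      X, MvPolynomial.monomial_mul, mul_one, MvPolynomial.smul_monomial, ← pow_mul,
      Algebra.smul_def, map_pow, mul_comm, pow_succ, mul_comm 2]
    rfl

/-- The comparison map from the cobar complex to the Koszul complex, which is
`m [h₀ | … | h_{s-1}] ↦ m q(h₀) ⋯ q(h_{s-1})` with `q (x^(2^r)) = y_r` and `q (x^k) = 0`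
if `k` is not a power of two. -/
def toKosz (N : ℕ∞) (s : ℕ) (f : Cob N) : YPoly N := evalY N (toYs N 0 s (C f))

theorem toYs_C_mem (N : ℕ∞) {s : ℕ} {f : Cob N} (hf : f ∈ cochains N s) :
    toYs N 0 s (C f) ∈ mixed N 0 s := by
  have h := toYs_mem N 0 s (C_mem_mixed N (show f ∈ cochains N (0 + s) by rwa [zero_add]))
  rwa [zero_add] at h

theorem toKosz_add (N : ℕ∞) (s : ℕ) (f g : Cob N) :
    toKosz N s (f + g) = toKosz N s f + toKosz N s g := by
  simp only [toKosz, map_add]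

theorem C_smul (N : ℕ∞) (c : F2a) (f : Cob N) : (C (c • f) : CobY N) = c • C f := by
  rw [MvPolynomial.C_apply, MvPolynomial.C_apply, MvPolynomial.smul_monomial]

theorem toKosz_smul (N : ℕ∞) (s : ℕ) (c : F2a) (f : Cob N) :
    toKosz N s (c • f) = c • toKosz N s f := by
  simp only [toKosz, C_smul, map_smul]

theorem inclY_toKosz (N : ℕ∞) {s : ℕ} {f : Cob N} (hf : f ∈ cochains N s) :
    inclY N (toKosz N s f) = toYs N 0 s (C f) :=
  inclY_evalY N (toYs_C_mem N hf)

/-- All inner cofaces vanish by the twisting condition and the last one because `q(1) = 0`. What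
remains is the coaction on `A`, the Koszul differential. -/
theorem toKosz_diff (N : ℕ∞) (s : ℕ) {f : Cob N} (hf : f ∈ cochains N s) :
    toKosz N (s + 1) (diff N s f) = koszulD N (toKosz N s f) := by
  rw [← evalY_inclY N (koszulD N _), inclY_koszulD, inclY_toKosz N hf, toKosz]
  congr 1
  cases s with
  | zero =>
    change toY N 0 (C (diff N 0 f)) = toY N 0 (mapY N (shift N 1) (C f))
    rw [C_diff, map_add, toY_of_mem N (C_mem_mixed N hf), add_zero, cofreeD_apply,
      Finset.range_zero, Finset.sum_empty, add_zero]
  | succ s =>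
    have hC : C f ∈ mixed N (0 + (s + 1)) 0 := C_mem_mixed N (by rwa [zero_add])
    have hC' : C f ∈ mixed N (0 + 1 + s) 0 :=
      C_mem_mixed N (by rwa [show 0 + 1 + s = s + 1 by omega])
    have h := toYs_cofreeD N 0 s hC
    rw [zero_add, zero_add] at h
    change toY N 0 (toYs N 1 (s + 1) (C (diff N (s + 1) f))) = _
    have h2 := toYs_succ_of_mem N (0 + 1) s hC'
    rw [zero_add] at h2
    have h3 : toYs N 1 s (C f) ∈ mixed N (0 + 1) (0 + s) := toYs_mem N (0 + 1) s hC'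
    rw [C_diff, map_add, h2, add_zero, h, map_add, toY_toY_comul N h3, add_zero, cofreeD_apply,
      Finset.range_zero, Finset.sum_empty, add_zero]

/-- The chain homotopy between the identity and the projection to the Koszul complex. -/
theorem homotopy_zero (N : ℕ∞) {f : Cob N} (hf : f ∈ cochains N 0) :
    f = homotopy N 0 (diff N 0 f) + fromKosz N 0 (inclY N (toKosz N 0 f)) := by
  rw [homotopy_diff_zero N hf, inclY_toKosz N hf, add_assoc, add_self, add_zero]

theorem homotopy_succ (N : ℕ∞) (s : ℕ) {f : Cob N} (hf : f ∈ cochains N (s + 1)) :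
    f = diff N s (homotopy N s f) + homotopy N (s + 1) (diff N (s + 1) f) +
      fromKosz N (s + 1) (inclY N (toKosz N (s + 1) f)) := by
  rw [homotopy_diff_succ N s hf, inclY_toKosz N hf]
  linear_combination -(diff N s (homotopy N s f) +
    fromKosz N (s + 1) (toYs N 0 (s + 1) (C f))) * two_eq_zero N

/-! ### Coefficients of the Koszul differential; good and bad monomials -/

theorem coeff_ymon_monomial {N : ℕ∞} (m m' : ℕ) (α α' : Idx N →₀ ℕ) (c : F2a)
    [Decidable (m' = m ∧ α' = α)] :
    coeff (ymon m α) (monomial (ymon m' α') c) = if m' = m ∧ α' = α then c else 0 := by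
  classical
  rw [MvPolynomial.coeff_monomial]
  exact if_congr ymon_inj rfl rfl

theorem YPoly.ext {N : ℕ∞} {z w : YPoly N}
    (h : ∀ m α, coeff (ymon m α) z = coeff (ymon m α) w) : z = w := by
  refine MvPolynomial.ext _ _ fun μ => ?_
  rw [← ymon_yPart μ]
  exact h _ _

open Classical in
theorem coeff_koszulD (N : ℕ∞) (m : ℕ) (α : Idx N →₀ ℕ) (z : YPoly N) :
    coeff (ymon m α) (koszulD N z) = ∑ r ∈ α.support,
      if (m + 2 ^ r.1).testBit r.1 = true then
        F2a.a ^ 2 ^ (r.1 + 1) * coeff (ymon (m + 2 ^ r.1) (α - Finsupp.single r 1)) z else 0 := by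
  refine YPoly.induction (p := fun z => coeff (ymon m α) (koszulD N z) = ∑ r ∈ α.support,
      if (m + 2 ^ r.1).testBit r.1 = true then
        F2a.a ^ 2 ^ (r.1 + 1) * coeff (ymon (m + 2 ^ r.1) (α - Finsupp.single r 1)) z else 0)
    ?_ ?_ ?_ z
  · intro f g hf hg
    rw [map_add, MvPolynomial.coeff_add, hf, hg, ← Finset.sum_add_distrib]
    refine Finset.sum_congr rfl fun r _ => ?_
    split_ifs
    · rw [MvPolynomial.coeff_add, mul_add]
    · rw [add_zero]
  · intro c f hf
    rw [map_smul, MvPolynomial.coeff_smul, hf, smul_eq_mul, Finset.mul_sum]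
    refine Finset.sum_congr rfl fun r _ => ?_
    split_ifs
    · rw [MvPolynomial.coeff_smul, smul_eq_mul, mul_left_comm]
    · rw [mul_zero]
  · intro m' α'
    rw [koszulD_ymon, MvPolynomial.coeff_sum]
    simp only [coeff_ymon_monomial, mul_ite, mul_one, mul_zero, ← ite_and]
    rw [← Finset.sum_filter, ← Finset.sum_filter]
    refine Finset.sum_congr ?_ fun _ _ => rfl
    ext r
    rw [Finset.mem_filter, Finset.mem_filter, mem_bits, Finsupp.mem_support_iff]
    constructor
    · rintro ⟨h1, rfl, rfl⟩
      have h2 := two_pow_le_of_testBit h1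
      rw [Nat.sub_add_cancel h2, add_tsub_cancel_right]
      refine ⟨?_, h1, rfl, rfl⟩
      rw [Finsupp.add_apply, Finsupp.single_eq_same]
      omega
    · rintro ⟨h1, h2, rfl, rfl⟩
      refine ⟨h2, Nat.add_sub_cancel _ _, tsub_add_cancel_of_le ?_⟩
      exact Finsupp.single_le_iff.mpr (Nat.one_le_iff_ne_zero.mpr h1)

/-- The monomials `u^m y^α` of the ring `answerSub`. -/
def IsGood {N : ℕ∞} (m : ℕ) (α : Idx N →₀ ℕ) : Prop :=
  ∀ r : Idx N, (∀ q < r, α q = 0) → 2 ^ (r.1 + 1) ∣ m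

theorem isGood_of_isLow {N : ℕ∞} {m : ℕ} {α : Idx N →₀ ℕ} {t : Idx N} (ht : α t ≠ 0)
    (hm : 2 ^ (t.1 + 1) ∣ m) : IsGood m α := by
  intro r hr
  refine (pow_dvd_pow 2 ?_).trans hm
  by_contra h
  refine ht (hr t ?_)
  change t.1 < r.1
  omega

/-- The least index at which goodness fails is the 2-adic valuation of `m`. It is the index at which
the differential acts on the bad monomial with the smallest power of `a`. -/
theorem exists_of_not_isGood {N : ℕ∞} {m : ℕ} {α : Idx N →₀ ℕ} (h : ¬ IsGood m α) :
    ∃ t : Idx N, (∀ q < t, α q = 0) ∧ 2 ^ t.1 ∣ m ∧ ¬ 2 ^ (t.1 + 1) ∣ m := by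
  classical
  have h' : ∃ k : ℕ, ∃ hk : (k : ℕ∞) < N,
      (∀ q < (⟨k, hk⟩ : Idx N), α q = 0) ∧ ¬ 2 ^ (k + 1) ∣ m := by
    rw [IsGood] at h
    push Not at h
    obtain ⟨r, hr, hm⟩ := h
    exact ⟨r.1, r.2, hr, hm⟩
  obtain ⟨hk, h1, h2⟩ := Nat.find_spec h'
  refine ⟨⟨Nat.find h', hk⟩, h1, ?_, h2⟩
  change 2 ^ Nat.find h' ∣ m
  rcases Nat.eq_zero_or_pos (Nat.find h') with h0 | hpos
  · rw [h0, pow_zero]; exact one_dvd m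
  · have h3 := Nat.find_min h' (m := Nat.find h' - 1) (by omega)
    by_contra hd
    refine h3 ⟨lt_of_le_of_lt (by exact_mod_cast Nat.sub_le _ _) hk, fun q hq => h1 q ?_, ?_⟩
    · have hq' : q.1 < Nat.find h' - 1 := hq
      change q.1 < Nat.find h'
      omega
    · rwa [Nat.sub_add_cancel hpos]

/-- The triangularity of the matching. A contribution to the coefficient at the good partner
`u^(m-2^t) y_t y^α` removes some `y_r`. Either `r = t`, giving the bad monomial itself, or `r > t`,
and then the source is a good monomial of smaller weight, where `z` vanishes by assumption. -/
theorem coeff_koszulD_bad (N : ℕ∞) {m : ℕ} {α : Idx N →₀ ℕ} {t : Idx N}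
    (hα : ∀ q < t, α q = 0) (h1 : 2 ^ t.1 ∣ m) (h2 : ¬ 2 ^ (t.1 + 1) ∣ m) {z : YPoly N}
    (hz : ∀ m' α', IsGood m' α' → yWeight N α' < yWeight N α → coeff (ymon m' α') z = 0) :
    coeff (ymon (m - 2 ^ t.1) (α + Finsupp.single t 1)) (koszulD N z) =
      F2a.a ^ 2 ^ (t.1 + 1) * coeff (ymon m α) z := by
  classical
  have hb := (testBit_iff_of_dvd h1).mpr h2
  have hle := two_pow_le_of_testBit hb
  have hd : 2 ^ (t.1 + 1) ∣ m - 2 ^ t.1 := by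
    obtain ⟨l, rfl⟩ := h1
    rw [pow_succ, Nat.mul_dvd_mul_iff_left (by positivity)] at h2
    have : 2 ^ t.1 * l - 2 ^ t.1 = 2 ^ t.1 * (l - 1) := by rw [Nat.mul_sub, mul_one]
    rw [this, pow_succ]
    exact Nat.mul_dvd_mul_left _ (by omega)
  rw [coeff_koszulD, Finset.sum_eq_single_of_mem t (by simp)]
  · rw [Nat.sub_add_cancel hle, if_pos hb, add_tsub_cancel_right]
  · intro r hr hrt
    rw [Finsupp.mem_support_iff, Finsupp.add_apply, Finsupp.single_eq_of_ne hrt, add_zero] at hr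
    have htr : t < r := by
      rcases lt_trichotomy r t with h | h | h
      · exact absurd (hα r h) hr
      · exact absurd h hrt
      · exact h
    have htr' : t.1 < r.1 := htr
    have hs : Finsupp.single r 1 ≤ α + Finsupp.single t 1 := by
      rw [Finsupp.single_le_iff, Finsupp.add_apply]
      omega
    -- The source still contains `y_t`, and its `u`-exponent `m - 2^t + 2^r` is divisible by
    -- `2^(t+1)`, so it is good. Its weight is that of `α` plus `2^t - 2^r < 0`.
    rw [hz, mul_zero, ite_self]
    · refine isGood_of_isLow (t := t) ?_ (dvd_add hd (pow_dvd_pow 2 htr'))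
      rw [Finsupp.tsub_apply, Finsupp.add_apply, Finsupp.single_eq_same,
        Finsupp.single_eq_of_ne hrt.symm]
      omega
    · have h3 : yWeight N (α + Finsupp.single t 1 - Finsupp.single r 1) + 2 ^ r.1 =
          yWeight N α + 2 ^ t.1 := by
        have := congrArg (yWeight N) (tsub_add_cancel_of_le hs)
        rwa [map_add, map_add, yWeight_single, yWeight_single, one_mul, one_mul] at this
      have h4 : 2 ^ t.1 < 2 ^ r.1 := Nat.pow_lt_pow_right one_lt_two htr'
      omega

/-- Every contribution removes some `y_r` with `r` at least the least index `t`, and carries the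
factor `a^(2^(r+1))`. -/
theorem coeff_koszulD_dvd (N : ℕ∞) (m : ℕ) {α : Idx N →₀ ℕ} {t : Idx N} (ht : IsLow α t)
    (z : YPoly N) : F2a.a ^ 2 ^ (t.1 + 1) ∣ coeff (ymon m α) (koszulD N z) := by
  classical
  rw [coeff_koszulD]
  refine Finset.dvd_sum fun r hr => ?_
  split_ifs
  · refine Dvd.dvd.mul_right (pow_dvd_pow _ (Nat.pow_le_pow_right two_pos ?_)) _
    by_contra h
    refine Finsupp.mem_support_iff.mp hr (ht.2 r ?_)
    change r.1 < t.1
    omega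
  · exact dvd_zero _

theorem coeff_koszulD_zero (N : ℕ∞) (m : ℕ) (z : YPoly N) :
    coeff (ymon m 0) (koszulD N z) = 0 := by
  classical
  rw [coeff_koszulD, Finsupp.support_zero, Finset.sum_empty]

/-! ### The filtration of the Koszul complex -/

/-- The part of `𝔽₂[a, u, y_r]` of cohomological degree `s` and filtration at least `p`. -/
def filK (N : ℕ∞) (s p : ℕ) : Submodule F2a (YPoly N) where
  carrier := {z | ∀ m α, coeff (ymon m α) z ≠ 0 → α.degree = s ∧ p ≤ yWeight N α}
  zero_mem' m α h := absurd (MvPolynomial.coeff_zero _) h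
  add_mem' {z w} hz hw m α h := by
    by_cases h1 : coeff (ymon m α) z = 0
    · refine hw m α fun h2 => h ?_
      rw [MvPolynomial.coeff_add, h1, h2, add_zero]
    · exact hz m α h1
  smul_mem' c z hz m α h := by
    refine hz m α fun h2 => h ?_
    rw [MvPolynomial.coeff_smul, h2, smul_zero]

theorem filK_anti (N : ℕ∞) (s : ℕ) {p q : ℕ} (h : p ≤ q) : filK N s q ≤ filK N s p :=
  fun _ hz m α hm => ⟨(hz m α hm).1, h.trans (hz m α hm).2⟩

theorem monomial_mem_filK (N : ℕ∞) {s p m : ℕ} {α : Idx N →₀ ℕ} (hs : α.degree = s)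
    (hp : p ≤ yWeight N α) (c : F2a) : monomial (ymon m α) c ∈ filK N s p := by
  classical
  intro m' α' h
  rw [coeff_ymon_monomial] at h
  obtain ⟨rfl, rfl⟩ : m = m' ∧ α = α' := by
    by_contra h'
    exact h (if_neg h')
  exact ⟨hs, hp⟩

theorem filK_induction {N : ℕ∞} {s p : ℕ} {P : YPoly N → Prop} (h0 : P 0)
    (hadd : ∀ f g, P f → P g → P (f + g))
    (hmon : ∀ m α, α.degree = s → p ≤ yWeight N α → ∀ c, P (monomial (ymon m α) c))
    {z : YPoly N} (hz : z ∈ filK N s p) : P z := by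
  rw [z.as_sum]
  refine Finset.sum_induction _ P hadd h0 fun μ hμ => ?_
  rw [MvPolynomial.mem_support_iff, ← ymon_yPart μ] at hμ
  have := hz _ _ hμ
  rw [← ymon_yPart μ]
  exact hmon _ _ this.1 this.2 _

theorem filK_mul (N : ℕ∞) {s p t q : ℕ} {z w : YPoly N} (hz : z ∈ filK N s p)
    (hw : w ∈ filK N t q) : z * w ∈ filK N (s + t) (p + q) := by
  refine filK_induction (P := fun z => z * w ∈ filK N (s + t) (p + q)) ?_ ?_ ?_ hz
  · rw [zero_mul]; exact zero_mem _
  · intro f g hf hg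
    rw [add_mul]; exact add_mem hf hg
  · intro m α hα hp c
    refine filK_induction (P := fun w => monomial (ymon m α) c * w ∈ filK N (s + t) (p + q))
      ?_ ?_ ?_ hw
    · rw [mul_zero]; exact zero_mem _
    · intro f g hf hg
      rw [mul_add]; exact add_mem hf hg
    · intro m' α' hα' hp' c'
      rw [MvPolynomial.monomial_mul, ← ymon_add]
      exact monomial_mem_filK N (by rw [map_add, hα, hα']) (by rw [map_add]; omega) _

theorem augment_mon (N : ℕ∞) (μ : Var →₀ ℕ) : augment N (mon N μ) = 0 ∨
    (xdeg μ = 0 ∧ ∃ k, augment N (mon N μ) = X YVar.u ^ k) := by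
  induction μ using Finsupp.induction_linear with
  | zero => exact Or.inr ⟨map_zero _, 0, by rw [mon_zero, map_one, pow_zero]⟩
  | add μ ν hμ hν =>
    rw [mon_add, map_mul]
    rcases hμ with hμ | ⟨hμ, k, hk⟩
    · exact Or.inl (by rw [hμ, zero_mul])
    · rcases hν with hν | ⟨hν, l, hl⟩
      · exact Or.inl (by rw [hν, mul_zero])
      · exact Or.inr ⟨by rw [map_add, hμ, hν], k + l, by rw [hk, hl, pow_add]⟩
  | single v k =>
    cases v with
    | u => exact Or.inr ⟨xdeg_single_u k, k, by rw [mon_single_u, map_pow, augment_uu]⟩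
    | x i =>
      rw [mon_single_x, map_pow, augment_xx]
      rcases Nat.eq_zero_or_pos k with rfl | hk
      · exact Or.inr ⟨by simp, 0, by simp⟩
      · exact Or.inl (zero_pow hk.ne')

/-- Evaluation kills every monomial that involves an `x`, so the terms that survive owe their whole
filtration to the `y_r`. -/
theorem evalY_mem_filK (N : ℕ∞) {s p : ℕ} {F : CobY N} (hF : F ∈ mixed N 0 s)
    (hp : F ∈ filY N p) : evalY N F ∈ filK N s p := by
  have hs : ∀ α, coeff α F ≠ 0 → α.degree = s := by
    classical
    refine mixed_induction N (p := fun F => ∀ α, coeff α F ≠ 0 → α.degree = s) ?_ ?_ ?_ hF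
    · intro α h
      exact absurd (MvPolynomial.coeff_zero _) h
    · intro F G hF hG α h
      by_cases h1 : coeff α F = 0
      · refine hG α fun h2 => h ?_
        rw [MvPolynomial.coeff_add, h1, h2, add_zero]
      · exact hF α h1
    · intro α hα g _ β h
      rw [MvPolynomial.coeff_monomial] at h
      by_cases hβ : α = β
      · exact hβ ▸ hα
      · exact absurd (if_neg hβ) h
  rw [F.as_sum, map_sum]
  refine sum_mem fun α hα => ?_
  have hα' := hs α (MvPolynomial.mem_support_iff.mp hα)
  have hc := xIdeal_pow_le N (hp α)
  rw [evalY_monomial]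
  generalize coeff α F = c at hc
  rw [degSpan] at hc
  induction hc using Submodule.span_induction with
  | zero => rw [map_zero, zero_mul]; exact zero_mem _
  | add f g _ _ hf hg => rw [map_add, add_mul]; exact add_mem hf hg
  | smul c f _ hf => rw [map_smul, smul_mul_assoc]; exact Submodule.smul_mem _ _ hf
  | mem f hf =>
    obtain ⟨μ, hμ, rfl⟩ := hf
    rcases augment_mon N μ with h | ⟨h, k, hk⟩
    · rw [h, zero_mul]; exact zero_mem _
    · rw [hk, MvPolynomial.X_pow_eq_monomial, ← ymon_single_u, MvPolynomial.monomial_mul,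
        ← ymon_add, zero_add]
      exact monomial_mem_filK N hα' (by omega) _

theorem toKosz_mem (N : ℕ∞) {s p : ℕ} {f : Cob N} (hf : f ∈ fil N s p) :
    toKosz N s f ∈ filK N s p :=
  evalY_mem_filK N (toYs_C_mem N hf.2) (toYs_mem_filY N 0 s (C_mem_filY N hf.1))

theorem inclY_monomial (N : ℕ∞) (m : ℕ) (α : Idx N →₀ ℕ) (c : F2a) :
    inclY N (monomial (ymon m α) c) = monomial α (c • uu N ^ m) := by
  rw [← mul_one c, ← smul_eq_mul, ← MvPolynomial.smul_monomial, map_smul, inclY_ymon,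
    MvPolynomial.smul_monomial, smul_eq_mul, mul_one]

theorem inclY_mem_filY (N : ℕ∞) {s p : ℕ} {z : YPoly N} (hz : z ∈ filK N s p) :
    inclY N z ∈ filY N p := by
  refine filK_induction (P := fun z => inclY N z ∈ filY N p) ?_ ?_ ?_ hz
  · rw [map_zero]; exact zero_mem _
  · intro f g hf hg
    rw [map_add]; exact add_mem hf hg
  · intro m α _ hα c
    rw [inclY_monomial]
    exact monomial_mem_filY N (l := 0) (by simp) (by omega)

theorem inclY_mem_mixed (N : ℕ∞) {s p : ℕ} {z : YPoly N} (hz : z ∈ filK N s p) :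
    inclY N z ∈ mixed N 0 s := by
  refine filK_induction (P := fun z => inclY N z ∈ mixed N 0 s) ?_ ?_ ?_ hz
  · rw [map_zero]; exact zero_mem _
  · intro f g hf hg
    rw [map_add]; exact add_mem hf hg
  · intro m α hα _ c
    rw [inclY_monomial]
    exact monomial_mem_mixed' N α hα
      (Submodule.smul_mem _ _ (cochains_pow N (uu_mem_cochains N 0) m))

/-- The component of a given bidegree. -/
def comp (N : ℕ∞) (i : ℕ × ℕ) : YPoly N →ₗ[F2a] YPoly N :=
  MvPolynomial.weightedHomogeneousComponent (bideg N) i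

theorem coeff_comp (N : ℕ∞) (s p m : ℕ) (α : Idx N →₀ ℕ) (z : YPoly N)
    [Decidable (α.degree = s ∧ yWeight N α = p)] :
    coeff (ymon m α) (comp N (s, p) z) =
      if α.degree = s ∧ yWeight N α = p then coeff (ymon m α) z else 0 := by
  rw [comp, MvPolynomial.coeff_weightedHomogeneousComponent, weight_ymon]
  exact if_congr Prod.mk_inj rfl rfl

theorem comp_eq_zero (N : ℕ∞) {s p : ℕ} {z : YPoly N} (hz : z ∈ filK N s (p + 1)) :
    comp N (s, p) z = 0 := by
  classical
  refine YPoly.ext fun m α => ?_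
  rw [coeff_comp, MvPolynomial.coeff_zero, ite_eq_right_iff]
  rintro ⟨_, h⟩
  by_contra hne
  have := (hz m α hne).2
  omega

theorem mem_filK_succ (N : ℕ∞) {s p : ℕ} {z : YPoly N} (hz : z ∈ filK N s p)
    (h : comp N (s, p) z = 0) : z ∈ filK N s (p + 1) := by
  classical
  intro m α hne
  obtain ⟨h1, h2⟩ := hz m α hne
  refine ⟨h1, ?_⟩
  rcases Nat.eq_or_lt_of_le h2 with h3 | h3
  · have := coeff_comp N s p m α z
    rw [h, MvPolynomial.coeff_zero, if_pos ⟨h1, h3.symm⟩] at this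
    exact absurd this.symm hne
  · exact h3

theorem comp_mem_filK (N : ℕ∞) (s p : ℕ) (z : YPoly N) : comp N (s, p) z ∈ filK N s p := by
  classical
  intro m α hne
  rw [coeff_comp] at hne
  by_cases h : α.degree = s ∧ yWeight N α = p
  · exact ⟨h.1, h.2.ge⟩
  · exact absurd (if_neg h) hne

theorem comp_comp (N : ℕ∞) (i : ℕ × ℕ) (z : YPoly N) : comp N i (comp N i z) = comp N i z :=
  (MvPolynomial.weightedHomogeneousComponent_isWeightedHomogeneous i z
    ).weightedHomogeneousComponent_same

theorem sub_comp_mem (N : ℕ∞) {s p : ℕ} {z : YPoly N} (hz : z ∈ filK N s p) :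
    z - comp N (s, p) z ∈ filK N s (p + 1) := by
  refine mem_filK_succ N (sub_mem hz (comp_mem_filK N s p z)) ?_
  rw [map_sub, comp_comp, sub_self]

theorem comp_mul (N : ℕ∞) {s p t q : ℕ} {z w : YPoly N} (hz : z ∈ filK N s p)
    (hw : w ∈ filK N t q) :
    comp N ((s, p) + (t, q)) (z * w) = comp N (s, p) z * comp N (t, q) w := by
  have e : z * w = comp N (s, p) z * comp N (t, q) w +
      ((z - comp N (s, p) z) * w + comp N (s, p) z * (w - comp N (t, q) w)) := by ring
  have h1 := filK_mul N (sub_comp_mem N hz) hw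
  have h2 := filK_mul N (comp_mem_filK N s p z) (sub_comp_mem N hw)
  rw [show p + 1 + q = p + q + 1 by omega] at h1
  have h3 : comp N ((s, p) + (t, q))
      ((z - comp N (s, p) z) * w + comp N (s, p) z * (w - comp N (t, q) w)) = 0 :=
    comp_eq_zero N (add_mem h1 h2)
  rw [e, map_add, h3, add_zero]
  exact ((MvPolynomial.weightedHomogeneousComponent_isWeightedHomogeneous (s, p) z).mul
    (MvPolynomial.weightedHomogeneousComponent_isWeightedHomogeneous (t, q) w)
    ).weightedHomogeneousComponent_same

theorem koszulD_mem (N : ℕ∞) {s p : ℕ} {z : YPoly N} (hz : z ∈ filK N s p) :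
    koszulD N z ∈ filK N (s + 1) (p + 1) := by
  refine filK_induction (P := fun z => koszulD N z ∈ filK N (s + 1) (p + 1)) ?_ ?_ ?_ hz
  · rw [map_zero]; exact zero_mem _
  · intro f g hf hg
    rw [map_add]; exact add_mem hf hg
  · intro m α hα hp c
    rw [← mul_one c, ← smul_eq_mul, ← MvPolynomial.smul_monomial, map_smul, koszulD_ymon]
    refine Submodule.smul_mem _ _ (sum_mem fun r _ => monomial_mem_filK N ?_ ?_ _)
    · rw [map_add, hα, Finsupp.degree_single]
    · rw [map_add, yWeight_single, one_mul]
      have := Nat.one_le_two_pow (n := r.1)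
      omega

/-! ### Products -/

theorem toY_mul (N : ℕ∞) {i j l : ℕ} {F H : CobY N} (hF : F ∈ mixed N (i + 1) j)
    (hH : H ∈ mixed N i l) : toY N i (F * H) = toY N i F * H := by
  refine mixed_succ_induction N (p := fun F => toY N i (F * H) = toY N i F * H) ?_ ?_ ?_ hF
  · rw [zero_mul, map_zero, zero_mul]
  · intro F G hF hG
    rw [add_mul, map_add, map_add, hF, hG, add_mul]
  · intro α _ g hg k
    refine mixed_induction N (p := fun H => toY N i (monomial α (g * xx N i ^ k) * H) =
      toY N i (monomial α (g * xx N i ^ k)) * H) ?_ ?_ ?_ hH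
    · rw [mul_zero, map_zero, mul_zero]
    · intro F G hF hG
      rw [mul_add, map_add, hF, hG, mul_add]
    · intro β _ h hh
      rw [toY_mul_pow N i α hg, MvPolynomial.monomial_mul, mul_right_comm g,
        toY_mul_pow N i _ (cochains_mul N hg hh), mul_right_comm, MvPolynomial.monomial_mul]

theorem toYs_mul (N : ℕ∞) (i j : ℕ) {l l' : ℕ} {F H : CobY N} (hF : F ∈ mixed N (i + j) l)
    (hH : H ∈ mixed N i l') : toYs N i j (F * H) = toYs N i j F * H := by
  induction j generalizing i with
  | zero => rfl
  | succ j ih =>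
    have hF' : F ∈ mixed N (i + 1 + j) l := by rwa [show i + 1 + j = i + (j + 1) by omega]
    change toY N i (toYs N (i + 1) j (F * H)) = toY N i (toYs N (i + 1) j F) * H
    rw [ih (i + 1) hF' (mixed_mono N (Nat.le_succ i) _ hH),
      toY_mul N (toYs_mem N (i + 1) j hF') hH]

theorem toY_mul_shift (N : ℕ∞) {s i j : ℕ} {f : Cob N} (hf : f ∈ cochains N s) {G : CobY N}
    (hG : G ∈ mixed N (i + 1) j) : toY N (s + i) (C f * mapY N (shift N s) G) =
      C f * mapY N (shift N s) (toY N i G) := by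
  refine mixed_succ_induction N (p := fun G => toY N (s + i) (C f * mapY N (shift N s) G) =
      C f * mapY N (shift N s) (toY N i G)) ?_ ?_ ?_ hG
  · simp only [map_zero, mul_zero]
  · intro F G hF hG
    simp only [map_add, mul_add, hF, hG]
  · intro α _ g hg k
    have h1 : f * shift N s g ∈ cochains N (s + i) :=
      cup_mem_cochains N s i hf hg
    have e : f * shift N s (g * xx N i ^ k) = f * shift N s g * xx N (s + i) ^ k := by
      rw [map_mul, map_pow, shift_xx, mul_assoc]
    rw [mapY_monomial, MvPolynomial.C_mul_monomial, e, toY_mul_pow N _ _ h1,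
      toY_mul_pow N _ _ hg, map_mul (mapY N (shift N s)), mapY_yPow, mapY_monomial, ← mul_assoc,
      MvPolynomial.C_mul_monomial]

theorem toYs_mul_shift (N : ℕ∞) {s : ℕ} (i j : ℕ) {l : ℕ} {f : Cob N} (hf : f ∈ cochains N s)
    {G : CobY N} (hG : G ∈ mixed N (i + j) l) :
    toYs N (s + i) j (C f * mapY N (shift N s) G) =
      C f * mapY N (shift N s) (toYs N i j G) := by
  induction j generalizing i with
  | zero => rfl
  | succ j ih =>
    have hG' : G ∈ mixed N (i + 1 + j) l := by rwa [show i + 1 + j = i + (j + 1) by omega]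
    change toY N (s + i) (toYs N (s + i + 1) j _) = C f * mapY N (shift N s) (toY N i _)
    rw [add_assoc, ih (i + 1) hG', toY_mul_shift N hf (toYs_mem N (i + 1) j hG')]

theorem toYs_add (N : ℕ∞) (i j l : ℕ) (F : CobY N) :
    toYs N i (j + l) F = toYs N i j (toYs N (i + j) l F) := by
  induction j generalizing i with
  | zero => rw [zero_add]; rfl
  | succ j ih =>
    rw [show j + 1 + l = j + l + 1 by omega, show i + (j + 1) = i + 1 + j by omega]
    change toY N i (toYs N (i + 1) (j + l) F) = toY N i (toYs N (i + 1) j _)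
    rw [ih]

theorem shift_uu_pow_sub_mem (N : ℕ∞) (s m : ℕ) :
    shift N s (uu N ^ m) - uu N ^ m ∈ xIdeal N ^ 1 := by
  rw [pow_one, map_pow]
  refine Ideal.mem_of_dvd _ (sub_dvd_pow_sub_pow _ _ m) ?_
  rw [shift_uu, add_sub_cancel_left]
  exact Ideal.mul_mem_left _ _ (sum_mem fun i _ => xx_mem_xIdeal N i)

/-- The comparison map to the Koszul complex is multiplicative on leading terms. -/
theorem comp_toKosz_cup (N : ℕ∞) {s p t q : ℕ} {f g : Cob N} (hf : f ∈ fil N s p)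
    (hg : g ∈ fil N t q) : comp N ((s, p) + (t, q)) (toKosz N (s + t) (cup N s f g)) =
      comp N (s, p) (toKosz N s f) * comp N (t, q) (toKosz N t g) := by
  have hz := toKosz_mem N hg
  set z := toKosz N t g with hzdef
  -- The product of cochains applies the coaction to the second factor. `E` is the part of that
  -- coaction that involves some `x_i`; it has filtration at least `q + 1` and so does not affect
  -- the leading term.
  set E := mapY N (shift N s) (inclY N z) - inclY N z with hE
  have hzm : inclY N z ∈ mixed N s t := mixed_mono N (Nat.zero_le s) t (inclY_mem_mixed N hz)
  have hEm : E ∈ mixed N s t := by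
    refine sub_mem (mapY_mem N _ (fun f hf => ?_) (inclY_mem_mixed N hz)) hzm
    exact shift_mem N s 0 hf
  have hEf : E ∈ filY N (q + 1) := by
    refine filK_induction (P := fun z => mapY N (shift N s) (inclY N z) - inclY N z ∈
      filY N (q + 1)) ?_ ?_ ?_ hz
    · rw [map_zero, map_zero, sub_zero]; exact zero_mem _
    · intro f g hf hg
      rw [map_add, map_add, add_sub_add_comm]; exact add_mem hf hg
    · intro m α _ hα c
      rw [inclY_monomial, mapY_monomial, ← map_sub, map_smul, ← smul_sub]
      refine monomial_mem_filY N (l := 1) ?_ (by omega)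
      rw [Algebra.smul_def]
      exact Ideal.mul_mem_left _ _ (shift_uu_pow_sub_mem N s m)
  have hfC := C_mem_mixed N hf.2
  have e1 : toKosz N (s + t) (cup N s f g) =
      toKosz N s f * z + evalY N (toYs N 0 s (C f * E)) := by
    have h1 : C (cup N s f g) = C f * mapY N (shift N s) (C g) := by
      rw [cup, C.map_mul]
      congr 1
      exact (mapY_monomial N _ _ _).symm
    have h2 := toYs_mul_shift N 0 t hf.2
      (C_mem_mixed N (show g ∈ cochains N (0 + t) by rw [zero_add]; exact hg.2))
    have h3 : mapY N (shift N s) (inclY N z) = inclY N z + E := by rw [hE]; ring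
    have h4 := toYs_mul N 0 s (F := C f) (l := 0) (by rwa [zero_add]) (inclY_mem_mixed N hz)
    rw [add_zero] at h2
    rw [toKosz, toYs_add, zero_add, h1, h2, ← inclY_toKosz N hg.2, ← hzdef, h3, mul_add, map_add,
      map_add, h4, map_mul, evalY_inclY]
    rfl
  have h5 : evalY N (toYs N 0 s (C f * E)) ∈ filK N (s + t) (p + q + 1) := by
    refine evalY_mem_filK N ?_ ?_
    · have h := toYs_mem N 0 s (F := C f * E) (l := 0 + t)
        (by rw [zero_add s]; exact mixed_mul N hfC hEm)
      rwa [show 0 + t + s = s + t by omega] at h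
    · have h := filY_mul N (C_mem_filY N hf.1) hEf
      rw [← add_assoc] at h
      exact toYs_mem_filY N 0 s h
  have h6 : comp N ((s, p) + (t, q)) (evalY N (toYs N 0 s (C f * E))) = 0 := comp_eq_zero N h5
  rw [e1, map_add, h6, add_zero, comp_mul N (toKosz_mem N hf) hz]

/-! ### Consequences of the homotopy -/

/-- In `f = d h f + h d f + fromKosz (toKosz f)` the last two terms lie in `F^(p+1)`: the second
because `d f` does and `h` preserves the filtration, the third because the component of weight `p`
vanishes. -/
theorem mem_bdy_one (N : ℕ∞) {s p : ℕ} {f : Cob N} (hf : f ∈ fil N s p)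
    (hd : diff N s f ∈ fil N (s + 1) (p + 1)) (h : comp N (s, p) (toKosz N s f) = 0) :
    f ∈ bdy N 1 s p := by
  have hz := mem_filK_succ N (toKosz_mem N hf) h
  have h1 : fromKosz N s (inclY N (toKosz N s f)) ∈ fil N s (p + 1) :=
    ⟨fromKosz_mem_pow N s (inclY_mem_filY N hz), fromKosz_mem N s (inclY_mem_mixed N hz)⟩
  have h2 := homotopy_mem_fil N s (p + 1) hd
  cases s with
  | zero =>
    rw [homotopy_zero N hf.2]
    exact fil_le_bdy N _ _ _ (add_mem h2 h1)
  | succ s =>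
    have e := homotopy_succ N s hf.2
    have h3 : diff N s (homotopy N s f) ∈ fil N (s + 1) p := by
      have h4 := sub_mem hf (fil_anti N _ (Nat.le_succ p) (add_mem h2 h1))
      have e' := e
      rw [add_assoc] at e'
      rwa [← eq_sub_of_add_eq e'.symm] at h4
    rw [e, add_assoc]
    refine add_mem (Submodule.mem_sup_left ⟨h3, ?_⟩) (fil_le_bdy N _ _ _ (add_mem h2 h1))
    exact ⟨_, homotopy_mem_fil N s p hf, rfl⟩

theorem mem_fil_zero (N : ℕ∞) {s : ℕ} {f : Cob N} : f ∈ fil N s 0 ↔ f ∈ cochains N s := by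
  rw [fil, pow_zero, Ideal.one_eq_top]
  simp

/-- The comparison map is injective on cohomology; for cocycles with zero image the homotopy formula
reduces to `f = d h f`. -/
theorem mem_bound_of_toKosz (N : ℕ∞) {s : ℕ} {f : Cob N} (hf : f ∈ cocycles N s)
    (h : toKosz N s f = 0) : f ∈ bound N s 0 := by
  have hd : diff N s f = 0 := hf.2
  have h0 : homotopy N s 0 = 0 := by
    simp [homotopy]
  have h1 : fromKosz N s (inclY N (toKosz N s f)) = 0 := by
    rw [h, map_zero, fromKosz, map_zero, map_zero]
  cases s with
  | zero =>
    rw [homotopy_zero N hf.1, hd, h0, h1, add_zero]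
    exact zero_mem _
  | succ s =>
    rw [homotopy_succ N s hf.1, hd, h0, h1, add_zero, add_zero]
    exact ⟨_, (mem_fil_zero N).mpr (homotopy_mem N s hf.1), rfl⟩

/-! ### Explicit cochains -/

/-- The product of an `s`-cochain with the cocycles `[x^(2^r)]` for `r` in a list. -/
def mulList (N : ℕ∞) : ℕ → Cob N → List (Idx N) → Cob N
  | _, f, [] => f
  | s, f, r :: l => mulList N (s + 1) (f * xx N s ^ 2 ^ r.1) l

theorem cup_xx_pow (N : ℕ∞) (s k : ℕ) (f : Cob N) : cup N s f (xx N 0 ^ k) = f * xx N s ^ k := by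
  rw [cup, map_pow, shift_xx, add_zero]

theorem xx_pow_mem_fil (N : ℕ∞) (k : ℕ) : xx N 0 ^ k ∈ fil N 1 k :=
  ⟨Ideal.pow_mem_pow (xx_mem_xIdeal N 0) k, cochains_pow N (xx_mem_cochains N one_pos) k⟩

theorem diff_xx_pow (N : ℕ∞) (r : ℕ) : diff N 1 (xx N 0 ^ 2 ^ r) = 0 := by
  rw [diff_apply, Finset.sum_range_one, map_pow, map_pow, shift_xx, comul_xx, if_neg (by omega),
    if_pos rfl, add_pow_two_pow, add_zero]
  linear_combination (xx N 0 ^ 2 ^ r + xx N 1 ^ 2 ^ r) * two_eq_zero N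

theorem mul_xx_mem_fil (N : ℕ∞) {s p : ℕ} {f : Cob N} (hf : f ∈ fil N s p) (k : ℕ) :
    f * xx N s ^ k ∈ fil N (s + 1) (p + k) := by
  rw [← cup_xx_pow]
  exact cup_mem_fil N hf (xx_pow_mem_fil N k)

theorem diff_mul_xx (N : ℕ∞) {s : ℕ} {f : Cob N} (hf : f ∈ cochains N s) (r : ℕ) :
    diff N (s + 1) (f * xx N s ^ 2 ^ r) = diff N s f * xx N (s + 1) ^ 2 ^ r := by
  rw [← cup_xx_pow, ← cup_xx_pow, diff_cup N s 1 hf, diff_xx_pow, cup, cup, map_zero, mul_zero,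
    add_zero]

theorem toKosz_mul_xx (N : ℕ∞) {s : ℕ} {f : Cob N} (hf : f ∈ cochains N s) (r : Idx N) :
    toKosz N (s + 1) (f * xx N s ^ 2 ^ r.1) =
      toKosz N s f * monomial (ymon 0 (Finsupp.single r 1)) 1 := by
  have hC := C_mem_mixed N hf
  have h1 : toYs N (0 + s) 1 (C (f * xx N s ^ 2 ^ r.1)) = C f * X r := by
    rw [zero_add]
    change toY N s (monomial 0 (f * xx N s ^ 2 ^ r.1)) = _
    rw [toY_mul_pow N s 0 hf, yPow_two_pow, MvPolynomial.C_apply]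
  have hX : (X r : CobY N) ∈ mixed N 0 1 := by
    rw [← yPow_two_pow]; exact yPow_mem_mixed N 0 _
  rw [toKosz, toYs_add, h1, toYs_mul N 0 s (l := 0) (by rwa [zero_add]) hX, map_mul, evalY_X,
    ymon_single_y, X]
  rfl

theorem mulList_mem (N : ℕ∞) {s p : ℕ} {f : Cob N} (hf : f ∈ fil N s p) (l : List (Idx N)) :
    mulList N s f l ∈ fil N (s + l.length) (p + (l.map fun r => 2 ^ r.1).sum) := by
  induction l generalizing s p f with
  | nil => exact hf
  | cons r l ih =>
    have h := ih (mul_xx_mem_fil N hf (2 ^ r.1))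
    rwa [add_right_comm, add_assoc s, add_assoc p, ← List.length_cons (a := r),
      ← List.sum_cons] at h

/-- The factors `[x^(2^r)]` are cocycles, since `x^(2^r)` is primitive. -/
theorem diff_mulList (N : ℕ∞) {s : ℕ} {f : Cob N} (hf : f ∈ cochains N s) (l : List (Idx N)) :
    diff N (s + l.length) (mulList N s f l) = mulList N (s + 1) (diff N s f) l := by
  induction l generalizing s f with
  | nil => rfl
  | cons r l ih =>
    have h := ih ((mul_xx_mem_fil N ((mem_fil_zero N).mpr hf) (2 ^ r.1)).2)
    rw [diff_mul_xx N hf] at h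
    rw [List.length_cons, add_comm l.length, ← add_assoc]
    exact h

theorem mulList_smul (N : ℕ∞) (s : ℕ) (c : F2a) (f : Cob N) (l : List (Idx N)) :
    mulList N s (c • f) l = c • mulList N s f l := by
  induction l generalizing s f with
  | nil => rfl
  | cons r l ih =>
    rw [mulList, smul_mul_assoc, ih]
    rfl

theorem toKosz_mulList (N : ℕ∞) {s : ℕ} {f : Cob N} (hf : f ∈ cochains N s)
    (l : List (Idx N)) : toKosz N (s + l.length) (mulList N s f l) =
      toKosz N s f * monomial (ymon 0 (l.map fun r => Finsupp.single r 1).sum) 1 := by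
  induction l generalizing s f with
  | nil =>
    rw [List.map_nil, List.sum_nil, ymon_zero, MvPolynomial.monomial_zero', map_one, mul_one]
    rfl
  | cons r l ih =>
    have h := ih ((mul_xx_mem_fil N ((mem_fil_zero N).mpr hf) (2 ^ r.1)).2)
    rw [toKosz_mul_xx N hf, mul_assoc, MvPolynomial.monomial_mul, ← ymon_add, add_zero,
      mul_one] at h
    rw [List.length_cons, add_comm l.length, ← add_assoc]
    exact h

theorem exists_list {N : ℕ∞} (α : Idx N →₀ ℕ) :
    ∃ l : List (Idx N), (l.map fun r => Finsupp.single r 1).sum = α ∧ l.length = α.degree ∧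
      (l.map fun r => 2 ^ r.1).sum = yWeight N α := by
  induction α using Finsupp.induction_linear with
  | zero => exact ⟨[], rfl, (map_zero _).symm, (map_zero _).symm⟩
  | add α β hα hβ =>
    obtain ⟨l, h1, h2, h3⟩ := hα
    obtain ⟨l', h1', h2', h3'⟩ := hβ
    refine ⟨l ++ l', ?_, ?_, ?_⟩
    · rw [List.map_append, List.sum_append, h1, h1']
    · rw [List.length_append, h2, h2', map_add]
    · rw [List.map_append, List.sum_append, h3, h3', map_add]
  | single r k =>
    refine ⟨List.replicate k r, ?_, ?_, ?_⟩
    · rw [List.map_replicate, List.sum_replicate, Finsupp.smul_single, smul_eq_mul, mul_one]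
    · rw [List.length_replicate, Finsupp.degree_single]
    · rw [List.map_replicate, List.sum_replicate, yWeight_single, smul_eq_mul]

theorem toKosz_uu_pow (N : ℕ∞) (m : ℕ) : toKosz N 0 (uu N ^ m) = monomial (ymon m 0) 1 := by
  change evalY N (C (uu N ^ m)) = _
  rw [evalY_C, map_pow, augment_uu, ymon_single_u, MvPolynomial.X_pow_eq_monomial]

theorem uu_pow_mem (N : ℕ∞) (m : ℕ) : uu N ^ m ∈ fil N 0 0 :=
  (mem_fil_zero N).mpr (cochains_pow N (uu_mem_cochains N 0) m)

theorem diff_uu_pow (N : ℕ∞) (m : ℕ) :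
    diff N 0 (uu N ^ m) = (uu N + aa N ^ 2 * xx N 0) ^ m + uu N ^ m := by
  rw [diff_apply, Finset.range_zero, Finset.sum_empty, add_zero, map_pow, shift_uu,
    Finset.sum_range_one]

theorem diff_uu_pow_mem (N : ℕ∞) (m : ℕ) : diff N 0 (uu N ^ m) ∈ fil N 1 1 := by
  refine ⟨?_, diff_mem N 0 (cochains_pow N (uu_mem_cochains N 0) m)⟩
  have h := shift_uu_pow_sub_mem N 1 m
  rw [diff_apply, Finset.range_zero, Finset.sum_empty, add_zero]
  have e : shift N 1 (uu N ^ m) + uu N ^ m = shift N 1 (uu N ^ m) - uu N ^ m := by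
    linear_combination uu N ^ m * two_eq_zero N
  rw [e]
  exact h

/-- Every monomial of `𝔽₂[a, u, y_r]` is the image of a cochain that represents a class in `E₁`. -/
theorem exists_lift_one (N : ℕ∞) (m : ℕ) (α : Idx N →₀ ℕ) :
    ∃ c ∈ fil N α.degree (yWeight N α),
      diff N α.degree c ∈ fil N (α.degree + 1) (yWeight N α + 1) ∧
      toKosz N α.degree c = monomial (ymon m α) 1 := by
  obtain ⟨l, h1, h2, h3⟩ := exists_list α
  refine ⟨mulList N 0 (uu N ^ m) l, ?_, ?_, ?_⟩
  · have h := mulList_mem N (uu_pow_mem N m) l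
    rwa [zero_add, zero_add, h2, h3] at h
  · have h := mulList_mem N (diff_uu_pow_mem N m) l
    rw [← diff_mulList N (uu_pow_mem N m).2, h2, h3, zero_add] at h
    rwa [add_comm α.degree, add_comm (yWeight N α)]
  · have h := toKosz_mulList N (uu_pow_mem N m).2 l
    rwa [zero_add, h2, h1, toKosz_uu_pow, MvPolynomial.monomial_mul, ← ymon_add, add_zero,
      zero_add, mul_one] at h

theorem a_smul (N : ℕ∞) (k : ℕ) (f : Cob N) : F2a.a ^ k • f = aa N ^ k * f := by
  rw [Algebra.smul_def, map_pow]
  rfl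

/-- The cocycle `d (u^(m + 2^t)) / a^(2^(t+1))` with leading term `u^m [x^(2^t)]`. -/
theorem exists_divided_diff (N : ℕ∞) {m t : ℕ} (hm : 2 ^ (t + 1) ∣ m) :
    ∃ c ∈ fil N 1 (2 ^ t), F2a.a ^ 2 ^ (t + 1) • c = diff N 0 (uu N ^ (m + 2 ^ t)) ∧
      c - uu N ^ m * xx N 0 ^ 2 ^ t ∈ fil N 1 (2 ^ t + 1) := by
  obtain ⟨l, rfl⟩ := hm
  have hu := cochains_pow N (uu_mem_cochains N 1) (2 ^ t)
  have hx := xx_pow_mem_fil N (2 ^ t)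
  have ha : aa N ^ 2 ^ (t + 1) ∈ cochains N 1 :=
    cochains_pow N (Subalgebra.algebraMap_mem _ _) _
  let v : cochainAlg N 1 := ⟨_, hu⟩
  let z : cochainAlg N 1 := ⟨_, hx.2⟩
  let e : cochainAlg N 1 := ⟨_, ha⟩
  -- With `v = u^(2^t)`, `z = x^(2^t)` and `e = a^(2^(t+1))`, this reads `(v + e z)^(2l+1) =
  -- v^(2l+1) + (2l+1) v^(2l) e z + k (e z)²`. It is taken inside the subalgebra of cochains so that
  -- `k` is again a 1-cochain. Dividing by `e` leaves the leading term `v^(2l) z` and a remainder of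
  -- filtration `2 · 2^t ≥ 2^t + 1`.
  obtain ⟨k, hk⟩ := Polynomial.powAddExpansion v (e * z) (2 * l + 1)
  have hk' := congrArg (Subtype.val : cochainAlg N 1 → Cob N) hk
  simp only [v, z, e, Subalgebra.coe_mul, Subalgebra.coe_add, Subalgebra.coe_pow] at hk'
  have e1 : ((2 * l + 1 : ℕ) : Cob N) = 1 := by
    push_cast
    rw [two_eq_zero]
    ring
  have e2 : (((2 * l + 1 : ℕ) : cochainAlg N 1) : Cob N) = 1 := by
    rw [← e1]; rfl
  rw [e2, one_mul, Nat.add_sub_cancel] at hk'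
  have hux : uu N ^ (2 ^ (t + 1) * l) * xx N 0 ^ 2 ^ t ∈ fil N 1 (2 ^ t) :=
    ⟨Ideal.mul_mem_left _ _ hx.1,
      cochains_mul N (cochains_pow N (uu_mem_cochains N 1) _) hx.2⟩
  have hr : aa N ^ 2 ^ (t + 1) * (k : Cob N) * (xx N 0 ^ 2 ^ t) ^ 2 ∈ fil N 1 (2 ^ t + 1) := by
    refine ⟨Ideal.mul_mem_left _ _ ?_,
      cochains_mul N (cochains_mul N ha k.2) (cochains_pow N hx.2 2)⟩
    rw [← pow_mul]
    refine Ideal.pow_le_pow_right ?_ (Ideal.pow_mem_pow (xx_mem_xIdeal N 0) _)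
    have := Nat.one_le_two_pow (n := t)
    omega
  refine ⟨uu N ^ (2 ^ (t + 1) * l) * xx N 0 ^ 2 ^ t +
    aa N ^ 2 ^ (t + 1) * (k : Cob N) * (xx N 0 ^ 2 ^ t) ^ 2,
    add_mem hux (fil_anti N _ (Nat.le_succ _) hr), ?_, by rwa [add_sub_cancel_left]⟩
  have e4 : 2 ^ (t + 1) * l + 2 ^ t = 2 ^ t * (2 * l + 1) := by ring
  have e5 : (uu N + aa N ^ 2 * xx N 0) ^ 2 ^ t =
      uu N ^ 2 ^ t + aa N ^ 2 ^ (t + 1) * xx N 0 ^ 2 ^ t := by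
    rw [add_pow_two_pow, mul_pow, ← pow_mul, pow_succ, mul_comm (2 ^ t) 2]
  have e6 : uu N ^ (2 ^ (t + 1) * l) = (uu N ^ 2 ^ t) ^ (2 * l) := by
    rw [← pow_mul]; congr 1; ring
  rw [diff_uu_pow, a_smul, e4, e6, pow_mul (uu N + aa N ^ 2 * xx N 0), pow_mul (uu N) (2 ^ t) (2 * l + 1), e5, hk']
  linear_combination -(uu N ^ 2 ^ t) ^ (2 * l + 1) * two_eq_zero N

/-- For `N = ⊤` only `m = 0` is divisible by all powers of two, so no positive power of `u` is good.
For finite `N = n` the strongest condition is the one at `r = n - 1`. -/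
theorem dvd_cases {N : ℕ∞} {m : ℕ} (h : IsGood m (0 : Idx N →₀ ℕ)) :
    m = 0 ∨ ∃ n : ℕ, N = n ∧ 2 ^ n ∣ m := by
  have h' : ∀ r : ℕ, (r : ℕ∞) < N → 2 ^ (r + 1) ∣ m := fun r hr => h ⟨r, hr⟩ fun _ _ => rfl
  induction N using ENat.recTopCoe with
  | top =>
    left
    by_contra hm
    have h1 := Nat.le_of_dvd (Nat.pos_of_ne_zero hm) (h' m (ENat.natCast_lt_top m))
    have h2 := Nat.lt_two_pow_self (n := m + 1)
    omega
  | coe n =>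
    right
    refine ⟨n, rfl, ?_⟩
    cases n with
    | zero => simp
    | succ n => exact h' n (by exact_mod_cast Nat.lt_succ_self n)

theorem diff_uu_pow_eq_zero {N : ℕ∞} {m : ℕ} (h : IsGood m (0 : Idx N →₀ ℕ)) :
    diff N 0 (uu N ^ m) = 0 := by
  rw [diff_uu_pow]
  rcases dvd_cases h with rfl | ⟨n, hn, l, rfl⟩
  · rw [pow_zero, pow_zero, add_self]
  · rw [pow_mul, pow_mul, add_pow_two_pow, mul_pow, xx_pow N n hn, mul_zero, add_zero, add_self]

open Classical in
/-- Every monomial of `answerSub` is the leading term of a cocycle. -/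
theorem exists_lift (N : ℕ∞) {m : ℕ} {α : Idx N →₀ ℕ} (h : IsGood m α) :
    ∃ c ∈ fil N α.degree (yWeight N α), diff N α.degree c = 0 ∧
      (∀ m' (α' : Idx N →₀ ℕ), IsGood m' α' → coeff (ymon m' α') (toKosz N α.degree c) =
        if m = m' ∧ α = α' then 1 else 0) ∧
      ∀ t, IsLow α t → F2a.a ^ 2 ^ (t.1 + 1) • c ∈ bound N α.degree 0 := by
  by_cases hα : α = 0
  · subst hα
    refine ⟨uu N ^ m, ?_, ?_, fun m' α' _ => ?_, fun t ht => absurd rfl ht.1⟩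
    · rw [map_zero, map_zero]; exact uu_pow_mem N m
    · rw [map_zero]; exact diff_uu_pow_eq_zero h
    · rw [map_zero, toKosz_uu_pow, coeff_ymon_monomial]
  · obtain ⟨t, ht⟩ := exists_isLow hα
    have hm : 2 ^ (t.1 + 1) ∣ m := h t ht.2
    obtain ⟨c, hc, hdc, -⟩ := exists_divided_diff N hm
    obtain ⟨β, hβ⟩ : ∃ β, α = β + Finsupp.single t 1 := ⟨α - Finsupp.single t 1,
      (tsub_add_cancel_of_le (Finsupp.single_le_iff.mpr (Nat.one_le_iff_ne_zero.mpr ht.1))).symm⟩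
    obtain ⟨l, h1, h2, h3⟩ := exists_list β
    have hdeg : α.degree = 1 + l.length := by
      rw [hβ, map_add, Finsupp.degree_single, h2, add_comm]
    have hwt : yWeight N α = 2 ^ t.1 + (l.map fun r => 2 ^ r.1).sum := by
      rw [hβ, map_add, yWeight_single, one_mul, h3, add_comm]
    have hU := (uu_pow_mem N (m + 2 ^ t.1)).2
    have hb : F2a.a ^ 2 ^ (t.1 + 1) • mulList N 1 c l =
        diff N l.length (mulList N 0 (uu N ^ (m + 2 ^ t.1)) l) := by
      rw [← mulList_smul, hdc, ← diff_mulList N hU, zero_add]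
    have hbm : mulList N 0 (uu N ^ (m + 2 ^ t.1)) l ∈ cochains N l.length := by
      have := (mulList_mem N (uu_pow_mem N (m + 2 ^ t.1)) l).2
      rwa [zero_add] at this
    have ha : F2a.a ^ 2 ^ (t.1 + 1) ≠ 0 := pow_ne_zero _ F2a.a_ne_zero
    refine ⟨mulList N 1 c l, ?_, ?_, fun m' α' hgood => ?_, fun t' ht' => ?_⟩
    · rw [hdeg, hwt]; exact mulList_mem N hc l
    · rw [hdeg]
      -- A multiple of the cochain by a power of `a` is a coboundary, and `Cob N` has no
      -- `a`-torsion.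
      refine smul_eq_zero_of_ne N ha ?_
      rw [← map_smul, hb, add_comm 1, diff_diff N _ hbm]
    · have e1 : F2a.a ^ 2 ^ (t.1 + 1) • toKosz N α.degree (mulList N 1 c l) =
          ∑ r ∈ bits N (m + 2 ^ t.1), monomial (ymon (m + 2 ^ t.1 - 2 ^ r.1)
            (β + Finsupp.single r 1)) (F2a.a ^ 2 ^ (r.1 + 1)) := by
        have e2 := toKosz_mulList N hU l
        rw [zero_add] at e2
        rw [← toKosz_smul, hb, hdeg, add_comm 1, toKosz_diff N _ hbm, e2, toKosz_uu_pow,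
          MvPolynomial.monomial_mul, ← ymon_add, add_zero, zero_add, h1, mul_one, koszulD_ymon]
      have e3 := congrArg (coeff (ymon m' α')) e1
      have htb : t ∈ bits N (m + 2 ^ t.1) :=
        (mem_bits N _ t).mpr ((testBit_add_two_pow hm _).mpr (Or.inl rfl))
      rw [MvPolynomial.coeff_smul, smul_eq_mul, MvPolynomial.coeff_sum,
        Finset.sum_eq_single_of_mem t htb, coeff_ymon_monomial, Nat.add_sub_cancel, ← hβ] at e3
      · refine mul_left_cancel₀ ha (e3.trans ?_)
        rw [mul_ite, mul_one, mul_zero]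
      -- The other digits satisfy `r > t`. Their monomials have `u`-exponent `m + 2^t - 2^r` of
      -- 2-adic valuation `t` and no `y_q` with `q < t`, so they are bad and invisible at good
      -- indices.
      · intro r hr hrt
        rw [coeff_ymon_monomial, if_neg]
        rintro ⟨rfl, rfl⟩
        have hr' := ((testBit_add_two_pow hm _).mp ((mem_bits N _ r).mp hr)).resolve_left
          fun h => hrt (Subtype.ext h)
        have htr := le_of_testBit_of_dvd hr' hm
        have hle : 2 ^ r.1 ≤ m := two_pow_le_of_testBit hr'
        have hd : 2 ^ (t.1 + 1) ∣ m + 2 ^ t.1 - 2 ^ r.1 := by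
          refine hgood t fun q hq => ?_
          have hq1 : q.1 < t.1 := hq
          have hq2 := ht.2 q hq
          rw [hβ, Finsupp.add_apply] at hq2
          rw [Finsupp.add_apply, Finsupp.single_eq_of_ne, add_zero]
          · omega
          · rintro rfl
            omega
        rw [Nat.sub_add_comm hle, Nat.dvd_add_right (Nat.dvd_sub hm (pow_dvd_pow 2 htr)),
          Nat.pow_dvd_pow_iff_le_right one_lt_two] at hd
        omega
    · rw [← ht.unique ht', hb, hdeg, add_comm 1]
      exact ⟨_, (mem_fil_zero N).mpr hbm, rfl⟩

/-! ### The answer in terms of coefficients -/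

theorem yGen_eq (N : ℕ∞) (r : Idx N) (m : ℕ) :
    yGen N r.1 r.2 m = monomial (ymon (2 ^ (r.1 + 1) * m) (Finsupp.single r 1)) 1 := by
  rw [monomial_ymon, Finsupp.prod_single_index (h := fun r : Idx N => fun k =>
    (X (YVar.y r.1 r.2) : YPoly N) ^ k) (pow_zero _), pow_one, yGen]

theorem IsGood.add {N : ℕ∞} {m m' : ℕ} {α α' : Idx N →₀ ℕ} (h : IsGood m α)
    (h' : IsGood m' α') : IsGood (m + m') (α + α') := by
  intro r hr
  refine dvd_add (h r fun q hq => ?_) (h' r fun q hq => ?_)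
  · have := hr q hq
    rw [Finsupp.add_apply] at this
    omega
  · have := hr q hq
    rw [Finsupp.add_apply] at this
    omega

/-- The span of the monomials of `answerSub`. -/
def goodSub (N : ℕ∞) : Submodule F2a (YPoly N) where
  carrier := {z | ∀ m α, coeff (ymon m α) z ≠ 0 → IsGood m α}
  zero_mem' m α h := absurd (MvPolynomial.coeff_zero _) h
  add_mem' {z w} hz hw m α h := by
    by_cases h1 : coeff (ymon m α) z = 0
    · refine hw m α fun h2 => h ?_
      rw [MvPolynomial.coeff_add, h1, h2, add_zero]
    · exact hz m α h1
  smul_mem' c z hz m α h := by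
    refine hz m α fun h2 => h ?_
    rw [MvPolynomial.coeff_smul, h2, smul_zero]

theorem monomial_mem_goodSub (N : ℕ∞) {m : ℕ} {α : Idx N →₀ ℕ} (h : IsGood m α) (c : F2a) :
    monomial (ymon m α) c ∈ goodSub N := by
  classical
  intro m' α' hne
  rw [coeff_ymon_monomial] at hne
  obtain ⟨rfl, rfl⟩ : m = m' ∧ α = α' := by
    by_contra h'
    exact hne (if_neg h')
  exact h

theorem goodSub_induction {N : ℕ∞} {P : YPoly N → Prop} (h0 : P 0)
    (hadd : ∀ f g, P f → P g → P (f + g))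
    (hmon : ∀ m α, IsGood m α → ∀ c, P (monomial (ymon m α) c))
    {z : YPoly N} (hz : z ∈ goodSub N) : P z := by
  rw [z.as_sum]
  refine Finset.sum_induction _ P hadd h0 fun μ hμ => ?_
  rw [MvPolynomial.mem_support_iff, ← ymon_yPart μ] at hμ
  rw [← ymon_yPart μ]
  exact hmon _ _ (hz _ _ hμ) _

theorem goodSub_mul (N : ℕ∞) {z w : YPoly N} (hz : z ∈ goodSub N) (hw : w ∈ goodSub N) :
    z * w ∈ goodSub N := by
  refine goodSub_induction (P := fun z => z * w ∈ goodSub N) ?_ ?_ ?_ hz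
  · rw [zero_mul]; exact zero_mem _
  · intro f g hf hg
    rw [add_mul]; exact add_mem hf hg
  · intro m α hα c
    refine goodSub_induction (P := fun w => monomial (ymon m α) c * w ∈ goodSub N) ?_ ?_ ?_ hw
    · rw [mul_zero]; exact zero_mem _
    · intro f g hf hg
      rw [mul_add]; exact add_mem hf hg
    · intro m' α' hα' c'
      rw [MvPolynomial.monomial_mul, ← ymon_add]
      exact monomial_mem_goodSub N (hα.add hα') _

theorem monomial_y_mem (N : ℕ∞) (α : Idx N →₀ ℕ) : monomial (ymon 0 α) 1 ∈ answerSub N := by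
  rw [monomial_ymon, pow_zero, one_mul]
  refine prod_mem fun r _ => pow_mem ?_ _
  have h := yGen_mem N r.1 r.2 0
  rwa [yGen, mul_zero, pow_zero, one_mul] at h

theorem monomial_eq_yGen_mul (N : ℕ∞) {m : ℕ} {α : Idx N →₀ ℕ} {t : Idx N} (ht : α t ≠ 0)
    (hm : 2 ^ (t.1 + 1) ∣ m) : (monomial (ymon m α) 1 : YPoly N) =
      yGen N t.1 t.2 (m / 2 ^ (t.1 + 1)) * monomial (ymon 0 (α - Finsupp.single t 1)) 1 := by
  rw [yGen_eq, MvPolynomial.monomial_mul, ← ymon_add, Nat.mul_div_cancel' hm, add_zero, mul_one,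
    add_tsub_cancel_of_le (Finsupp.single_le_iff.mpr (Nat.one_le_iff_ne_zero.mpr ht))]

/-- A good monomial with `α ≠ 0` is a generator at the least index of `α`, absorbing the whole power
of `u`, times a monomial in the `y_r`. With `α = 0` it is a power of `u^(2^n)`, or `1`. -/
theorem mem_answerSub_iff (N : ℕ∞) (z : YPoly N) : z ∈ answerSub N ↔ z ∈ goodSub N := by
  constructor
  · intro hz
    refine Algebra.adjoin_induction (p := fun z _ => z ∈ goodSub N) ?_ ?_ ?_ ?_ hz
    · rintro _ (⟨r, hr, m, rfl⟩ | ⟨n, hn, rfl⟩)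
      · rw [yGen_eq N ⟨r, hr⟩]
        exact monomial_mem_goodSub N
          (isGood_of_isLow (t := ⟨r, hr⟩) (by simp) (Dvd.intro _ rfl)) _
      · rw [MvPolynomial.X_pow_eq_monomial, ← ymon_single_u]
        refine monomial_mem_goodSub N (fun r _ => pow_dvd_pow 2 ?_) _
        exact r.lt hn
    · intro c
      rw [MvPolynomial.algebraMap_eq, MvPolynomial.C_apply, ← ymon_zero]
      exact monomial_mem_goodSub N (fun _ _ => dvd_zero _) _
    · exact fun _ _ _ _ => add_mem
    · exact fun _ _ _ _ => goodSub_mul N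
  · intro hz
    refine goodSub_induction (P := fun z => z ∈ answerSub N) (zero_mem _)
      (fun _ _ => add_mem) ?_ hz
    intro m α h c
    rw [← mul_one c, ← smul_eq_mul, ← MvPolynomial.smul_monomial]
    refine Subalgebra.smul_mem _ ?_ c
    by_cases hα : α = 0
    · subst hα
      rw [ymon_single_u, ← MvPolynomial.X_pow_eq_monomial]
      rcases dvd_cases h with rfl | ⟨n, hn, l, rfl⟩
      · rw [pow_zero]; exact one_mem _
      · rw [pow_mul]; exact pow_mem (u_pow_mem N n hn) l
    · obtain ⟨t, ht⟩ := exists_isLow hα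
      rw [monomial_eq_yGen_mul N ht.1 (h t ht.2)]
      exact mul_mem (yGen_mem N _ _ _) (monomial_y_mem N _)

/-- The polynomials whose coefficients at `u^m y^α` are divisible by `a^(2^(t+1))` for the least
index `t` in `α`, and vanish if `α = 0`. -/
def torsionSub (N : ℕ∞) : Submodule F2a (YPoly N) where
  carrier := {z | ∀ m α, (α = 0 → coeff (ymon m α) z = 0) ∧
    ∀ t, IsLow α t → F2a.a ^ 2 ^ (t.1 + 1) ∣ coeff (ymon m α) z}
  zero_mem' m α := ⟨fun _ => MvPolynomial.coeff_zero _, fun t _ => by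
    rw [MvPolynomial.coeff_zero]; exact dvd_zero _⟩
  add_mem' {z w} hz hw m α := by
    refine ⟨fun h => ?_, fun t ht => ?_⟩
    · rw [MvPolynomial.coeff_add, (hz m α).1 h, (hw m α).1 h, add_zero]
    · rw [MvPolynomial.coeff_add]
      exact dvd_add ((hz m α).2 t ht) ((hw m α).2 t ht)
  smul_mem' c z hz m α := by
    refine ⟨fun h => ?_, fun t ht => ?_⟩
    · rw [MvPolynomial.coeff_smul, (hz m α).1 h, smul_zero]
    · rw [MvPolynomial.coeff_smul, smul_eq_mul]
      exact ((hz m α).2 t ht).mul_left c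

/-- Multiplication can only lower the least index occurring in a monomial, and a lower index asks
for a smaller power of `a`. -/
theorem mul_mem_torsionSub (N : ℕ∞) (z : YPoly N) {w : YPoly N} (hw : w ∈ torsionSub N) :
    z * w ∈ torsionSub N := by
  classical
  intro m α
  have key : ∀ β ∈ antidiagonal (ymon m α),
      yPart β.1 + yPart β.2 = α ∧ ymon (β.2 YVar.u) (yPart β.2) = β.2 := by
    intro β hβ
    refine ⟨?_, ymon_yPart _⟩
    have h := mem_antidiagonal.mp hβ
    ext r
    have h' := DFunLike.congr_fun h (YVar.y r.1 r.2)
    rwa [ymon_y] at h'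
  refine ⟨fun h => ?_, fun t ht => ?_⟩
  · rw [MvPolynomial.coeff_mul]
    refine Finset.sum_eq_zero fun β hβ => ?_
    obtain ⟨h1, h2⟩ := key β hβ
    rw [← h2, (hw _ _).1, mul_zero]
    rw [h] at h1
    ext r
    have h' := DFunLike.congr_fun h1 r
    rw [Finsupp.add_apply, Finsupp.zero_apply] at h'
    rw [Finsupp.zero_apply]
    omega
  · rw [MvPolynomial.coeff_mul]
    refine Finset.dvd_sum fun β hβ => ?_
    obtain ⟨h1, h2⟩ := key β hβ
    by_cases h0 : yPart β.2 = 0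
    · rw [← h2, (hw _ _).1 h0, mul_zero]; exact dvd_zero _
    · obtain ⟨t', ht'⟩ := exists_isLow h0
      rw [← h2]
      refine Dvd.dvd.mul_left (dvd_trans (pow_dvd_pow _ (Nat.pow_le_pow_right two_pos ?_))
        ((hw _ _).2 t' ht')) _
      by_contra hlt
      have hlt' : t' < t := by
        change t'.1 < t.1
        omega
      have h' := DFunLike.congr_fun h1 t'
      rw [Finsupp.add_apply, ht.2 t' hlt'] at h'
      have := ht'.1
      omega

theorem mem_answerIdeal_iff (N : ℕ∞) (w : answerSub N) :
    w ∈ answerIdeal N ↔ (w : YPoly N) ∈ torsionSub N := by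
  classical
  constructor
  · intro hw
    refine Submodule.span_induction (p := fun (w : answerSub N) _ => (w : YPoly N) ∈ torsionSub N)
      ?_ ?_ ?_ ?_ hw
    · rintro _ ⟨r, hr, m, rfl⟩
      change F2a.a ^ 2 ^ (r + 1) • yGen N r hr m ∈ torsionSub N
      rw [yGen_eq N ⟨r, hr⟩, MvPolynomial.smul_monomial, smul_eq_mul, mul_one]
      intro m' α'
      rw [coeff_ymon_monomial]
      split_ifs with h
      · obtain ⟨-, rfl⟩ := h
        refine ⟨fun h0 => ?_, fun t ht => ?_⟩
        · have := DFunLike.congr_fun h0 (⟨r, hr⟩ : Idx N)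
          simp at this
        · have : t = ⟨r, hr⟩ := by
            by_contra hne
            exact ht.1 (Finsupp.single_eq_of_ne hne)
          rw [this]
      · exact ⟨fun _ => rfl, fun _ _ => dvd_zero _⟩
    · exact zero_mem _
    · exact fun _ _ _ _ => add_mem
    · exact fun z w _ hw => mul_mem_torsionSub N z hw
  · intro hw
    have hg := (mem_answerSub_iff N _).mp w.2
    -- The conditions are on single coefficients, so `w` may be split into its monomials, each lying
    -- in `answerSub`. Each is then a multiple of the relation at its least index `t`.
    have e : w = ∑ μ ∈ (w : YPoly N).support.attach,
        (⟨monomial μ.1 (coeff μ.1 (w : YPoly N)), by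
          have hμ := MvPolynomial.mem_support_iff.mp μ.2
          rw [mem_answerSub_iff, ← ymon_yPart μ.1]
          rw [← ymon_yPart μ.1] at hμ
          exact monomial_mem_goodSub N (hg _ _ hμ) _⟩ : answerSub N) := by
      apply Subtype.ext
      rw [AddSubmonoidClass.coe_finsetSum]
      conv_lhs => rw [(w : YPoly N).as_sum]
      exact (Finset.sum_attach _ fun μ => monomial μ (coeff μ (w : YPoly N))).symm
    rw [e]
    refine sum_mem fun μ _ => ?_
    have hμ := MvPolynomial.mem_support_iff.mp μ.2
    have hμ' := hμ
    rw [← ymon_yPart μ.1] at hμ'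
    have hgood := hg _ _ hμ'
    have hne : yPart μ.1 ≠ 0 := fun h => hμ' ((hw _ _).1 h)
    obtain ⟨t, ht⟩ := exists_isLow hne
    have hd := (hw (μ.1 YVar.u) (yPart μ.1)).2 t ht
    rw [ymon_yPart] at hd
    obtain ⟨d, hd⟩ := hd
    have e2 : (⟨monomial μ.1 (coeff μ.1 (w : YPoly N)), by
          rw [mem_answerSub_iff, ← ymon_yPart μ.1]
          exact monomial_mem_goodSub N hgood _⟩ : answerSub N) =
        (d • ⟨_, monomial_y_mem N (yPart μ.1 - Finsupp.single t 1)⟩ : answerSub N) *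
          F2a.a ^ 2 ^ (t.1 + 1) •
            (⟨yGen N t.1 t.2 (μ.1 YVar.u / 2 ^ (t.1 + 1)), yGen_mem N _ _ _⟩ : answerSub N) := by
      apply Subtype.ext
      change monomial μ.1 (coeff μ.1 (w : YPoly N)) =
        (d • monomial (ymon 0 (yPart μ.1 - Finsupp.single t 1)) 1) *
          F2a.a ^ 2 ^ (t.1 + 1) • yGen N t.1 t.2 (μ.1 YVar.u / 2 ^ (t.1 + 1))
      rw [smul_mul_smul_comm, mul_comm (monomial _ _),
        ← monomial_eq_yGen_mul N ht.1 (hgood t ht.2), ymon_yPart, MvPolynomial.smul_monomial,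
        smul_eq_mul, mul_one, hd, mul_comm]
    rw [e2]
    exact Ideal.mul_mem_left _ _ (Ideal.subset_span ⟨t.1, t.2, _, rfl⟩)

/-! ### Leading terms -/

/-- The component of bidegree `i` of the Koszul cochain of a cobar cochain. -/
def lead (N : ℕ∞) (i : ℕ × ℕ) : Cob N →ₗ[F2a] YPoly N :=
  (comp N i).comp
    { toFun := fun f => toKosz N i.1 f
      map_add' := fun f g => toKosz_add N i.1 f g
      map_smul' := fun c f => by rw [toKosz_smul, RingHom.id_apply] }

theorem lead_apply (N : ℕ∞) (s p : ℕ) (f : Cob N) :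
    lead N (s, p) f = comp N (s, p) (toKosz N s f) := rfl

theorem lead_eq_zero (N : ℕ∞) {s p : ℕ} {f : Cob N} (hf : f ∈ fil N s (p + 1)) :
    lead N (s, p) f = 0 :=
  comp_eq_zero N (toKosz_mem N hf)

theorem comp_comp_of_ne (N : ℕ∞) {i j : ℕ × ℕ} (h : i ≠ j) (z : YPoly N) :
    comp N i (comp N j z) = 0 := by
  classical
  obtain ⟨s, p⟩ := i
  obtain ⟨t, q⟩ := j
  refine YPoly.ext fun m α => ?_
  rw [coeff_comp, coeff_comp, MvPolynomial.coeff_zero]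
  split_ifs with h1 h2
  · exact absurd (Prod.ext (h1.1.symm.trans h2.1) (h1.2.symm.trans h2.2)) h
  · rfl
  · rfl

theorem comp_monomial (N : ℕ∞) (m : ℕ) (α : Idx N →₀ ℕ) (c : F2a) :
    comp N (α.degree, yWeight N α) (monomial (ymon m α) c) = monomial (ymon m α) c := by
  classical
  refine YPoly.ext fun m' α' => ?_
  rw [coeff_comp, coeff_ymon_monomial]
  split_ifs with h1 h2 h2
  · rfl
  · rfl
  · exact absurd (by rw [h2.2]; exact ⟨rfl, rfl⟩) h1
  · rfl

theorem pageCyc_le_cyc (N : ℕ∞) {r : ℕ∞} {k : ℕ} (hk : (k : ℕ∞) ≤ r) (i : ℕ × ℕ) :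
    pageCyc N r i ≤ cyc N k i.1 i.2 :=
  iInf₂_le k hk

theorem bdy_le_pageBdy (N : ℕ∞) {r : ℕ∞} {k : ℕ} (hk : (k : ℕ∞) ≤ r) (i : ℕ × ℕ) :
    bdy N k i.1 i.2 ≤ pageBdy N r i :=
  le_iSup₂ (f := fun (k : ℕ) (_ : (k : ℕ∞) ≤ r) => bdy N k i.1 i.2) k hk

theorem pageCyc_le_fil (N r : ℕ∞) (i : ℕ × ℕ) : pageCyc N r i ≤ fil N i.1 i.2 :=
  (pageCyc_le_cyc N (k := 0) bot_le i).trans (cyc_le_fil N _ _ _)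

theorem mem_cyc_of_diff (N : ℕ∞) {k s p : ℕ} {f : Cob N} (hf : f ∈ fil N s p)
    (hd : diff N s f ∈ fil N (s + 1) (p + k)) : f ∈ cyc N k s p :=
  Submodule.mem_sup_left ⟨hf, hd⟩

theorem mem_pageCyc_one (N : ℕ∞) {s p : ℕ} {f : Cob N} (hf : f ∈ fil N s p)
    (hd : diff N s f ∈ fil N (s + 1) (p + 1)) : f ∈ pageCyc N 1 (s, p) := by
  simp only [pageCyc, Submodule.mem_iInf]
  intro k hk
  have hk' : k ≤ 1 := by exact_mod_cast hk
  exact mem_cyc_of_diff N hf (fil_anti N _ (by omega) hd)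

theorem mem_pageCyc_of_diff_eq_zero (N : ℕ∞) (r : ℕ∞) {s p : ℕ} {f : Cob N}
    (hf : f ∈ fil N s p) (hd : diff N s f = 0) : f ∈ pageCyc N r (s, p) := by
  simp only [pageCyc, Submodule.mem_iInf]
  intro k _
  exact mem_cyc_of_diff N hf (by rw [hd]; exact zero_mem _)

theorem fil_le_pageCyc (N r : ℕ∞) (s p : ℕ) : fil N s (p + 1) ≤ pageCyc N r (s, p) :=
  le_iInf₂ fun _ _ => le_sup_right

/-- A cochain in `Z₁` with vanishing leading term is in `B₁`. -/
theorem mem_pageBdy_of_lead (N : ℕ∞) {r : ℕ∞} (hr : 1 ≤ r) {i : ℕ × ℕ} {f : Cob N}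
    (hf : f ∈ pageCyc N r i) (h : lead N i f = 0) : f ∈ pageBdy N r i := by
  obtain ⟨s, p⟩ := i
  have hr' : ((1 : ℕ) : ℕ∞) ≤ r := by exact_mod_cast hr
  refine bdy_le_pageBdy N hr' _ ?_
  obtain ⟨f₁, ⟨hf₁, hd⟩, f₂, hf₂, rfl⟩ := Submodule.mem_sup.mp (pageCyc_le_cyc N hr' _ hf)
  rw [map_add, lead_eq_zero N hf₂, add_zero] at h
  exact add_mem (mem_bdy_one N hf₁ hd h) (fil_le_bdy N _ _ _ hf₂)

/-! ### A page as a ring of polynomials -/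

section PageEquiv

variable (N r : ℕ∞) (A : Subalgebra F2a (YPoly N)) (K : Submodule F2a (YPoly N))
  (hA : ∀ i, ∀ f ∈ pageCyc N r i, lead N i f ∈ A)
  (hB : ∀ i, ∀ f ∈ pageCyc N r i, f ∈ pageBdy N r i ↔ lead N i f ∈ K)
  {R : Type} [CommRing R] [Algebra F2a R] (q : A →ₐ[F2a] R)
  (hker : ∀ w : A, q w = 0 ↔ (w : YPoly N) ∈ K)

/-- The map from a page to `R` given by leading terms. -/
def pageMap (i : ℕ × ℕ) : Page N r i →ₗ[F2a] R :=
  Submodule.liftQ _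
    (q.toLinearMap.comp (((lead N i).comp (pageCyc N r i).subtype).codRestrict
      (Subalgebra.toSubmodule A) fun f => hA i f f.2))
    (fun f hf => (hker _).mpr ((hB i f f.2).mp hf))

theorem pageMap_mk {i : ℕ × ℕ} {f : Cob N} (hf : f ∈ pageCyc N r i) :
    pageMap N r A K hA hB q hker i (pageClass N r i f hf) = q ⟨lead N i f, hA i f hf⟩ := rfl

/-- The map from a page to the quotient by `K` given by leading terms. -/
def pageLead (i : ℕ × ℕ) : Page N r i →ₗ[F2a] YPoly N ⧸ K :=
  Submodule.liftQ _ (K.mkQ.comp ((lead N i).comp (pageCyc N r i).subtype))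
    (fun f hf => (Submodule.Quotient.mk_eq_zero K).mpr ((hB i f f.2).mp hf))

theorem pageLead_eq_zero {i : ℕ × ℕ} {z : Page N r i} (h : pageLead N r K hB i z = 0) : z = 0 := by
  induction z using Submodule.Quotient.induction_on with | _ f =>
  exact (Submodule.Quotient.mk_eq_zero _).mpr
    ((hB i f f.2).mpr ((Submodule.Quotient.mk_eq_zero K).mp h))

def totalMap : (⨁ i, Page N r i) →ₗ[F2a] R :=
  DirectSum.toModule F2a (ℕ × ℕ) R (pageMap N r A K hA hB q hker)

theorem totalMap_of (i : ℕ × ℕ) (z : Page N r i) :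
    totalMap N r A K hA hB q hker (DirectSum.of (Page N r) i z) =
      pageMap N r A K hA hB q hker i z :=
  DirectSum.toModule_lof F2a i z

theorem comp_lead (i : ℕ × ℕ) (f : Cob N) : comp N i (lead N i f) = lead N i f :=
  comp_comp N i _

/-- The total map adds up the components of `z`; this lemma recovers them modulo `K` as the
bihomogeneous components of one polynomial. Since `K` is stable under taking components, injectivity
follows. -/
theorem exists_totalMap_eq (z : ⨁ i, Page N r i) : ∃ w : A,
    totalMap N r A K hA hB q hker z = q w ∧
      ∀ i, K.mkQ (comp N i w) = pageLead N r K hB i (z i) := by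
  induction z using DirectSum.induction_on with
  | zero => exact ⟨0, by rw [map_zero, map_zero], fun i => by
      rw [ZeroMemClass.coe_zero, map_zero, map_zero, DirectSum.zero_apply, map_zero]⟩
  | of j z =>
    induction z using Submodule.Quotient.induction_on with | _ f =>
    refine ⟨⟨lead N j f, hA j f f.2⟩, totalMap_of N r A K hA hB q hker j _, fun i => ?_⟩
    by_cases h : j = i
    · subst h
      rw [DirectSum.of_eq_same, comp_lead]
      rfl
    · rw [DirectSum.of_eq_of_ne _ _ _ (Ne.symm h), map_zero]
      change K.mkQ (comp N i (lead N j f)) = 0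
      rw [← comp_lead, comp_comp_of_ne N (Ne.symm h), map_zero]
  | add z z' hz hz' =>
    obtain ⟨w, hw, hc⟩ := hz
    obtain ⟨w', hw', hc'⟩ := hz'
    refine ⟨w + w', by rw [map_add, map_add, hw, hw'], fun i => ?_⟩
    rw [AddMemClass.coe_add, map_add, map_add, hc, hc', DirectSum.add_apply, map_add]

theorem totalMap_injective (hK : ∀ i, ∀ z ∈ K, comp N i z ∈ K) :
    Function.Injective (totalMap N r A K hA hB q hker) := by
  intro z z' h
  obtain ⟨w, hw, hc⟩ := exists_totalMap_eq N r A K hA hB q hker z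
  obtain ⟨w', hw', hc'⟩ := exists_totalMap_eq N r A K hA hB q hker z'
  have hwK := (hker (w - w')).mp (by rw [map_sub, ← hw, ← hw', h, sub_self])
  refine DFinsupp.ext fun i => sub_eq_zero.mp (pageLead_eq_zero N r K hB (i := i) ?_)
  refine (map_sub (pageLead N r K hB i) (z i) (z' i)).trans ?_
  rw [← hc, ← hc', ← map_sub, ← map_sub]
  exact (Submodule.Quotient.mk_eq_zero K).mpr (hK i _ hwK)

theorem totalMap_surjective (hq : Function.Surjective q)
    (hspan : Subalgebra.toSubmodule A ≤ ⨆ i, (pageCyc N r i).map (lead N i)) :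
    Function.Surjective (totalMap N r A K hA hB q hker) := by
  intro ρ
  obtain ⟨⟨w, hwA⟩, rfl⟩ := hq ρ
  obtain ⟨h, z, hz⟩ : ∃ h : w ∈ A, ∃ z, totalMap N r A K hA hB q hker z = q ⟨w, h⟩ := by
    refine Submodule.iSup_induction _
      (motive := fun w => ∃ h : w ∈ A, ∃ z, totalMap N r A K hA hB q hker z = q ⟨w, h⟩)
      (hspan hwA) ?_ ?_ ?_
    · rintro i _ ⟨f, hf, rfl⟩
      exact ⟨hA i f hf, DirectSum.of (Page N r) i (pageClass N r i f hf),
        totalMap_of N r A K hA hB q hker i _⟩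
    · exact ⟨zero_mem _, 0, by rw [map_zero]; exact (map_zero q).symm⟩
    · rintro w w' ⟨h, z, hz⟩ ⟨h', z', hz'⟩
      exact ⟨add_mem h h', z + z', by rw [map_add, hz, hz', ← map_add]; rfl⟩
  exact ⟨z, hz⟩

theorem totalMap_mul (z z' : ⨁ i, Page N r i) :
    totalMap N r A K hA hB q hker (z * z') =
      totalMap N r A K hA hB q hker z * totalMap N r A K hA hB q hker z' := by
  induction z using DirectSum.induction_on with
  | zero => rw [zero_mul, map_zero, zero_mul]
  | add z w hz hw => rw [add_mul, map_add, map_add, add_mul, hz, hw]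
  | of i z =>
    induction z' using DirectSum.induction_on with
    | zero => rw [mul_zero, map_zero, mul_zero]
    | add z w hz hw => rw [mul_add, map_add, map_add, mul_add, hz, hw]
    | of j z' =>
      induction z using Submodule.Quotient.induction_on with | _ f =>
      induction z' using Submodule.Quotient.induction_on with | _ g =>
      rw [DirectSum.of_mul_of, totalMap_of, totalMap_of, totalMap_of]
      change q ⟨lead N (i + j) (cup N i.1 f g), _⟩ = q ⟨lead N i f, _⟩ * q ⟨lead N j g, _⟩
      rw [← map_mul]
      exact congrArg q (Subtype.ext (comp_toKosz_cup N (pageCyc_le_fil N r i f.2)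
        (pageCyc_le_fil N r j g.2)))

end PageEquiv

/-- Used twice: for `E₁` with all polynomials and `K = 0`, and for `E_∞` with `answerSub` and
`torsionSub`. -/
theorem exists_pageEquiv (N r : ℕ∞) (A : Subalgebra F2a (YPoly N)) (K : Submodule F2a (YPoly N))
    (hA : ∀ i, ∀ f ∈ pageCyc N r i, lead N i f ∈ A)
    (hB : ∀ i, ∀ f ∈ pageCyc N r i, f ∈ pageBdy N r i ↔ lead N i f ∈ K)
    {R : Type} [CommRing R] [Algebra F2a R] (q : A →ₐ[F2a] R)
    (hker : ∀ w : A, q w = 0 ↔ (w : YPoly N) ∈ K) (hK : ∀ i, ∀ z ∈ K, comp N i z ∈ K) (hq : Function.Surjective q)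
    (hspan : Subalgebra.toSubmodule A ≤ ⨆ i, (pageCyc N r i).map (lead N i)) :
    ∃ Ψ : R ≃+* ⨁ i, Page N r i, (∀ (c : F2a) (ρ : R), Ψ (c • ρ) = c • Ψ ρ) ∧
      ∀ i f (hf : f ∈ pageCyc N r i) (w : A), (w : YPoly N) = lead N i f →
        Ψ (q w) = DirectSum.of (Page N r) i (pageClass N r i f hf) := by
  let T : (⨁ i, Page N r i) →ₙ+* R :=
    { toFun := totalMap N r A K hA hB q hker
      map_mul' := totalMap_mul N r A K hA hB q hker
      map_zero' := map_zero _
      map_add' := map_add _ }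
  let Ψ : (⨁ i, Page N r i) ≃+* R := RingEquiv.ofBijective T
    ⟨totalMap_injective N r A K hA hB q hker hK, totalMap_surjective N r A K hA hB q hker hq hspan⟩
  have hΨ : ∀ z, Ψ z = totalMap N r A K hA hB q hker z := fun _ => rfl
  refine ⟨Ψ.symm, fun c ρ => ?_, fun i f hf w hw => ?_⟩
  · apply Ψ.injective
    rw [RingEquiv.apply_symm_apply, hΨ, map_smul, ← hΨ, RingEquiv.apply_symm_apply]
  · apply Ψ.injective
    rw [RingEquiv.apply_symm_apply, hΨ, totalMap_of, pageMap_mk]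
    exact congrArg q (Subtype.ext hw)

/-! ### The first page -/

/-- A boundary in `B₁` is `d b` with `b ∈ F^p` up to `F^(p+1)`, and the Koszul differential strictly
raises the filtration. The converse is the homotopy. -/
theorem mem_pageBdy_one_iff (N : ℕ∞) (i : ℕ × ℕ) {f : Cob N} (hf : f ∈ pageCyc N 1 i) :
    f ∈ pageBdy N 1 i ↔ lead N i f = 0 := by
  refine ⟨fun h => ?_, mem_pageBdy_of_lead N le_rfl hf⟩
  obtain ⟨s, p⟩ := i
  have hle : pageBdy N 1 (s, p) ≤ LinearMap.ker (lead N (s, p)) := by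
    refine iSup₂_le fun k hk => sup_le ?_ fun f hf => lead_eq_zero N hf
    have hk' : k ≤ 1 := by exact_mod_cast hk
    rintro f ⟨-, hf⟩
    cases s with
    | zero =>
      rw [(Submodule.mem_bot F2a).mp hf]
      exact zero_mem _
    | succ s =>
      obtain ⟨b, hb, rfl⟩ := hf
      change comp N (s + 1, p) (toKosz N (s + 1) (diff N s b)) = 0
      rw [toKosz_diff N s hb.2]
      refine comp_eq_zero N (filK_anti N _ ?_ (koszulD_mem N (toKosz_mem N hb)))
      change p + 1 ≤ p + 1 - k + 1
      omega
  exact hle h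

theorem monomial_mem_lead_one (N : ℕ∞) (m : ℕ) (α : Idx N →₀ ℕ) :
    ∃ i, ∃ f ∈ pageCyc N 1 i, lead N i f = monomial (ymon m α) 1 := by
  obtain ⟨c, hc, hd, e⟩ := exists_lift_one N m α
  refine ⟨(α.degree, yWeight N α), c, mem_pageCyc_one N hc hd, ?_⟩
  rw [lead_apply, e, comp_monomial]

theorem lead_uu_pow (N : ℕ∞) (m : ℕ) : lead N (0, 0) (uu N ^ m) = X YVar.u ^ m := by
  rw [lead_apply, toKosz_uu_pow, MvPolynomial.X_pow_eq_monomial, ← ymon_single_u]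
  have h := comp_monomial N m 0 1
  rwa [map_zero, map_zero] at h

theorem lead_uu_pow_mul_xx (N : ℕ∞) (m : ℕ) (r : Idx N) :
    lead N (1, 2 ^ r.1) (uu N ^ m * xx N 0 ^ 2 ^ r.1) =
      monomial (ymon m (Finsupp.single r 1)) 1 := by
  have h := toKosz_mul_xx N (uu_pow_mem N m).2 r
  rw [zero_add, toKosz_uu_pow, MvPolynomial.monomial_mul, ← ymon_add, add_zero, zero_add,
    mul_one] at h
  rw [lead_apply, h]
  have h' := comp_monomial N m (Finsupp.single r 1) 1
  rwa [Finsupp.degree_single, yWeight_single, one_mul] at h'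

theorem page_one (N : ℕ∞) : ∃ Ψ : YPoly N ≃+* ⨁ i, Page N 1 i,
    (∀ (c : F2a) (f : YPoly N), Ψ (c • f) = c • Ψ f) ∧
    ∀ i f (hf : f ∈ pageCyc N 1 i),
      Ψ (lead N i f) = DirectSum.of (Page N 1) i (pageClass N 1 i f hf) := by
  obtain ⟨Ψ, h1, h2⟩ := exists_pageEquiv N 1 ⊤ ⊥ (fun _ _ _ => trivial)
    (fun i f hf => (mem_pageBdy_one_iff N i hf).trans (Submodule.mem_bot F2a).symm)
    (⊤ : Subalgebra F2a (YPoly N)).val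
    (fun w => (Submodule.mem_bot F2a).symm)
    (fun i z hz => by
      rw [(Submodule.mem_bot F2a).mp hz, map_zero]
      exact zero_mem _)
    (fun z => ⟨⟨z, trivial⟩, rfl⟩)
    (fun z _ => by
      refine YPoly.induction (p := fun z => z ∈ ⨆ i, (pageCyc N 1 i).map (lead N i))
        (fun _ _ => add_mem) (fun c f => Submodule.smul_mem _ c) (fun m α => ?_) z
      obtain ⟨i, f, hf, e⟩ := monomial_mem_lead_one N m α
      exact Submodule.mem_iSup_of_mem i ⟨f, hf, e⟩)
  exact ⟨Ψ, h1, fun i f hf => h2 i f hf ⟨lead N i f, trivial⟩ rfl⟩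

/-! ### The canonical cocycles -/

theorem YPoly.map_eq_sum {N : ℕ∞} {M : Type} [AddCommGroup M] [Module F2a M]
    (L : YPoly N →ₗ[F2a] M) (z : YPoly N) :
    L z = ∑ μ ∈ z.support, coeff μ z • L (monomial μ 1) := by
  conv_lhs => rw [z.as_sum]
  rw [map_sum]
  refine Finset.sum_congr rfl fun μ _ => ?_
  rw [← map_smul, MvPolynomial.smul_monomial, smul_eq_mul, mul_one]

/-- A cocycle with leading term `u^m y^α`. -/
def liftCocycle (N : ℕ∞) {m : ℕ} {α : Idx N →₀ ℕ} (h : IsGood m α) : Cob N :=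
  (exists_lift N h).choose

open Classical in
theorem liftCocycle_spec (N : ℕ∞) {m : ℕ} {α : Idx N →₀ ℕ} (h : IsGood m α) :
    liftCocycle N h ∈ fil N α.degree (yWeight N α) ∧ diff N α.degree (liftCocycle N h) = 0 ∧
      (∀ m' (α' : Idx N →₀ ℕ), IsGood m' α' →
        coeff (ymon m' α') (toKosz N α.degree (liftCocycle N h)) =
          if m = m' ∧ α = α' then 1 else 0) ∧
      ∀ t, IsLow α t → F2a.a ^ 2 ^ (t.1 + 1) • liftCocycle N h ∈ bound N α.degree 0 :=
  (exists_lift N h).choose_spec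

open Classical in
/-- The linear map to `s`-cocycles that sends the monomials of degree `s` of `answerSub` to
cocycles that they are the leading terms of, and the other monomials to zero. -/
def toCocycle (N : ℕ∞) (s : ℕ) : YPoly N →ₗ[F2a] Cob N :=
  (MvPolynomial.basisMonomials (YVar N) F2a).constr F2a fun μ =>
    if h : IsGood (μ YVar.u) (yPart μ) ∧ (yPart μ).degree = s then liftCocycle N h.1 else 0

open Classical in
theorem toCocycle_monomial (N : ℕ∞) (s m : ℕ) (α : Idx N →₀ ℕ) :
    toCocycle N s (monomial (ymon m α) 1) =
      if h : IsGood m α ∧ α.degree = s then liftCocycle N h.1 else 0 := by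
  have h := (MvPolynomial.basisMonomials (YVar N) F2a).constr_basis F2a (fun μ =>
    if h : IsGood (μ YVar.u) (yPart μ) ∧ (yPart μ).degree = s then liftCocycle N h.1 else 0)
    (ymon m α)
  rw [MvPolynomial.coe_basisMonomials] at h
  refine h.trans ?_
  simp only [ymon_u, yPart_ymon]

theorem toCocycle_induction (N : ℕ∞) (s : ℕ) {P : Cob N → Prop} (h0 : P 0)
    (h : ∀ m (α : Idx N →₀ ℕ) (hg : IsGood m α), α.degree = s → P (liftCocycle N hg))
    (m : ℕ) (α : Idx N →₀ ℕ) : P (toCocycle N s (monomial (ymon m α) 1)) := by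
  rw [toCocycle_monomial]
  split_ifs with hg
  · exact h m α hg.1 hg.2
  · exact h0

theorem toCocycle_mem_cocycles (N : ℕ∞) (s : ℕ) (z : YPoly N) :
    toCocycle N s z ∈ cocycles N s := by
  refine YPoly.induction (p := fun z => toCocycle N s z ∈ cocycles N s) ?_ ?_ ?_ z
  · intro f g hf hg
    rw [map_add]; exact add_mem hf hg
  · intro c f hf
    rw [map_smul]; exact Submodule.smul_mem _ c hf
  · refine toCocycle_induction N s (P := fun c => c ∈ cocycles N s) (zero_mem _) ?_
    rintro m α hg rfl
    exact ⟨(liftCocycle_spec N hg).1.2, (liftCocycle_spec N hg).2.1⟩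

/-- The canonical cocycles form a dual system to the good coefficients, so a combination of them can
be read off from its Koszul image despite its bad terms. -/
theorem coeff_toKosz_toCocycle (N : ℕ∞) (s : ℕ) (z : YPoly N) {m : ℕ} {α : Idx N →₀ ℕ}
    (hg : IsGood m α) (hs : α.degree = s) :
    coeff (ymon m α) (toKosz N s (toCocycle N s z)) = coeff (ymon m α) z := by
  classical
  refine YPoly.induction (p := fun z => coeff (ymon m α) (toKosz N s (toCocycle N s z)) =
    coeff (ymon m α) z) ?_ ?_ ?_ z
  · intro f g hf hg
    rw [map_add, toKosz_add, MvPolynomial.coeff_add, MvPolynomial.coeff_add, hf, hg]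
  · intro c f hf
    rw [map_smul, toKosz_smul, MvPolynomial.coeff_smul, MvPolynomial.coeff_smul, hf]
  · intro m' α'
    rw [toCocycle_monomial, coeff_ymon_monomial]
    split_ifs with h h' h'
    · obtain ⟨rfl, rfl⟩ := h'
      obtain ⟨h1, rfl⟩ := h
      rw [(liftCocycle_spec N h1).2.2.1 _ _ hg, if_pos ⟨rfl, rfl⟩]
    · obtain ⟨h1, rfl⟩ := h
      rw [(liftCocycle_spec N h1).2.2.1 _ _ hg, if_neg h']
    · obtain ⟨rfl, rfl⟩ := h'
      exact absurd ⟨hg, hs⟩ h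
    · rw [← zero_smul F2a (0 : Cob N), toKosz_smul, zero_smul, MvPolynomial.coeff_zero]

/-- The divisor of each coefficient is exactly the power of `a` that kills the canonical cocycle in
`Ext`. -/
theorem toCocycle_mem_bound (N : ℕ∞) (s : ℕ) {z : YPoly N} (hz : z ∈ torsionSub N) :
    toCocycle N s z ∈ bound N s 0 := by
  rw [YPoly.map_eq_sum]
  refine sum_mem fun μ hμ => ?_
  have hμ' := MvPolynomial.mem_support_iff.mp hμ
  rw [← ymon_yPart μ] at hμ' ⊢
  have hne : yPart μ ≠ 0 := fun h => hμ' ((hz _ _).1 h)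
  obtain ⟨t, ht⟩ := exists_isLow hne
  obtain ⟨d, hd⟩ := (hz (μ YVar.u) (yPart μ)).2 t ht
  rw [toCocycle_monomial]
  split_ifs with h
  · obtain ⟨hg, rfl⟩ := h
    rw [hd, mul_comm, mul_smul]
    exact Submodule.smul_mem _ d ((liftCocycle_spec N hg).2.2.2 t ht)
  · rw [smul_zero]; exact zero_mem _

theorem toCocycle_mem_fil (N : ℕ∞) {s p : ℕ} {z : YPoly N} (hz : z ∈ filK N s p) :
    toCocycle N s z ∈ fil N s p := by
  rw [YPoly.map_eq_sum]
  refine sum_mem fun μ hμ => Submodule.smul_mem _ _ ?_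
  have hμ' := MvPolynomial.mem_support_iff.mp hμ
  rw [← ymon_yPart μ] at hμ' ⊢
  have hp := (hz _ _ hμ').2
  rw [toCocycle_monomial]
  split_ifs with h
  · obtain ⟨hg, rfl⟩ := h
    exact fil_anti N _ hp (liftCocycle_spec N hg).1
  · exact zero_mem _

theorem toCocycle_eq_zero (N : ℕ∞) {s t : ℕ} (hst : s ≠ t) {z : YPoly N} (hz : z ∈ filK N s 0) :
    toCocycle N t z = 0 := by
  rw [YPoly.map_eq_sum]
  refine Finset.sum_eq_zero fun μ hμ => ?_
  have hμ' := MvPolynomial.mem_support_iff.mp hμ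
  rw [← ymon_yPart μ] at hμ' ⊢
  have hp := (hz _ _ hμ').1
  rw [toCocycle_monomial, dif_neg, smul_zero]
  rintro ⟨-, h⟩
  exact hst (hp.symm.trans h)

/-! ### The page `E_∞` -/

/-- A bad monomial in the leading term would support a differential `d_(2^t)`: the coefficient of
its good partner in the Koszul differential is `a^(2^(t+1))` times its own, with no other
contribution. -/
theorem lead_mem_goodSub (N : ℕ∞) (i : ℕ × ℕ) {f : Cob N} (hf : f ∈ pageCyc N ⊤ i) :
    lead N i f ∈ goodSub N := by
  classical
  obtain ⟨s, p⟩ := i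
  intro m α hne
  by_contra hg
  obtain ⟨t, h1, h2, h3⟩ := exists_of_not_isGood hg
  -- The partner has weight `p + 2^t`, so `k = 2^t + 1` is what forces its coefficient in `d f₁` to
  -- vanish.
  obtain ⟨f₁, ⟨hf₁, hd⟩, f₂, hf₂, rfl⟩ :=
    Submodule.mem_sup.mp (pageCyc_le_cyc N (k := 2 ^ t.1 + 1) le_top _ hf)
  rw [map_add, lead_eq_zero N hf₂, add_zero, lead_apply, coeff_comp] at hne
  split_ifs at hne with hb
  · obtain ⟨rfl, rfl⟩ := hb
    have e := coeff_koszulD_bad N h1 h2 h3 (z := toKosz N α.degree f₁) fun m' α' _ hlt => by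
      by_contra hne'
      exact absurd ((toKosz_mem N hf₁) m' α' hne').2 (not_le.mpr hlt)
    rw [← toKosz_diff N _ hf₁.2] at e
    have h0 : coeff (ymon (m - 2 ^ t.1) (α + Finsupp.single t 1))
        (toKosz N (α.degree + 1) (diff N α.degree f₁)) = 0 := by
      by_contra hne'
      have := ((toKosz_mem N hd) _ _ hne').2
      rw [map_add, yWeight_single, one_mul] at this
      change yWeight N α + (2 ^ t.1 + 1) ≤ _ at this
      omega
    rw [h0] at e
    exact hne ((mul_eq_zero.mp e.symm).resolve_left (pow_ne_zero _ F2a.a_ne_zero))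
  · exact hne rfl

theorem comp_mem_torsionSub (N : ℕ∞) (i : ℕ × ℕ) {z : YPoly N} (hz : z ∈ torsionSub N) :
    comp N i z ∈ torsionSub N := by
  classical
  intro m α
  rw [coeff_comp]
  split_ifs
  · exact hz m α
  · exact ⟨fun _ => rfl, fun _ _ => dvd_zero _⟩

theorem koszulD_mem_torsionSub (N : ℕ∞) (z : YPoly N) : koszulD N z ∈ torsionSub N :=
  fun m α => ⟨fun h => by rw [h, coeff_koszulD_zero], fun t ht => coeff_koszulD_dvd N m ht z⟩

theorem toKosz_bound_mem (N : ℕ∞) {s p : ℕ} {f : Cob N} (hf : f ∈ bound N s p) :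
    toKosz N s f ∈ torsionSub N := by
  cases s with
  | zero =>
    rw [(Submodule.mem_bot F2a).mp hf, ← zero_smul F2a (0 : Cob N), toKosz_smul, zero_smul]
    exact zero_mem _
  | succ s =>
    obtain ⟨b, hb, rfl⟩ := hf
    rw [toKosz_diff N s hb.2]
    exact koszulD_mem_torsionSub N _

/-- Good coefficients agree by the dual system. Bad ones vanish on both sides, on the left because a
cocycle is a permanent cycle. -/
theorem lead_toCocycle (N : ℕ∞) {s p : ℕ} {z : YPoly N} (hz : z ∈ goodSub N)
    (hc : comp N (s, p) z = z) : lead N (s, p) (toCocycle N s z) = z := by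
  classical
  have hz' : z ∈ filK N s p := hc ▸ comp_mem_filK N s p z
  have hG := lead_mem_goodSub N (s, p) (mem_pageCyc_of_diff_eq_zero N ⊤ (toCocycle_mem_fil N hz')
    (toCocycle_mem_cocycles N s z).2)
  refine YPoly.ext fun m α => ?_
  by_cases hg : IsGood m α
  · conv_rhs => rw [← hc]
    rw [lead_apply, coeff_comp, coeff_comp]
    split_ifs with h
    · exact coeff_toKosz_toCocycle N s z hg h.1
    · rfl
  · rw [not_not.mp (mt (hG m α) hg), not_not.mp (mt (hz m α) hg)]

theorem toCocycle_mem_pageCyc (N : ℕ∞) {s p : ℕ} {z : YPoly N} (hz : z ∈ filK N s p) :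
    toCocycle N s z ∈ pageCyc N ⊤ (s, p) :=
  mem_pageCyc_of_diff_eq_zero N ⊤ (toCocycle_mem_fil N hz) (toCocycle_mem_cocycles N s z).2

/-- Hence every class of `E_∞` is represented by the canonical cocycle of its leading term; this
defines the map to `Ext`. -/
theorem sub_toCocycle_mem_pageBdy (N : ℕ∞) (s p : ℕ) {f : Cob N} (hf : f ∈ pageCyc N ⊤ (s, p)) :
    f - toCocycle N s (lead N (s, p) f) ∈ pageBdy N ⊤ (s, p) := by
  refine mem_pageBdy_of_lead N le_top
    (sub_mem hf (toCocycle_mem_pageCyc N (comp_mem_filK N s p _))) ?_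
  rw [map_sub, lead_toCocycle N (lead_mem_goodSub N _ hf) (comp_lead N _ f), sub_self]

theorem mem_pageBdy_top_iff (N : ℕ∞) (i : ℕ × ℕ) {f : Cob N} (hf : f ∈ pageCyc N ⊤ i) :
    f ∈ pageBdy N ⊤ i ↔ lead N i f ∈ torsionSub N := by
  obtain ⟨s, p⟩ := i
  constructor
  · have hle : pageBdy N ⊤ (s, p) ≤ (torsionSub N).comap (lead N (s, p)) := by
      refine iSup₂_le fun k _ => sup_le (fun f hf => ?_) fun f hf => ?_
      · exact comp_mem_torsionSub N _ (toKosz_bound_mem N hf.2)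
      · change lead N (s, p) f ∈ torsionSub N
        rw [lead_eq_zero N hf]
        exact zero_mem _
    exact fun h => hle h
  · intro h
    have h1 : toCocycle N s (lead N (s, p) f) ∈ pageBdy N ⊤ (s, p) := by
      -- With `k = p + 1` the filtration `p + 1 - k` imposed on the bounding cochain is zero, so
      -- every coboundary in `F^p` is admitted.
      refine bdy_le_pageBdy N (k := p + 1) le_top _ (Submodule.mem_sup_left
        ⟨toCocycle_mem_fil N (comp_mem_filK N s p _), ?_⟩)
      change _ ∈ bound N s (p + 1 - (p + 1))
      rw [Nat.sub_self]
      exact toCocycle_mem_bound N s h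
    have h2 := add_mem (sub_toCocycle_mem_pageBdy N s p hf) h1
    rwa [sub_add_cancel] at h2

theorem page_top (N : ℕ∞) : ∃ Φ : Answer N ≃+* ⨁ i, Page N ⊤ i,
    (∀ (c : F2a) (f : Answer N), Φ (c • f) = c • Φ f) ∧
    ∀ i f (hf : f ∈ pageCyc N ⊤ i) (w : answerSub N), (w : YPoly N) = lead N i f →
      Φ (Ideal.Quotient.mk (answerIdeal N) w) =
        DirectSum.of (Page N ⊤) i (pageClass N ⊤ i f hf) := by
  have hspan : Subalgebra.toSubmodule (answerSub N) ≤ ⨆ i, (pageCyc N ⊤ i).map (lead N i) := by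
    intro z hz
    refine goodSub_induction (P := fun z => z ∈ ⨆ i, (pageCyc N ⊤ i).map (lead N i))
      (zero_mem _) (fun _ _ => add_mem) (fun m α hg c => ?_) ((mem_answerSub_iff N z).mp hz)
    refine Submodule.mem_iSup_of_mem (α.degree, yWeight N α)
      ⟨_, toCocycle_mem_pageCyc N (monomial_mem_filK N (m := m) rfl le_rfl c), ?_⟩
    exact lead_toCocycle N (monomial_mem_goodSub N hg c) (comp_monomial N m α c)
  let q : answerSub N →ₐ[F2a] Answer N := Ideal.Quotient.mkₐ F2a (answerIdeal N)
  have hq : Function.Surjective q :=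
    Ideal.Quotient.mkₐ_surjective F2a _
  have hker : ∀ w : answerSub N, q w = 0 ↔ (w : YPoly N) ∈ torsionSub N :=
    fun w => Ideal.Quotient.eq_zero_iff_mem.trans (mem_answerIdeal_iff N w)
  obtain ⟨Φ, h1, h2⟩ := exists_pageEquiv (R := Answer N) N ⊤ (answerSub N) (torsionSub N)
    (fun i f hf => (mem_answerSub_iff N _).mpr (lead_mem_goodSub N i hf))
    (fun i f hf => mem_pageBdy_top_iff N i hf) q hker
    (fun i z hz => comp_mem_torsionSub N i hz) hq hspan
  refine ⟨Φ, h1, h2⟩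

/-- The cochain itself need not be a cocycle, but it differs from the divided coboundary of
`u^(2^(r+1) m + 2^r)` by an element of higher filtration. -/
theorem uu_pow_mul_xx_mem_pageCyc (N : ℕ∞) (r m : ℕ) :
    uu N ^ (2 ^ (r + 1) * m) * xx N 0 ^ 2 ^ r ∈ pageCyc N ⊤ (1, 2 ^ r) := by
  obtain ⟨c, hc, hdc, hsub⟩ := exists_divided_diff N (t := r) (Dvd.intro m rfl)
  have hd : diff N 1 c = 0 := by
    have h0 := diff_diff N 0 (uu_pow_mem N (2 ^ (r + 1) * m + 2 ^ r)).2
    have ha : F2a.a ^ 2 ^ (r + 1) ≠ 0 := pow_ne_zero _ F2a.a_ne_zero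
    refine smul_eq_zero_of_ne N ha ?_
    rw [← map_smul, hdc]
    exact h0
  have h := sub_mem (mem_pageCyc_of_diff_eq_zero N ⊤ hc hd) (fil_le_pageCyc N ⊤ _ _ hsub)
  rwa [sub_sub_cancel] at h

theorem uu_pow_mem_pageCyc (N : ℕ∞) (n : ℕ) (hn : N = n) :
    uu N ^ 2 ^ n ∈ pageCyc N ⊤ (0, 0) :=
  mem_pageCyc_of_diff_eq_zero N ⊤ (uu_pow_mem N _)
    (diff_uu_pow_eq_zero fun r _ => pow_dvd_pow 2 (r.lt hn))

/-! ### Convergence -/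

/-- The map from polynomials to `Ext` given by `toCocycle`. -/
def extMap (N : ℕ∞) (s : ℕ) : YPoly N →ₗ[F2a] CobarExt N s :=
  (Submodule.mkQ _).comp ((toCocycle N s).codRestrict (cocycles N s) (toCocycle_mem_cocycles N s))

theorem extMap_eq_zero_iff (N : ℕ∞) (s : ℕ) (z : YPoly N) :
    extMap N s z = 0 ↔ toCocycle N s z ∈ bound N s 0 :=
  Submodule.Quotient.mk_eq_zero _

/-- Coboundaries have Koszul images in `torsionSub`, and at good indices these images have the
coefficients of `z` itself. This is injectivity of the map from `E_∞` to `Ext`. -/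
theorem mem_torsionSub_of_extMap (N : ℕ∞) {z : YPoly N} (hz : z ∈ goodSub N)
    (h : ∀ s, extMap N s z = 0) : z ∈ torsionSub N := by
  intro m α
  have h1 := toKosz_bound_mem N ((extMap_eq_zero_iff N α.degree z).mp (h _)) m α
  by_cases hg : IsGood m α
  · rwa [coeff_toKosz_toCocycle N α.degree z hg rfl] at h1
  · rw [not_not.mp (mt (hz m α) hg)]
    exact ⟨fun _ => rfl, fun _ _ => dvd_zero _⟩

/-- Every cocycle is cohomologous to a combination of the canonical ones. -/
theorem exists_sub_toCocycle_mem (N : ℕ∞) {s : ℕ} {f : Cob N} (hf : f ∈ cocycles N s) :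
    ∃ z ∈ goodSub N, z ∈ filK N s 0 ∧ f - toCocycle N s z ∈ bound N s 0 := by
  classical
  let w := toKosz N s f
  have hw : w ∈ filK N s 0 := toKosz_mem N ((mem_fil_zero N).mpr hf.1)
  -- The good part of the Koszul image. Subtracting its canonical cocycle leaves a cocycle whose
  -- Koszul image `v` has only bad terms.
  let z : YPoly N := ∑ μ ∈ w.support with IsGood (μ YVar.u) (yPart μ), monomial μ (coeff μ w)
  have hz : ∀ m α, coeff (ymon m α) z = if IsGood m α then coeff (ymon m α) w else 0 := by
    intro m α
    simp only [z, MvPolynomial.coeff_sum, MvPolynomial.coeff_monomial]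
    rw [Finset.sum_ite_eq']
    simp only [Finset.mem_filter, MvPolynomial.mem_support_iff, ymon_u, yPart_ymon]
    split_ifs with h1 h2 h2
    · rfl
    · exact absurd h1.2 h2
    · by_contra hne
      exact h1 ⟨fun h => hne h.symm, h2⟩
    · rfl
  have hzg : z ∈ goodSub N := fun m α hne => by
    rw [hz] at hne
    by_contra h
    exact hne (if_neg h)
  have hzf : z ∈ filK N s 0 := fun m α hne => by
    refine hw m α fun h => hne ?_
    rw [hz, if_pos (hzg m α hne), h]
  refine ⟨z, hzg, hzf, ?_⟩
  have hcoc := sub_mem hf (toCocycle_mem_cocycles N s z)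
  refine mem_bound_of_toKosz N hcoc ?_
  let v := toKosz N s (f - toCocycle N s z)
  have hv : v = w - toKosz N s (toCocycle N s z) := by
    refine eq_sub_of_add_eq ?_
    rw [← toKosz_add, sub_add_cancel]
  have hvg : ∀ m α, IsGood m α → coeff (ymon m α) v = 0 := by
    intro m α hg
    by_cases hs : α.degree = s
    · rw [hv, MvPolynomial.coeff_sub, coeff_toKosz_toCocycle N s z hg hs, hz, if_pos hg, sub_self]
    · by_contra hne
      exact hs ((toKosz_mem N ((mem_fil_zero N).mpr hcoc.1)) m α hne).1
  refine YPoly.ext fun m α => ?_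
  rw [MvPolynomial.coeff_zero]
  by_cases hg : IsGood m α
  · exact hvg m α hg
  · obtain ⟨t, h1, h2, h3⟩ := exists_of_not_isGood hg
    -- The Koszul differential of `v` vanishes and `v` has no good terms, so the matching kills its
    -- bad coefficients as well.
    have e := coeff_koszulD_bad N h1 h2 h3 (z := v) fun m' α' hg' _ => hvg m' α' hg'
    have hd : diff N s (f - toCocycle N s z) = 0 := hcoc.2
    rw [← toKosz_diff N s hcoc.1, hd, ← zero_smul F2a (0 : Cob N), toKosz_smul, zero_smul,
      MvPolynomial.coeff_zero] at e
    exact (mul_eq_zero.mp e.symm).resolve_left (pow_ne_zero _ F2a.a_ne_zero)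

/-- The map `E_∞^{s,p} → Ext^s` given by the canonical cocycles. -/
def pageExt (N : ℕ∞) (i : ℕ × ℕ) : Page N ⊤ i →ₗ[F2a] CobarExt N i.1 :=
  Submodule.liftQ _ ((extMap N i.1).comp ((lead N i).comp (pageCyc N ⊤ i).subtype))
    (fun f hf => (extMap_eq_zero_iff N i.1 _).mpr
      (toCocycle_mem_bound N i.1 ((mem_pageBdy_top_iff N i f.2).mp hf)))

theorem pageExt_mk (N : ℕ∞) (i : ℕ × ℕ) {f : Cob N} (hf : f ∈ pageCyc N ⊤ i) :
    pageExt N i (pageClass N ⊤ i f hf) = extMap N i.1 (lead N i f) := rfl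

def totalExt (N : ℕ∞) : (⨁ i, Page N ⊤ i) →ₗ[F2a] ⨁ s, CobarExt N s :=
  DirectSum.toModule F2a (ℕ × ℕ) _ fun i =>
    (DirectSum.lof F2a ℕ (CobarExt N) i.1).comp (pageExt N i)

theorem totalExt_of (N : ℕ∞) (i : ℕ × ℕ) (z : Page N ⊤ i) :
    totalExt N (DirectSum.of (Page N ⊤) i z) = DirectSum.of (CobarExt N) i.1 (pageExt N i z) :=
  DirectSum.toModule_lof F2a i z

/-- The analogue for `Ext` of the description of the total page: one polynomial records both the
image of `z` and, modulo torsion, its components. -/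
theorem exists_totalExt_eq (N : ℕ∞) (z : ⨁ i, Page N ⊤ i) : ∃ w ∈ goodSub N,
    (∀ s, totalExt N z s = extMap N s w) ∧
      ∀ i, (torsionSub N).mkQ (comp N i w) =
        pageLead N ⊤ (torsionSub N) (fun i _ => mem_pageBdy_top_iff N i) i (z i) := by
  induction z using DirectSum.induction_on with
  | zero =>
    refine ⟨0, zero_mem _, fun s => ?_, fun i => ?_⟩
    · rw [map_zero, map_zero, DirectSum.zero_apply]
    · rw [map_zero, map_zero, DirectSum.zero_apply, map_zero]
  | of j z =>
    induction z using Submodule.Quotient.induction_on with | _ f =>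
    refine ⟨lead N j f, lead_mem_goodSub N j f.2, fun s => ?_, fun i => ?_⟩
    · rw [totalExt_of]
      by_cases h : j.1 = s
      · subst h
        rw [DirectSum.of_eq_same]
        rfl
      · rw [DirectSum.of_eq_of_ne _ _ _ (Ne.symm h), eq_comm, extMap_eq_zero_iff]
        have h0 : lead N j f ∈ filK N j.1 0 :=
          filK_anti N _ (Nat.zero_le j.2) (comp_mem_filK N j.1 j.2 _)
        rw [toCocycle_eq_zero N h h0]
        exact zero_mem _
    · by_cases h : j = i
      · subst h
        rw [DirectSum.of_eq_same, comp_lead]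
        rfl
      · rw [DirectSum.of_eq_of_ne _ _ _ (Ne.symm h), map_zero, ← comp_lead,
          comp_comp_of_ne N (Ne.symm h), map_zero]
  | add z z' hz hz' =>
    obtain ⟨w, hg, hw, hc⟩ := hz
    obtain ⟨w', hg', hw', hc'⟩ := hz'
    refine ⟨w + w', add_mem hg hg', fun s => ?_, fun i => ?_⟩
    · rw [map_add, map_add, DirectSum.add_apply, hw, hw']
    · rw [map_add, map_add, hc, hc', DirectSum.add_apply, map_add]

theorem totalExt_injective (N : ℕ∞) : Function.Injective (totalExt N) := by
  intro z z' h
  obtain ⟨w, hg, hw, hc⟩ := exists_totalExt_eq N z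
  obtain ⟨w', hg', hw', hc'⟩ := exists_totalExt_eq N z'
  have hK : w - w' ∈ torsionSub N := mem_torsionSub_of_extMap N (sub_mem hg hg') fun s => by
    rw [map_sub, ← hw, ← hw', h, sub_self]
  refine DFinsupp.ext fun i => sub_eq_zero.mp (pageLead_eq_zero N ⊤ (torsionSub N)
    (fun i _ => mem_pageBdy_top_iff N i) (i := i) ?_)
  refine (map_sub (pageLead N ⊤ (torsionSub N) _ i) (z i) (z' i)).trans ?_
  rw [← hc, ← hc', ← map_sub, ← map_sub]
  exact (Submodule.Quotient.mk_eq_zero _).mpr (comp_mem_torsionSub N i hK)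

theorem of_extMap_mem_range (N : ℕ∞) (s : ℕ) {z : YPoly N} (hz : z ∈ goodSub N)
    (hs : z ∈ filK N s 0) :
    DirectSum.lof F2a ℕ (CobarExt N) s (extMap N s z) ∈ LinearMap.range (totalExt N) := by
  rw [YPoly.map_eq_sum (extMap N s), map_sum]
  refine sum_mem fun μ hμ => ?_
  have hμ' := MvPolynomial.mem_support_iff.mp hμ
  rw [← ymon_yPart μ] at hμ' ⊢
  obtain ⟨rfl, -⟩ := hs _ _ hμ'
  have hg := hz _ _ hμ'
  rw [map_smul]
  refine Submodule.smul_mem _ _ ⟨DirectSum.of (Page N ⊤) _ (pageClass N ⊤ _ _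
    (toCocycle_mem_pageCyc N
      (monomial_mem_filK N (m := μ YVar.u) (α := yPart μ) rfl le_rfl 1))), ?_⟩
  rw [totalExt_of, pageExt_mk, lead_toCocycle N (monomial_mem_goodSub N hg 1)
    (comp_monomial N _ _ 1)]
  rfl

theorem totalExt_surjective (N : ℕ∞) : Function.Surjective (totalExt N) := by
  intro y
  change y ∈ LinearMap.range (totalExt N)
  induction y using DirectSum.induction_on with
  | zero => exact zero_mem _
  | add y y' hy hy' => exact add_mem hy hy'
  | of s y =>
    induction y using Submodule.Quotient.induction_on with | _ f =>
    obtain ⟨z, hz, hs, hb⟩ := exists_sub_toCocycle_mem N f.2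
    have e : (Submodule.Quotient.mk f : CobarExt N s) = extMap N s z :=
      (Submodule.Quotient.eq _).mpr hb
    rw [e]
    exact of_extMap_mem_range N s hz hs

end

end XAdic

/-! ### Assembly of the three statements -/

open scoped DirectSum in
theorem mainTheorem6 (N : ℕ∞) :
    -- the first page is `𝔽₂[a, u, y_r : 0 ≤ r < N]`, with `y_r` represented by `[x^(2^r)]`
    (∃ Ψ : XAdic.YPoly N ≃+* ⨁ i, XAdic.Page N 1 i,
      (∀ (c : XAdic.F2a) (f : XAdic.YPoly N), Ψ (c • f) = c • Ψ f) ∧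
      (∃ h : XAdic.uu N ∈ XAdic.pageCyc N 1 (0, 0),
        Ψ (MvPolynomial.X XAdic.YVar.u) =
          DirectSum.of (XAdic.Page N 1) (0, 0)
            (XAdic.pageClass N 1 (0, 0) (XAdic.uu N) h)) ∧
      (∀ (r : ℕ) (hr : (r : ℕ∞) < N),
        ∃ h : XAdic.xx N 0 ^ 2 ^ r ∈ XAdic.pageCyc N 1 (1, 2 ^ r),
        Ψ (MvPolynomial.X (XAdic.YVar.y r hr)) =
          DirectSum.of (XAdic.Page N 1) (1, 2 ^ r)
            (XAdic.pageClass N 1 (1, 2 ^ r) (XAdic.xx N 0 ^ 2 ^ r) h))) ∧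
    -- the ring `E_∞`
    (∃ Φ : XAdic.Answer N ≃+* ⨁ i, XAdic.Page N ⊤ i,
      (∀ (c : XAdic.F2a) (f : XAdic.Answer N), Φ (c • f) = c • Φ f) ∧
      (∀ (r : ℕ) (hr : (r : ℕ∞) < N) (m : ℕ),
        ∃ h : XAdic.uu N ^ (2 ^ (r + 1) * m) * XAdic.xx N 0 ^ 2 ^ r ∈
          XAdic.pageCyc N ⊤ (1, 2 ^ r),
        Φ (Ideal.Quotient.mk (XAdic.answerIdeal N)
            ⟨XAdic.yGen N r hr m, XAdic.yGen_mem N r hr m⟩) =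
          DirectSum.of (XAdic.Page N ⊤) (1, 2 ^ r)
            (XAdic.pageClass N ⊤ (1, 2 ^ r)
              (XAdic.uu N ^ (2 ^ (r + 1) * m) * XAdic.xx N 0 ^ 2 ^ r) h)) ∧
      (∀ (n : ℕ) (hn : N = n),
        ∃ h : XAdic.uu N ^ 2 ^ n ∈ XAdic.pageCyc N ⊤ (0, 0),
        Φ (Ideal.Quotient.mk (XAdic.answerIdeal N)
            ⟨MvPolynomial.X XAdic.YVar.u ^ 2 ^ n, XAdic.u_pow_mem N n hn⟩) =
          DirectSum.of (XAdic.Page N ⊤) (0, 0)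
            (XAdic.pageClass N ⊤ (0, 0) (XAdic.uu N ^ 2 ^ n) h))) ∧
    -- convergence to `Ext` without nontrivial `𝔽₂[a]`-module extensions
    (∃ Θ : (⨁ i, XAdic.Page N ⊤ i) ≃ₗ[XAdic.F2a] (⨁ s, XAdic.CobarExt N s),
      ∀ (s p : ℕ) (z : XAdic.Page N ⊤ (s, p)),
        ∃ (c : XAdic.Cob N) (_ : c ∈ XAdic.fil N s p) (hc : c ∈ XAdic.cocycles N s)
          (h : c ∈ XAdic.pageCyc N ⊤ (s, p)),
          XAdic.pageClass N ⊤ (s, p) c h = z ∧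
          Θ (DirectSum.of (XAdic.Page N ⊤) (s, p) z) =
            DirectSum.of (XAdic.CobarExt N) s (XAdic.extClass N s c hc)) := by
  refine ⟨?_, ?_, ?_⟩
  · obtain ⟨Ψ, h1, h2⟩ := XAdic.page_one N
    refine ⟨Ψ, h1, ?_, fun r hr => ?_⟩
    · have hm := XAdic.mem_pageCyc_one N (XAdic.uu_pow_mem N 1) (XAdic.diff_uu_pow_mem N 1)
      have e := h2 _ _ hm
      have hl := XAdic.lead_uu_pow N 1
      simp only [pow_one] at hm e hl
      exact ⟨hm, by rw [← e, hl]⟩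
    · have hm := XAdic.mem_pageCyc_one N (XAdic.xx_pow_mem_fil N (2 ^ r))
        (by rw [XAdic.diff_xx_pow]; exact zero_mem _)
      refine ⟨hm, ?_⟩
      have hl := XAdic.lead_uu_pow_mul_xx N 0 ⟨r, hr⟩
      rw [pow_zero, one_mul, XAdic.ymon_single_y] at hl
      rw [← h2 _ _ hm, hl]
      rfl
  · obtain ⟨Φ, h1, h2⟩ := XAdic.page_top N
    refine ⟨Φ, h1, fun r hr m => ?_, fun n hn => ?_⟩
    · refine ⟨XAdic.uu_pow_mul_xx_mem_pageCyc N r m, h2 _ _ _ _ ?_⟩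
      rw [XAdic.lead_uu_pow_mul_xx N _ ⟨r, hr⟩]
      exact XAdic.yGen_eq N ⟨r, hr⟩ m
    · exact ⟨XAdic.uu_pow_mem_pageCyc N n hn, h2 _ _ _ _ (XAdic.lead_uu_pow N _).symm⟩
  · refine ⟨LinearEquiv.ofBijective (XAdic.totalExt N)
      ⟨XAdic.totalExt_injective N, XAdic.totalExt_surjective N⟩, fun s p z => ?_⟩
    induction z using Submodule.Quotient.induction_on with | _ f =>
    have hfil := XAdic.comp_mem_filK N s p (XAdic.toKosz N s f)
    -- The given representative `f` need not be a cocycle, so it is replaced by the canonical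
    -- cocycle of its leading term.
    refine ⟨XAdic.toCocycle N s (XAdic.lead N (s, p) f), XAdic.toCocycle_mem_fil N hfil,
      XAdic.toCocycle_mem_cocycles N s _, XAdic.toCocycle_mem_pageCyc N hfil, ?_, ?_⟩
    · refine Eq.symm ((Submodule.Quotient.eq _).mpr ?_)
      exact XAdic.sub_toCocycle_mem_pageBdy N s p f.2
    · exact XAdic.totalExt_of N (s, p) _
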